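/- **Conventions.** All vector spaces are complex. A *bornological vector space* is a complete convex bornological vector space: a vector space $V$ with a family of bounded subsets (closed under subsets and finite unions, containing the singletons, stable under scalar multiples) in which every bounded set is contained in a bounded completant disk, i.e. a bounded absolutely convex set $T$ whose gauge is a complete norm on its linear span $\langle T\rangle$. A linear map is *bounded* if it maps bounded sets to bounded sets; $\mathrm{Hom}(V,W)$, the space of bounded linear maps, carries the equibounded bornology. A *bornological isomorphism* is a bijective linear map which is bounded together with its inverse. $V\hat\otimes W$ is the completed bornological tensor product (bounded linear maps $V\hat\otimes W\to X$ correspond to bounded bilinear maps $V\times W\to X$), and $\tau$ is the flip map. $V$ has the *approximation property* if for every disk $S\subseteq V$ that is compact in some Banach space $\langle T\rangle$, $T$ a bounded completant disk, there are bounded finite rank operators $f_n:V\to V$ converging to the identity in $\mathrm{Hom}(\langle S\rangle,V)$. A *bornological algebra* $H$ is a bornological vector space with a bounded associative multiplication $\mu:H\hat\otimes H\to H$ (no unit is assumed). It is *essential* if $H\neq 0$ and $\mu$ induces a bornological isomorphism $H\hat\otimes_H H\cong H$, where $V\hat\otimes_H W$ is the quotient of $V\hat\otimes W$ by the closed linear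 span of the elements $vh\otimes w-v\otimes hw$. The *multiplier algebra* $M(H)$ consists of the pairs $(L,R)$ of bounded linear maps $H\to H$ with $L(fg)=L(f)g$, $R(fg)=fR(g)$ and $fL(g)=R(f)g$, with the bornology inherited from $\mathrm{Hom}(H,H)\oplus\mathrm{Hom}(H,H)$; we write $m\cdot f=L(f)$ and $f\cdot m=R(f)$ for $m=(L,R)$. A bounded homomorphism $H\to M(K)$ is *essential* if it induces bornological isomorphisms $H\hat\otimes_H K\cong K$ and $K\hat\otimes_H H\cong K$; it then extends uniquely to a bounded unital homomorphism $M(H)\to M(K)$. A functional $\omega$ is *faithful* if $\omega(fg)=0$ for all $g$ implies $f=0$, and $\omega(fg)=0$ for all $f$ implies $g=0$. A *bornological quantum group* is an essential bornological algebra $H$ with the approximation property, together with a *comultiplication*, i.e. an essential homomorphism $\Delta:H\to M(H\hat\otimes H)$ with $(\Delta\hat\otimes\mathrm{id})\Delta=(\mathrm{id}\hat\otimes\Delta)\Delta$, such that the Galois maps $$\gamma_l(f\otimes g)=\Delta(f)(g\otimes 1),\quad \gamma_r(f\otimes g)=\Delta(f)(1\otimes g),\quad \rho_l(f\otimes g)=(f\otimes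 1)\Delta(g),\quad \rho_r(f\otimes g)=(1\otimes f)\Delta(g)$$ are bornological isomorphisms of $H\hat\otimes H$ onto itself, and a faithful bounded linear functional $\phi:H\to\mathbb C$ which is left invariant, $(\mathrm{id}\hat\otimes\phi)\Delta(f)=\phi(f)1$ for all $f\in H$. Here, for a bounded functional $\omega$, the slices $(\mathrm{id}\hat\otimes\omega)\Delta(f),(\omega\hat\otimes\mathrm{id})\Delta(f)\in M(H)$ are the multipliers acting on $g\in H$ from the left by $(\mathrm{id}\hat\otimes\omega)\gamma_l(f\otimes g)$, respectively $(\omega\hat\otimes\mathrm{id})\gamma_r(f\otimes g)$, and from the right by $(\mathrm{id}\hat\otimes\omega)\rho_l(g\otimes f)$, respectively $(\omega\hat\otimes\mathrm{id})\rho_r(g\otimes f)$. A *counit* $\epsilon$ and an *antipode* $S$ of $H$ are an essential bounded algebra homomorphism $\epsilon:H\to\mathbb C$ and a bornological isomorphism $S:H\to H$ which is an algebra antihomomorphism and a coalgebra antihomomorphism ($\Delta S=(S\hat\otimes S)\tau\Delta$), such that $(\epsilon\hat\otimes\mathrm{id})\Delta=\mathrm{id}=(\mathrm{id}\hat\otimes\epsilon)\Delta$,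 $\mu(S\hat\otimes\mathrm{id})\gamma_r=\epsilon\hat\otimes\mathrm{id}$ and $\mu(\mathrm{id}\hat\otimes S)\rho_l=\mathrm{id}\hat\otimes\epsilon$. **Proposition.** Let $H$ be a bornological quantum group with left invariant functional $\phi$. There is a unique algebra homomorphism $\sigma:H\to H$ with $$\phi(fg)=\phi(g\,\sigma(f))\qquad\text{for all } f,g\in H,$$ and $\sigma$ is a bornological isomorphism; so $\sigma$ is the unique bounded algebra automorphism of $H$ with this property. Moreover $\phi$ is invariant under $\sigma$, that is, $\phi(\sigma(f))=\phi(f)$ for all $f\in H$. Furthermore, $H$ has a counit $\epsilon$ and an antipode $S$, which are uniquely determined, and as a consequence $S^2\sigma=\sigma S^2$. -/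

import Mathlib

open Set Filter Topology Bornology Pointwise

noncomputable section


namespace BornQG

universe u v w

/-! ## Convex bornologies, completant disks, complete bornological vector spaces -/

section Disks

variable {V : Type*} [AddCommGroup V] [Module ℂ V]

/-- A disk is a circled convex subset of a complex vector space. -/
def IsDisk (D : Set V) : Prop := Balanced ℂ D ∧ Convex ℝ D

/-- A disk `D` is completant if its linear span, with the Minkowski functional `gauge D`,
is a Banach space. -/
structure IsCompletant (D : Set V) : Prop where
  disk : IsDisk D
  separated : ∀ x ∈ Submodule.span ℂ D, gauge D x = 0 → x = 0
  complete : ∀ u : ℕ → V, (∀ n, u n ∈ Submodule.span ℂ D) →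
    (∀ ε : ℝ, 0 < ε → ∃ N, ∀ m ≥ N, ∀ n ≥ N, gauge D (u m - u n) < ε) →
    ∃ x ∈ Submodule.span ℂ D, Tendsto (fun n => gauge D (u n - x)) atTop (𝓝 0)

/-- The sequence `u` lies in the span `⟨D⟩` of the disk `D` and converges there to `x`. -/
def ConvergesIn (D : Set V) (u : ℕ → V) (x : V) : Prop :=
  (∀ n, u n ∈ Submodule.span ℂ D) ∧ x ∈ Submodule.span ℂ D ∧
    Tendsto (fun n => gauge D (u n - x)) atTop (𝓝 0)

variable {D : Set V}

theorem IsDisk.zero_mem (hD : IsDisk D) (hn : D.Nonempty) : (0 : V) ∈ D := by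
  obtain ⟨x, hx⟩ := hn
  simpa using hD.1.smul_mem (a := (0 : ℂ)) (by simp) hx

theorem IsDisk.smul_subset (hD : IsDisk D) {r s : ℝ} (hr : 0 ≤ r) (hrs : r ≤ s) :
    r • D ⊆ s • D := by
  rintro _ ⟨d, hd, rfl⟩
  rcases hr.eq_or_lt with rfl | hr0
  · exact ⟨0, hD.zero_mem ⟨d, hd⟩, by simp⟩
  · have hs : 0 < s := hr0.trans_le hrs
    refine ⟨((r / s : ℝ) : ℂ) • d, hD.1.smul_mem ?_ hd, ?_⟩
    · rw [Complex.norm_real, Real.norm_eq_abs, abs_of_nonneg (by positivity)]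
      exact (div_le_one hs).2 hrs
    · simp only [Complex.coe_smul, smul_smul]
      congr 1
      field_simp

theorem IsDisk.add_mem (hD : IsDisk D) {r s : ℝ} (hr : 0 ≤ r) (hs : 0 ≤ s) {x y : V}
    (hx : x ∈ r • D) (hy : y ∈ s • D) : x + y ∈ (r + s) • D := by
  rw [hD.2.add_smul hr hs]
  exact Set.add_mem_add hx hy

theorem IsDisk.csmul_mem (hD : IsDisk D) {r : ℝ} {x : V} (z : ℂ)
    (hx : x ∈ r • D) : z • x ∈ (‖z‖ * r) • D := by
  obtain ⟨d, hd, rfl⟩ := hx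
  rcases eq_or_ne z 0 with rfl | hz
  · exact ⟨0, hD.zero_mem ⟨d, hd⟩, by simp⟩
  · have hz' : ‖z‖ ≠ 0 := norm_ne_zero_iff.2 hz
    refine ⟨(z / (‖z‖ : ℂ)) • d, hD.1.smul_mem ?_ hd, ?_⟩
    · simp [hz']
    · simp only [← Complex.coe_smul, smul_smul]
      congr 1
      have : (‖z‖ : ℂ) ≠ 0 := by exact_mod_cast hz'
      push_cast
      field_simp

theorem IsDisk.neg_mem (hD : IsDisk D) {r : ℝ} {x : V} (hx : x ∈ r • D) : -x ∈ r • D := by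
  simpa using hD.csmul_mem (-1) hx

theorem IsDisk.sub_mem (hD : IsDisk D) {r s : ℝ} (hr : 0 ≤ r) (hs : 0 ≤ s) {x y : V}
    (hx : x ∈ r • D) (hy : y ∈ s • D) : x - y ∈ (r + s) • D := by
  rw [sub_eq_add_neg]; exact hD.add_mem hr hs hx (hD.neg_mem hy)

theorem smul_subset_span (r : ℝ) : r • D ⊆ (Submodule.span ℂ D : Set V) := by
  rintro _ ⟨d, hd, rfl⟩
  have := (Submodule.span ℂ D).smul_mem (r : ℂ) (Submodule.subset_span hd)
  simpa using this

theorem IsDisk.exists_mem_smul (hD : IsDisk D) (hn : D.Nonempty) {x : V}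
    (hx : x ∈ Submodule.span ℂ D) : ∃ r : ℝ, 0 < r ∧ x ∈ r • D := by
  induction hx using Submodule.span_induction with
  | mem x h => exact ⟨1, one_pos, by simpa⟩
  | zero => exact ⟨1, one_pos, by simpa using hD.zero_mem hn⟩
  | add x y _ _ hx hy =>
    obtain ⟨r, hr, hx⟩ := hx
    obtain ⟨s, hs, hy⟩ := hy
    exact ⟨r + s, by positivity, hD.add_mem hr.le hs.le hx hy⟩
  | smul a x _ hx =>
    obtain ⟨r, hr, hx⟩ := hx
    exact ⟨‖a‖ * r + 1, by positivity,
      hD.smul_subset (by positivity) (by linarith) (hD.csmul_mem a hx)⟩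

theorem IsDisk.mem_smul_of_gauge_lt (hD : IsDisk D) (hn : D.Nonempty) {x : V} {r : ℝ}
    (hx : x ∈ Submodule.span ℂ D) (h : gauge D x < r) : x ∈ r • D := by
  obtain ⟨r0, hr0, hx0⟩ := hD.exists_mem_smul hn hx
  obtain ⟨s, ⟨hs, hxs⟩, hsr⟩ := exists_lt_of_csInf_lt
    (s := {r ∈ Set.Ioi (0 : ℝ) | x ∈ r • D}) ⟨r0, hr0, hx0⟩ h
  exact hD.smul_subset (le_of_lt hs) hsr.le hxs

/-- Convergence of the series `∑ 2⁻ⁿ dₙ` with terms in a disk. -/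
def HasDyadicSums (D : Set V) : Prop :=
  ∀ d : ℕ → V, (∀ n, d n ∈ D) → ∃ x, ∀ N : ℕ,
    x - ∑ n ∈ Finset.range N, ((1 / 2 : ℝ) ^ n) • d n ∈ (4 * (1 / 2 : ℝ) ^ N) • D

theorem IsDisk.dyadic_mem (hD : IsDisk D) (hn : D.Nonempty) (d : ℕ → V) (hd : ∀ n, d n ∈ D)
    (N k : ℕ) :
    ∑ n ∈ Finset.range (N + k), ((1 / 2 : ℝ) ^ n) • d n
      - ∑ n ∈ Finset.range N, ((1 / 2 : ℝ) ^ n) • d n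
      ∈ (2 * (1 / 2 : ℝ) ^ N - 2 * (1 / 2 : ℝ) ^ (N + k)) • D := by
  induction k with
  | zero => simpa using ⟨0, hD.zero_mem hn, by simp⟩
  | succ k ih =>
    have h1 : ((1 / 2 : ℝ) ^ (N + k)) • d (N + k) ∈ ((1 / 2 : ℝ) ^ (N + k)) • D :=
      Set.smul_mem_smul_set (hd _)
    have h0 : (0 : ℝ) ≤ 2 * (1 / 2 : ℝ) ^ N - 2 * (1 / 2 : ℝ) ^ (N + k) := by
      have : (1 / 2 : ℝ) ^ (N + k) ≤ (1 / 2 : ℝ) ^ N :=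
        pow_le_pow_of_le_one (by norm_num) (by norm_num) (by omega)
      linarith
    have h2 := hD.add_mem h0 (by positivity) ih h1
    have e : 2 * (1 / 2 : ℝ) ^ N - 2 * (1 / 2 : ℝ) ^ (N + (k + 1))
        = 2 * (1 / 2 : ℝ) ^ N - 2 * (1 / 2 : ℝ) ^ (N + k) + (1 / 2 : ℝ) ^ (N + k) := by
      rw [← add_assoc, pow_succ]; ring
    rw [e, ← add_assoc, Finset.sum_range_succ]
    convert h2 using 1
    abel

theorem IsCompletant.eq_zero (hD : IsCompletant D) {x : V}
    (h : ∀ ε : ℝ, 0 < ε → x ∈ ε • D) : x = 0 := by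
  refine hD.separated x (smul_subset_span 1 (h 1 one_pos)) ?_
  refine le_antisymm (le_of_forall_pos_le_add fun ε hε => ?_) (gauge_nonneg x)
  simpa using gauge_le_of_mem hε.le (h ε hε)

theorem IsCompletant.hasDyadicSums (hD : IsCompletant D) : HasDyadicSums D := by
  intro d hd
  have hn : D.Nonempty := ⟨_, hd 0⟩
  set s : ℕ → V := fun N => ∑ n ∈ Finset.range N, ((1 / 2 : ℝ) ^ n) • d n with hs
  have hspan : ∀ N, s N ∈ Submodule.span ℂ D := fun N =>
    Submodule.sum_mem _ fun n _ => smul_subset_span _ (Set.smul_mem_smul_set (hd n))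
  have key : ∀ N M, N ≤ M → s M - s N ∈ (2 * (1 / 2 : ℝ) ^ N) • D := by
    intro N M hNM
    obtain ⟨k, rfl⟩ := Nat.exists_eq_add_of_le hNM
    refine hD.disk.smul_subset ?_ ?_ (hD.disk.dyadic_mem hn d hd N k)
    · have : (1 / 2 : ℝ) ^ (N + k) ≤ (1 / 2 : ℝ) ^ N :=
        pow_le_pow_of_le_one (by norm_num) (by norm_num) (by omega)
      linarith
    · have : (0 : ℝ) ≤ (1 / 2 : ℝ) ^ (N + k) := by positivity
      linarith
  obtain ⟨x, hx, hlim⟩ := hD.complete s hspan (by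
    intro ε hε
    obtain ⟨N, hN⟩ := exists_pow_lt_of_lt_one (show 0 < ε / 4 by positivity)
      (show (1 / 2 : ℝ) < 1 by norm_num)
    refine ⟨N, fun m hm n hn' => ?_⟩
    have h := hD.disk.sub_mem (by positivity) (by positivity) (key N m hm) (key N n hn')
    rw [sub_sub_sub_cancel_right] at h
    exact (gauge_le_of_mem (by positivity) h).trans_lt (by linarith))
  refine ⟨x, fun N => ?_⟩
  have hev := hlim.eventually_lt_const (show (0 : ℝ) < (1 / 2 : ℝ) ^ N by positivity)
  obtain ⟨M, hM, hMN⟩ := (hev.and (eventually_ge_atTop N)).exists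
  have h1 := hD.disk.mem_smul_of_gauge_lt hn (Submodule.sub_mem _ (hspan M) hx) hM
  have h2 := hD.disk.sub_mem (by positivity) (by positivity) (key N M hMN) h1
  rw [show s M - s N - (s M - x) = x - s N by abel] at h2
  refine hD.disk.smul_subset (by positivity) ?_ h2
  have : (0 : ℝ) ≤ (1 / 2 : ℝ) ^ N := by positivity
  linarith

theorem IsCompletant.of_hasDyadicSums (hD : IsDisk D) (hn : D.Nonempty)
    (h0 : ∀ x, (∀ ε : ℝ, 0 < ε → x ∈ ε • D) → x = 0) (hs : HasDyadicSums D) :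
    IsCompletant D := by
  refine ⟨hD, fun x hx hg => h0 x fun ε hε =>
    hD.mem_smul_of_gauge_lt hn hx (by rw [hg]; exact hε), fun u hu hc => ?_⟩
  have hpos : ∀ k : ℕ, (0 : ℝ) < (1 / 2 : ℝ) ^ k := fun k => by positivity
  choose M hM using fun k => hc _ (hpos k)
  let P : ℕ → ℕ := fun k => (Finset.range (k + 1)).sup M
  have hP : ∀ k, M k ≤ P k := fun k => Finset.le_sup (f := M) (by simp)
  have hPm : Monotone P := fun a b hab => Finset.sup_mono (by simpa using hab)
  have hstep : ∀ k, ∀ m ≥ P k, ∀ n ≥ P k, u m - u n ∈ ((1 / 2 : ℝ) ^ k) • D :=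
    fun k m hm n hn' => hD.mem_smul_of_gauge_lt hn (Submodule.sub_mem _ (hu m) (hu n))
      (hM k m ((hP k).trans hm) n ((hP k).trans hn'))
  have hd : ∀ k, ∃ d ∈ D, ((1 / 2 : ℝ) ^ k) • d = u (P (k + 1)) - u (P k) := fun k =>
    hstep k _ (hPm (Nat.le_succ k)) _ le_rfl
  choose d hdD hde using hd
  obtain ⟨x, hx⟩ := hs d hdD
  have hsum : ∀ N, ∑ n ∈ Finset.range N, ((1 / 2 : ℝ) ^ n) • d n = u (P N) - u (P 0) := by
    intro N
    simp_rw [hde]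
    exact Finset.sum_range_sub (fun k => u (P k)) N
  have hx' : x ∈ Submodule.span ℂ D := by
    have := smul_subset_span _ (hx 0)
    simpa using this
  have hlim : ∀ k, ∀ n ≥ P k, u n - (x + u (P 0)) ∈ (5 * (1 / 2 : ℝ) ^ k) • D := by
    intro k n hn'
    have h1 := hx k
    rw [hsum] at h1
    have h2 := hD.sub_mem (by positivity) (by positivity) (hstep k n hn' _ le_rfl) h1
    rw [show u n - u (P k) - (x - (u (P k) - u (P 0))) = u n - (x + u (P 0)) by abel] at h2
    convert h2 using 2
    ring
  refine ⟨x + u (P 0), Submodule.add_mem _ hx' (hu _), ?_⟩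
  rw [Metric.tendsto_atTop]
  intro ε hε
  obtain ⟨k, hk⟩ := exists_pow_lt_of_lt_one (show 0 < ε / 5 by positivity)
      (show (1 / 2 : ℝ) < 1 by norm_num)
  refine ⟨P k, fun n hn' => ?_⟩
  rw [Real.dist_eq, sub_zero, abs_of_nonneg (gauge_nonneg _)]
  exact (gauge_le_of_mem (by positivity) (hlim k n hn')).trans_lt (by linarith)

end Disks

/-- A complete convex bornological vector space (over `ℂ`): scalar multiples of bounded ("small")
sets are bounded, and every bounded set is contained in a bounded completant disk. -/
class CompleteBornology (V : Type*) [AddCommGroup V] [Module ℂ V] [Bornology V] : Prop where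
  smul_bounded : ∀ (c : ℂ) (s : Set V), IsBounded s → IsBounded (c • s)
  exists_completant : ∀ s : Set V, IsBounded s → ∃ D, s ⊆ D ∧ IsBounded D ∧ IsCompletant D

section Basic

variable {V : Type*} [AddCommGroup V] [Module ℂ V] [Bornology V] [CompleteBornology V]

theorem isBounded_csmul (c : ℂ) {s : Set V} (h : IsBounded s) : IsBounded (c • s) :=
  CompleteBornology.smul_bounded c s h

theorem isBounded_rsmul (c : ℝ) {s : Set V} (h : IsBounded s) : IsBounded (c • s) := by
  convert isBounded_csmul (c : ℂ) h using 1
  ext x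
  simp [Set.mem_smul_set]

theorem exists_disk {s : Set V} (h : IsBounded s) :
    ∃ D, s ⊆ D ∧ D.Nonempty ∧ IsBounded D ∧ IsCompletant D := by
  obtain ⟨D, h1, h2, h3⟩ := CompleteBornology.exists_completant (s ∪ {0})
    (h.union isBounded_singleton)
  exact ⟨D, fun x hx => h1 (Or.inl hx), ⟨0, h1 (Or.inr rfl)⟩, h2, h3⟩

theorem isBounded_add {s t : Set V} (hs : IsBounded s) (ht : IsBounded t) :
    IsBounded (s + t) := by
  obtain ⟨D, h1, h2, h3, h4⟩ := exists_disk (hs.union ht)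
  refine (isBounded_rsmul 2 h3).subset ?_
  rintro _ ⟨x, hx, y, hy, rfl⟩
  have := h4.disk.add_mem zero_le_one zero_le_one
    (show x ∈ (1 : ℝ) • D by simpa using h1 (Or.inl hx))
    (show y ∈ (1 : ℝ) • D by simpa using h1 (Or.inr hy))
  norm_num at this
  exact this

/-- A subspace is closed if it contains the limits of its convergent sequences. -/
def IsBornClosed (N : Submodule ℂ V) : Prop :=
  ∀ (D : Set V) (u : ℕ → V) (x : V), IsDisk D → IsBounded D → (∀ n, u n ∈ N) →
    ConvergesIn D u x → x ∈ N

/-- The closure of a subspace: the smallest closed subspace containing it. -/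
def bornClosure (R : Submodule ℂ V) : Submodule ℂ V :=
  sInf {N | IsBornClosed N ∧ R ≤ N}

theorem le_bornClosure (R : Submodule ℂ V) : R ≤ bornClosure R :=
  le_sInf fun _ h => h.2

theorem isBornClosed_bornClosure (R : Submodule ℂ V) : IsBornClosed (bornClosure R) := by
  intro D u x hD hb hu hx
  simp only [bornClosure, Submodule.mem_sInf] at hu ⊢
  exact fun N hN => hN.1 D u x hD hb (fun n => hu n N hN) hx

theorem bornClosure_le {R N : Submodule ℂ V} (hN : IsBornClosed N) (h : R ≤ N) :
    bornClosure R ≤ N := sInf_le ⟨hN, h⟩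

theorem IsBornClosed.mem_of_approx {N : Submodule ℂ V} (hN : IsBornClosed N) {D : Set V}
    (hb : IsBounded D) {x : V}
    (h : ∀ ε : ℝ, 0 < ε → ∃ y ∈ N, x - y ∈ ε • D) : x ∈ N := by
  obtain ⟨E, hE1, hE2, hE3, hE4⟩ := exists_disk (hb.union (isBounded_singleton (x := x)))
  choose y hyN hy using fun n : ℕ => h (1 / ((n : ℝ) + 1)) (by positivity)
  have hDE : ∀ r : ℝ, r • D ⊆ r • E := fun r =>
    Set.smul_set_mono (fun z hz => hE1 (Or.inl hz))
  have hxE : x ∈ Submodule.span ℂ E := Submodule.subset_span (hE1 (Or.inr rfl))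
  have hyE : ∀ n, y n ∈ Submodule.span ℂ E := fun n => by
    have := Submodule.sub_mem _ hxE (smul_subset_span _ (hDE _ (hy n)))
    simpa using this
  refine hN E y x hE4.disk hE3 hyN ⟨hyE, hxE, ?_⟩
  refine squeeze_zero (fun n => gauge_nonneg _) (fun n => ?_)
    tendsto_one_div_add_atTop_nhds_zero_nat
  refine gauge_le_of_mem (by positivity) ?_
  rw [← neg_sub]
  exact hE4.disk.neg_mem (hDE _ (hy n))

end Basic


/-! ## Bounded linear maps -/

section BHom

variable {U V W X : Type*}
  [AddCommGroup U] [Module ℂ U] [Bornology U] [CompleteBornology U]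
  [AddCommGroup V] [Module ℂ V] [Bornology V] [CompleteBornology V]
  [AddCommGroup W] [Module ℂ W] [Bornology W] [CompleteBornology W]
  [AddCommGroup X] [Module ℂ X] [Bornology X] [CompleteBornology X]

/-- A map is bounded if it maps bounded sets to bounded sets. -/
def IsBoundedMap {α β : Type*} [Bornology α] [Bornology β] (f : α → β) : Prop :=
  ∀ s, IsBounded s → IsBounded (f '' s)

/-- A bornological isomorphism: a bijection, bounded in both directions. -/
def IsBornIso {α β : Type*} [Bornology α] [Bornology β] (f : α → β) : Prop :=
  Function.Bijective f ∧ IsBoundedMap f ∧ ∀ s, IsBounded s → IsBounded (f ⁻¹' s)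

variable (V W) in
/-- The subspace of bounded linear maps. -/
def boundedMaps : Submodule ℂ (V →ₗ[ℂ] W) where
  carrier := {f | IsBoundedMap f}
  add_mem' {f g} hf hg s hs := by
    refine (isBounded_add (hf s hs) (hg s hs)).subset ?_
    rintro _ ⟨x, hx, rfl⟩
    exact Set.add_mem_add ⟨x, hx, rfl⟩ ⟨x, hx, rfl⟩
  zero_mem' s _ := (isBounded_singleton (x := (0 : W))).subset (by rintro _ ⟨x, _, rfl⟩; rfl)
  smul_mem' c f hf s hs := by
    refine (isBounded_csmul c (hf s hs)).subset ?_
    rintro _ ⟨x, hx, rfl⟩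
    exact ⟨f x, ⟨x, hx, rfl⟩, rfl⟩

variable (V W) in
/-- The space `Hom(V, W)` of bounded linear maps. -/
def BHom : Type _ := boundedMaps V W

namespace BHom

instance : AddCommGroup (BHom V W) := inferInstanceAs (AddCommGroup (boundedMaps V W))
instance : Module ℂ (BHom V W) := inferInstanceAs (Module ℂ (boundedMaps V W))

/-- The linear map underlying a bounded linear map. -/
def toLin (f : BHom V W) : V →ₗ[ℂ] W := f.1

instance : FunLike (BHom V W) V W where
  coe f := f.toLin
  coe_injective _ _ h := Subtype.ext (DFunLike.coe_injective h)

instance : LinearMapClass (BHom V W) ℂ V W where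
  map_add f := f.toLin.map_add
  map_smulₛₗ f := f.toLin.map_smul

/-- Build a bounded linear map. -/
def mk (f : V →ₗ[ℂ] W) (hf : IsBoundedMap f) : BHom V W := ⟨f, hf⟩

@[simp] theorem mk_apply (f : V →ₗ[ℂ] W) (hf : IsBoundedMap f) (x : V) : mk f hf x = f x := rfl
@[simp] theorem toLin_apply (f : BHom V W) (x : V) : f.toLin x = f x := rfl
@[simp] theorem add_apply (f g : BHom V W) (x : V) : (f + g) x = f x + g x := rfl
@[simp] theorem sub_apply (f g : BHom V W) (x : V) : (f - g) x = f x - g x := rfl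
@[simp] theorem zero_apply (x : V) : (0 : BHom V W) x = 0 := rfl
@[simp] theorem smul_apply (c : ℂ) (f : BHom V W) (x : V) : (c • f) x = c • f x := rfl
@[simp] theorem rsmul_apply (c : ℝ) (f : BHom V W) (x : V) : (c • f) x = c • f x := rfl

@[ext] theorem ext {f g : BHom V W} (h : ∀ x, f x = g x) : f = g := DFunLike.ext f g h

theorem bounded (f : BHom V W) : IsBoundedMap f := f.2

@[simp] theorem sum_apply {ι : Type*} (s : Finset ι) (f : ι → BHom V W) (x : V) :
    (∑ i ∈ s, f i) x = ∑ i ∈ s, f i x :=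
  map_sum (⟨⟨fun f : BHom V W => f x, rfl⟩, fun _ _ => rfl⟩ : BHom V W →+ W) f s

/-- The equibounded bornology on `Hom(V, W)`: a set `L` of maps is bounded if `L(S)` is bounded
for every bounded set `S`. -/
instance : Bornology (BHom V W) :=
  Bornology.ofBounded
    {L | ∀ s : Set V, IsBounded s → IsBounded (Set.image2 (fun (f : BHom V W) x => f x) L s)}
    (fun s _ => by simp)
    (fun L hL M hM s hs => (hL s hs).subset (Set.image2_subset_right hM))
    (fun L hL M hM s hs => by
      rw [Set.image2_union_left]
      exact (hL s hs).union (hM s hs))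
    (fun f s hs => by
      rw [Set.image2_singleton_left]
      exact f.bounded s hs)

theorem isBounded_iff {L : Set (BHom V W)} : IsBounded L ↔
    ∀ s : Set V, IsBounded s → IsBounded (Set.image2 (fun (f : BHom V W) x => f x) L s) :=
  Bornology.isBounded_ofBounded_iff _

instance : CompleteBornology (BHom V W) where
  smul_bounded c L hL := by
    rw [isBounded_iff] at hL ⊢
    intro s hs
    refine (isBounded_csmul c (hL s hs)).subset ?_
    rintro _ ⟨_, ⟨f, hf, rfl⟩, x, hx, rfl⟩
    exact ⟨f x, ⟨f, hf, x, hx, rfl⟩, rfl⟩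
  exists_completant L hL := by
    rw [isBounded_iff] at hL
    choose E hE1 hE2 hE3 hE4 using fun s : {s : Set V // IsBounded s} => exists_disk (hL s.1 s.2)
    let D : Set (BHom V W) := {f | ∀ s : {s : Set V // IsBounded s}, ∀ x ∈ s.1, f x ∈ E s}
    have hmem : ∀ {r : ℝ}, 0 < r → ∀ f : BHom V W,
        (∀ s : {s : Set V // IsBounded s}, ∀ x ∈ s.1, f x ∈ r • E s) → f ∈ r • D := by
      intro r hr f hf
      refine ⟨r⁻¹ • f, fun s x hx => ?_, ?_⟩
      · have := hf s x hx
        rwa [Set.mem_smul_set_iff_inv_smul_mem₀ hr.ne'] at this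
      · simp [smul_smul, hr.ne']
    have hmem' : ∀ {r : ℝ} {f : BHom V W}, f ∈ r • D →
        ∀ s : {s : Set V // IsBounded s}, ∀ x ∈ s.1, f x ∈ r • E s := by
      rintro r _ ⟨f, hf, rfl⟩ s x hx
      exact ⟨f x, hf s x hx, rfl⟩
    have hdisk : IsDisk D := by
      constructor
      · rw [balanced_iff_smul_mem]
        intro a ha f hf s x hx
        exact (hE4 s).disk.1.smul_mem ha (hf s x hx)
      · intro f hf g hg a b ha hb hab s x hx
        exact (hE4 s).disk.2 (hf s x hx) (hg s x hx) ha hb hab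
    refine ⟨D, fun f hf s x hx => hE1 s ⟨f, hf, x, hx, rfl⟩, ?_, ?_⟩
    · rw [isBounded_iff]
      intro s hs
      refine (hE3 ⟨s, hs⟩).subset ?_
      rintro _ ⟨f, hf, x, hx, rfl⟩
      exact hf ⟨s, hs⟩ x hx
    · have hpt : ∀ x : V, IsBounded ({x} : Set V) := fun x => isBounded_singleton
      refine IsCompletant.of_hasDyadicSums hdisk
        ⟨0, fun s x _ => (hE4 s).disk.zero_mem (hE2 s)⟩ ?_ ?_
      · intro f hf
        ext x
        exact (hE4 ⟨{x}, hpt x⟩).eq_zero fun ε hε => hmem' (hf ε hε) _ x rfl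
      · intro d hd
        have hsum : ∀ (s : {s : Set V // IsBounded s}) (x : V), x ∈ s.1 → ∃ y, ∀ N : ℕ,
            y - ∑ n ∈ Finset.range N, ((1 / 2 : ℝ) ^ n) • d n x
              ∈ (4 * (1 / 2 : ℝ) ^ N) • E s :=
          fun s x hx => (hE4 s).hasDyadicSums (fun n => d n x) (fun n => hd n s x hx)
        have hlim0 : ∀ ε : ℝ, 0 < ε → ∃ N : ℕ, 4 * (1 / 2 : ℝ) ^ N < ε := fun ε hε => by
          obtain ⟨N, hN⟩ := exists_pow_lt_of_lt_one (show 0 < ε / 4 by positivity)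
            (show (1 / 2 : ℝ) < 1 by norm_num)
          exact ⟨N, by linarith⟩
        -- sums in different disks agree
        have huniq : ∀ (s t : {s : Set V // IsBounded s}) (u : ℕ → W) (y z : W),
            (∀ N : ℕ, y - u N ∈ (4 * (1 / 2 : ℝ) ^ N) • E s) →
            (∀ N : ℕ, z - u N ∈ (4 * (1 / 2 : ℝ) ^ N) • E t) → y = z := by
          intro s t u y z hy hz
          obtain ⟨F, hF1, hF2, hF3, hF4⟩ := exists_disk ((hE3 s).union (hE3 t))
          refine sub_eq_zero.1 (hF4.eq_zero fun ε hε => ?_)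
          obtain ⟨N, hN⟩ := hlim0 (ε / 2) (by positivity)
          have h1 : y - u N ∈ (4 * (1 / 2 : ℝ) ^ N) • F :=
            Set.smul_set_mono (fun z hz => hF1 (Or.inl hz)) (hy N)
          have h2 : z - u N ∈ (4 * (1 / 2 : ℝ) ^ N) • F :=
            Set.smul_set_mono (fun z hz => hF1 (Or.inr hz)) (hz N)
          have h3 := hF4.disk.sub_mem (by positivity) (by positivity) h1 h2
          rw [sub_sub_sub_cancel_right] at h3
          exact hF4.disk.smul_subset (by positivity) (by linarith) h3
        choose! g hg using fun x : V => hsum ⟨{x}, hpt x⟩ x rfl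
        have hg' : ∀ (s : {s : Set V // IsBounded s}) (x : V), x ∈ s.1 → ∀ N : ℕ,
            g x - ∑ n ∈ Finset.range N, ((1 / 2 : ℝ) ^ n) • d n x
              ∈ (4 * (1 / 2 : ℝ) ^ N) • E s := by
          intro s x hx
          obtain ⟨y, hy⟩ := hsum s x hx
          rwa [huniq _ _ _ _ _ (hg x) hy]
        have hadd : ∀ x y, g (x + y) = g x + g y := by
          intro x y
          let s : {s : Set V // IsBounded s} := ⟨{x, y, x + y}, by simp⟩
          refine sub_eq_zero.1 ((hE4 s).eq_zero fun ε hε => ?_)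
          obtain ⟨N, hN⟩ := hlim0 (ε / 3) (by positivity)
          have h1 := hg' s x (by simp [s]) N
          have h2 := hg' s y (by simp [s]) N
          have h3 := hg' s (x + y) (by simp [s]) N
          have h4 := (hE4 s).disk.sub_mem (by positivity) (by positivity) h3
            ((hE4 s).disk.add_mem (by positivity) (by positivity) h1 h2)
          refine (hE4 s).disk.smul_subset (by positivity) (by linarith) ?_
            (r := 4 * (1 / 2 : ℝ) ^ N + (4 * (1 / 2 : ℝ) ^ N + 4 * (1 / 2 : ℝ) ^ N))
          convert h4 using 1
          simp only [map_add, smul_add, Finset.sum_add_distrib]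
          abel
        have hsmul : ∀ (c : ℂ) x, g (c • x) = c • g x := by
          intro c x
          let s : {s : Set V // IsBounded s} := ⟨{x, c • x}, by simp⟩
          refine sub_eq_zero.1 ((hE4 s).eq_zero fun ε hε => ?_)
          obtain ⟨N, hN⟩ := hlim0 (ε / (1 + ‖c‖)) (by positivity)
          have h1 := hg' s x (by simp [s]) N
          have h2 := hg' s (c • x) (by simp [s]) N
          have h4 := (hE4 s).disk.sub_mem (by positivity) (by positivity) h2
            ((hE4 s).disk.csmul_mem c h1)
          rw [lt_div_iff₀ (by positivity)] at hN
          refine (hE4 s).disk.smul_subset (by positivity) (by linarith) ?_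
            (r := 4 * (1 / 2 : ℝ) ^ N + ‖c‖ * (4 * (1 / 2 : ℝ) ^ N))
          convert h4 using 1
          simp only [map_smul, smul_sub, Finset.smul_sum]
          simp only [smul_comm c]
          abel
        let G : V →ₗ[ℂ] W := ⟨⟨g, hadd⟩, hsmul⟩
        have hG : IsBoundedMap G := by
          intro s hs
          refine (isBounded_rsmul 4 (hE3 ⟨s, hs⟩)).subset ?_
          rintro _ ⟨x, hx, rfl⟩
          change g x ∈ _
          simpa using hg' ⟨s, hs⟩ x hx 0
        refine ⟨mk G hG, fun N => hmem (by positivity) _ fun s x hx => ?_⟩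
        simpa only [sub_apply, sum_apply, rsmul_apply] using! hg' s x hx N

/-- Composition of bounded linear maps. -/
def comp (g : BHom W X) (f : BHom V W) : BHom V X :=
  mk (g.toLin ∘ₗ f.toLin) (fun s hs => by
    have := g.bounded _ (f.bounded s hs)
    rwa [Set.image_image] at this)

@[simp] theorem comp_apply (g : BHom W X) (f : BHom V W) (x : V) : g.comp f x = g (f x) := rfl

variable (V) in
/-- The identity map. -/
def id : BHom V V := mk LinearMap.id (fun s hs => by simpa using hs)

@[simp] theorem id_apply (x : V) : BHom.id V x = x := rfl

/-- Bounded bilinear maps `V × W → X`, viewed as elements of `Hom(V, Hom(W, X))`. -/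
def mk₂ (f : V → W → X) (h1 : ∀ v v' w, f (v + v') w = f v w + f v' w)
    (h2 : ∀ (c : ℂ) v w, f (c • v) w = c • f v w)
    (h3 : ∀ v w w', f v (w + w') = f v w + f v w')
    (h4 : ∀ (c : ℂ) v w, f v (c • w) = c • f v w)
    (hb : ∀ s t, IsBounded s → IsBounded t → IsBounded (Set.image2 f s t)) :
    BHom V (BHom W X) :=
  mk
    { toFun := fun v => mk ⟨⟨f v, h3 v⟩, fun c w => h4 c v w⟩ (fun t ht => by
        have := hb {v} t isBounded_singleton ht
        rwa [Set.image2_singleton_left] at this)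
      map_add' := fun v v' => ext fun w => h1 v v' w
      map_smul' := fun c v => ext fun w => h2 c v w }
    (fun s hs => isBounded_iff.2 fun t ht => by
      refine (hb s t hs ht).subset ?_
      rintro _ ⟨_, ⟨v, hv, rfl⟩, w, hw, rfl⟩
      exact ⟨v, hv, w, hw, rfl⟩)

@[simp] theorem mk₂_apply (f : V → W → X) (h1 h2 h3 h4 hb) (v : V) (w : W) :
    mk₂ f h1 h2 h3 h4 hb v w = f v w := rfl

theorem bounded₂ (b : BHom V (BHom W X)) {s : Set V} {t : Set W} (hs : IsBounded s)
    (ht : IsBounded t) : IsBounded (Set.image2 (fun v w => b v w) s t) := by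
  have := isBounded_iff.1 (b.bounded s hs) t ht
  rwa [Set.image2_image_left] at this

end BHom

end BHom

/-! ## Quotients -/

section Quotient

variable {V W X : Type*}
  [AddCommGroup V] [Module ℂ V] [Bornology V] [CompleteBornology V]
  [AddCommGroup X] [Module ℂ X] [Bornology X] [CompleteBornology X]

/-- The complete quotient of a bornological vector space by (the closure of) a subspace. -/
def BQuot (R : Submodule ℂ V) : Type _ := V ⧸ bornClosure R

namespace BQuot

variable (R : Submodule ℂ V)

instance : AddCommGroup (BQuot R) := inferInstanceAs (AddCommGroup (V ⧸ bornClosure R))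
instance : Module ℂ (BQuot R) := inferInstanceAs (Module ℂ (V ⧸ bornClosure R))

/-- The quotient map. -/
def mkLin : V →ₗ[ℂ] BQuot R := (bornClosure R).mkQ

theorem mkLin_surjective : Function.Surjective (mkLin R) := Submodule.mkQ_surjective _

theorem mkLin_eq_zero {x : V} : mkLin R x = 0 ↔ x ∈ bornClosure R :=
  Submodule.Quotient.mk_eq_zero _

/-- The quotient bornology: the bounded sets are those contained in images of bounded sets. -/
instance : Bornology (BQuot R) :=
  Bornology.ofBounded {s | ∃ t : Set V, IsBounded t ∧ s ⊆ mkLin R '' t}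
    ⟨∅, isBounded_empty, by simp⟩
    (fun _ ⟨t, ht, h⟩ _ h' => ⟨t, ht, h'.trans h⟩)
    (fun _ ⟨t, ht, h⟩ _ ⟨t', ht', h'⟩ => ⟨t ∪ t', ht.union ht', by
      rw [Set.image_union]; exact Set.union_subset_union h h'⟩)
    (fun x => by
      obtain ⟨y, rfl⟩ := mkLin_surjective R x
      exact ⟨{y}, isBounded_singleton, by simp⟩)

theorem isBounded_iff {s : Set (BQuot R)} :
    IsBounded s ↔ ∃ t : Set V, IsBounded t ∧ s ⊆ mkLin R '' t :=
  Bornology.isBounded_ofBounded_iff _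

theorem mkLin_rsmul (r : ℝ) (x : V) : mkLin R (r • x) = r • mkLin R x := by
  simp [← Complex.coe_smul]

instance : CompleteBornology (BQuot R) where
  smul_bounded c s hs := by
    obtain ⟨t, ht, h⟩ := (isBounded_iff R).1 hs
    refine (isBounded_iff R).2 ⟨c • t, isBounded_csmul c ht, ?_⟩
    rintro _ ⟨x, hx, rfl⟩
    obtain ⟨y, hy, rfl⟩ := h hx
    exact ⟨c • y, ⟨y, hy, rfl⟩, (mkLin R).map_smul c y⟩
  exists_completant s hs := by
    obtain ⟨t, ht, h⟩ := (isBounded_iff R).1 hs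
    obtain ⟨D, hD1, hD2, hD3, hD4⟩ := exists_disk ht
    refine ⟨mkLin R '' D, h.trans (Set.image_mono hD1), (isBounded_iff R).2 ⟨D, hD3, le_rfl⟩, ?_⟩
    have hsm : ∀ r : ℝ, ∀ x, x ∈ r • (mkLin R '' D) ↔ ∃ y ∈ r • D, mkLin R y = x := by
      intro r x
      constructor
      · rintro ⟨_, ⟨y, hy, rfl⟩, rfl⟩
        exact ⟨r • y, ⟨y, hy, rfl⟩, mkLin_rsmul R r y⟩
      · rintro ⟨_, ⟨y, hy, rfl⟩, rfl⟩
        exact ⟨mkLin R y, ⟨y, hy, rfl⟩, (mkLin_rsmul R r y).symm⟩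
    refine IsCompletant.of_hasDyadicSums ⟨?_, ?_⟩ (hD2.image _) ?_ ?_
    · rw [balanced_iff_smul_mem]
      rintro a ha _ ⟨y, hy, rfl⟩
      exact ⟨a • y, hD4.disk.1.smul_mem ha hy, (mkLin R).map_smul a y⟩
    · rintro _ ⟨y, hy, rfl⟩ _ ⟨z, hz, rfl⟩ a b ha hb hab
      exact ⟨a • y + b • z, hD4.disk.2 hy hz ha hb hab, by
        rw [map_add, mkLin_rsmul, mkLin_rsmul]⟩
    · intro x hx
      obtain ⟨y, rfl⟩ := mkLin_surjective R x
      rw [mkLin_eq_zero]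
      refine (isBornClosed_bornClosure R).mem_of_approx hD3 fun ε hε => ?_
      obtain ⟨z, hz, hzy⟩ := (hsm ε _).1 (hx ε hε)
      refine ⟨y - z, (mkLin_eq_zero R).1 (by rw [map_sub, hzy, sub_self]), by simpa using hz⟩
    · intro d hd
      choose e heD hed using hd
      obtain ⟨x, hx⟩ := hD4.hasDyadicSums e heD
      refine ⟨mkLin R x, fun N => (hsm _ _).2 ⟨_, hx N, ?_⟩⟩
      simp only [map_sub, map_sum, mkLin_rsmul, hed]

/-- The quotient map, as a bounded linear map. -/
def mk : BHom V (BQuot R) :=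
  BHom.mk (mkLin R) fun s hs => (isBounded_iff R).2 ⟨s, hs, le_rfl⟩

theorem mk_surjective : Function.Surjective (mk R) := mkLin_surjective R

theorem mk_eq_zero {x : V} : mk R x = 0 ↔ x ∈ bornClosure R := mkLin_eq_zero R

theorem isBounded_iff' {s : Set (BQuot R)} :
    IsBounded s ↔ ∃ t : Set V, IsBounded t ∧ s ⊆ mk R '' t := isBounded_iff R

end BQuot

theorem isBornClosed_ker (f : BHom V X) : IsBornClosed (LinearMap.ker f.toLin) := by
  intro D u x hD hb hu hx
  rw [LinearMap.mem_ker]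
  rcases D.eq_empty_or_nonempty with rfl | hn
  · have h2 := hx.2.1
    simp only [Submodule.span_empty, Submodule.mem_bot] at h2
    rw [h2, map_zero]
  obtain ⟨E, hE1, hE2, hE3, hE4⟩ := exists_disk (f.bounded D hb)
  refine hE4.eq_zero fun ε hε => ?_
  obtain ⟨n, hn'⟩ := (hx.2.2.eventually_lt_const hε).exists
  obtain ⟨d, hd, hdx⟩ := hD.mem_smul_of_gauge_lt hn (Submodule.sub_mem _ (hx.1 n) hx.2.1) hn'
  have h3 : f.toLin (u n - x) ∈ ε • E := by
    rw [← hdx]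
    refine ⟨f d, hE1 ⟨d, hd, rfl⟩, ?_⟩
    simp [← Complex.coe_smul]
  have h4 := hE4.disk.neg_mem h3
  rw [map_sub, LinearMap.mem_ker.1 (hu n)] at h4
  simpa using h4

end Quotient

/-! ## The completed tensor product

`V ⊗̂ W` is the quotient of the space of absolutely summable formal combinations
`∑ c (v, w) · (v, w)` supported in a product of bounded sets by the closure of the bilinear
relations. -/

section Tensor

variable {V W X : Type*}
  [AddCommGroup V] [Module ℂ V] [Bornology V] [CompleteBornology V]
  [AddCommGroup W] [Module ℂ W] [Bornology W] [CompleteBornology W]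
  [AddCommGroup X] [Module ℂ X] [Bornology X] [CompleteBornology X]

/-- `c` is supported in `S × T`. -/
def SuppIn (S : Set V) (T : Set W) (c : V × W → ℂ) : Prop :=
  ∀ p, c p ≠ 0 → p.1 ∈ S ∧ p.2 ∈ T

variable (V W) in
/-- The absolutely summable functions on `V × W` supported in a product of bounded sets. -/
def ell1Submodule : Submodule ℂ (lp (fun _ : V × W => ℂ) 1) where
  carrier := {c | ∃ S T, IsBounded S ∧ IsBounded T ∧ SuppIn S T c}
  add_mem' := by
    rintro a b ⟨S, T, hS, hT, h⟩ ⟨S', T', hS', hT', h'⟩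
    refine ⟨S ∪ S', T ∪ T', hS.union hS', hT.union hT', fun p hp => ?_⟩
    by_cases ha : a p = 0
    · have hb : b p ≠ 0 := fun hb => hp (by simp [ha, hb])
      exact ⟨Or.inr (h' p hb).1, Or.inr (h' p hb).2⟩
    · exact ⟨Or.inl (h p ha).1, Or.inl (h p ha).2⟩
  zero_mem' := ⟨∅, ∅, isBounded_empty, isBounded_empty, fun p hp => (hp rfl).elim⟩
  smul_mem' := by
    rintro z a ⟨S, T, hS, hT, h⟩
    exact ⟨S, T, hS, hT, fun p hp => h p fun h0 => hp (by simp [h0])⟩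

variable (V W) in
/-- The free complete bornological vector space on the bounded products in `V × W`. -/
def Ell1 : Type _ := ell1Submodule V W

namespace Ell1

instance : AddCommGroup (Ell1 V W) := inferInstanceAs (AddCommGroup (ell1Submodule V W))
instance : Module ℂ (Ell1 V W) := inferInstanceAs (Module ℂ (ell1Submodule V W))

/-- The underlying summable family. -/
def val (c : Ell1 V W) : lp (fun _ : V × W => ℂ) 1 := c.1

theorem val_injective : Function.Injective (val (V := V) (W := W)) := Subtype.val_injective

@[simp] theorem val_add (a b : Ell1 V W) : (a + b).val = a.val + b.val := rfl
@[simp] theorem val_sub (a b : Ell1 V W) : (a - b).val = a.val - b.val := rfl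
@[simp] theorem val_smul (z : ℂ) (a : Ell1 V W) : (z • a).val = z • a.val := rfl
@[simp] theorem val_rsmul (z : ℝ) (a : Ell1 V W) : (z • a).val = z • a.val := rfl
@[simp] theorem val_zero : (0 : Ell1 V W).val = 0 := rfl
@[simp] theorem val_sum {ι : Type*} (s : Finset ι) (f : ι → Ell1 V W) :
    (∑ i ∈ s, f i).val = ∑ i ∈ s, (f i).val :=
  map_sum (⟨⟨val, rfl⟩, fun _ _ => rfl⟩ : Ell1 V W →+ lp (fun _ : V × W => ℂ) 1) f s

/-- The ball of summable families of norm at most `r` supported in `S × T`. -/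
def ball (S : Set V) (T : Set W) (r : ℝ) : Set (Ell1 V W) :=
  {c | SuppIn S T c.val ∧ ‖c.val‖ ≤ r}

/-- A set is bounded if its elements are supported in a common product of bounded sets and have
bounded `ℓ¹`-norm. -/
instance : Bornology (Ell1 V W) :=
  Bornology.ofBounded {B | ∃ S T r, IsBounded S ∧ IsBounded T ∧ B ⊆ ball S T r}
    ⟨∅, ∅, 0, isBounded_empty, isBounded_empty, by simp⟩
    (fun _ ⟨S, T, r, hS, hT, h⟩ _ h' => ⟨S, T, r, hS, hT, h'.trans h⟩)
    (fun _ ⟨S, T, r, hS, hT, h⟩ _ ⟨S', T', r', hS', hT', h'⟩ =>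
      ⟨S ∪ S', T ∪ T', max r r', hS.union hS', hT.union hT', by
        rintro c (hc | hc)
        · exact ⟨fun p hp => ⟨Or.inl ((h hc).1 p hp).1, Or.inl ((h hc).1 p hp).2⟩,
            (h hc).2.trans (le_max_left _ _)⟩
        · exact ⟨fun p hp => ⟨Or.inr ((h' hc).1 p hp).1, Or.inr ((h' hc).1 p hp).2⟩,
            (h' hc).2.trans (le_max_right _ _)⟩⟩)
    (fun c => by
      obtain ⟨S, T, hS, hT, h⟩ := c.2
      exact ⟨S, T, ‖c.val‖, hS, hT, by rintro _ rfl; exact ⟨h, le_rfl⟩⟩)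

theorem isBounded_iff {B : Set (Ell1 V W)} :
    IsBounded B ↔ ∃ S T r, IsBounded S ∧ IsBounded T ∧ B ⊆ ball S T r :=
  Bornology.isBounded_ofBounded_iff _

theorem mem_smul_ball {S : Set V} {T : Set W} {r : ℝ} (hr : 0 < r) {c : Ell1 V W} :
    c ∈ r • ball S T 1 ↔ c ∈ ball S T r := by
  rw [Set.mem_smul_set_iff_inv_smul_mem₀ hr.ne']
  have h1 : SuppIn S T ((r⁻¹ • c).val : V × W → ℂ) ↔ SuppIn S T (c.val : V × W → ℂ) := by
    simp [SuppIn, hr.ne']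
  have h2 : ‖(r⁻¹ • c).val‖ ≤ 1 ↔ ‖c.val‖ ≤ r := by
    rw [val_rsmul, norm_smul, norm_inv, Real.norm_eq_abs, abs_of_pos hr, inv_mul_le_iff₀ hr,
      mul_one]
  exact and_congr h1 h2

instance : CompleteBornology (Ell1 V W) where
  smul_bounded z B hB := by
    obtain ⟨S, T, r, hS, hT, h⟩ := isBounded_iff.1 hB
    refine isBounded_iff.2 ⟨S, T, ‖z‖ * r, hS, hT, ?_⟩
    rintro _ ⟨c, hc, rfl⟩
    refine ⟨fun p hp => (h hc).1 p fun h0 => hp (by simp [h0]), ?_⟩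
    simp only [val_smul, norm_smul]
    exact mul_le_mul_of_nonneg_left (h hc).2 (norm_nonneg z)
  exists_completant B hB := by
    obtain ⟨S, T, r, hS, hT, h⟩ := isBounded_iff.1 hB
    set R : ℝ := max r 1 with hR
    have hR0 : 0 < R := lt_max_of_lt_right one_pos
    have hdisk : IsDisk (ball S T R) := by
      constructor
      · rw [balanced_iff_smul_mem]
        intro a ha c hc
        refine ⟨fun p hp => hc.1 p fun h0 => hp (by simp [h0]), ?_⟩
        simp only [val_smul, norm_smul]
        exact (mul_le_of_le_one_left (norm_nonneg _) ha).trans hc.2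
      · intro c hc d hd a b ha hb hab
        refine ⟨fun p hp => ?_, ?_⟩
        · by_cases h0 : c.val p = 0
          · exact hd.1 p fun h1 => hp (by
              change a • c.val p + b • d.val p = 0
              simp [h0, h1])
          · exact hc.1 p h0
        · simp only [val_add, val_rsmul]
          refine (norm_add_le _ _).trans ?_
          rw [norm_smul, norm_smul, Real.norm_eq_abs, Real.norm_eq_abs, abs_of_nonneg ha,
            abs_of_nonneg hb]
          calc a * ‖c.val‖ + b * ‖d.val‖ ≤ a * R + b * R :=
                add_le_add (mul_le_mul_of_nonneg_left hc.2 ha) (mul_le_mul_of_nonneg_left hd.2 hb)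
            _ = R := by rw [← add_mul, hab, one_mul]
    have hball : ∀ {s : ℝ}, 0 < s → ∀ {c : Ell1 V W},
        c ∈ s • ball S T R ↔ c ∈ ball S T (s * R) := by
      intro s hs c
      rw [← mem_smul_ball (mul_pos hs hR0), mul_smul]
      have : R • ball S T 1 = ball S T R := Set.ext fun x => mem_smul_ball hR0
      rw [this]
    refine ⟨ball S T R, fun c hc => ⟨(h hc).1, (h hc).2.trans (le_max_left _ _)⟩,
      isBounded_iff.2 ⟨S, T, R, hS, hT, le_rfl⟩, ?_⟩
    refine IsCompletant.of_hasDyadicSums hdisk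
      ⟨0, fun p hp => (hp (by simp)).elim, by simpa using hR0.le⟩ ?_ ?_
    · intro c hc
      apply val_injective
      rw [val_zero, ← norm_le_zero_iff]
      refine le_of_forall_pos_le_add fun ε hε => ?_
      have := ((hball (div_pos hε hR0)).1 (hc _ (div_pos hε hR0))).2
      rwa [div_mul_cancel₀ _ hR0.ne', ← zero_add ε] at this
    · intro d hd
      have hle : ∀ n, ‖((1 / 2 : ℝ) ^ n) • (d n).val‖ ≤ R * (1 / 2 : ℝ) ^ n := fun n => by
        rw [norm_smul, Real.norm_eq_abs, abs_of_nonneg (by positivity), mul_comm]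
        exact mul_le_mul_of_nonneg_right (hd n).2 (by positivity)
      have hgeo : Summable fun n : ℕ => R * (1 / 2 : ℝ) ^ n :=
        (summable_geometric_of_lt_one (by norm_num) (by norm_num)).mul_left R
      have hs : Summable fun n => ((1 / 2 : ℝ) ^ n) • (d n).val :=
        Summable.of_norm_bounded hgeo hle
      set y := ∑' n, ((1 / 2 : ℝ) ^ n) • (d n).val with hy
      have hpt : ∀ p, HasSum (fun n => (((1 / 2 : ℝ) ^ n) • (d n).val) p) (y p) := fun p => by
        have hc : Continuous fun f : lp (fun _ : V × W => ℂ) 1 => f p :=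
          (continuous_apply p).comp lp.uniformContinuous_coe.continuous
        exact hs.hasSum.map
          (⟨⟨fun f => f p, rfl⟩, fun _ _ => rfl⟩ : lp (fun _ : V × W => ℂ) 1 →+ ℂ) hc
      have hysupp : SuppIn S T y := by
        intro p hp
        by_contra hcon
        refine hp ?_
        have : ∀ n, (((1 / 2 : ℝ) ^ n) • (d n).val) p = 0 := fun n => by
          have h0 : (d n).val p = 0 := by
            by_contra h0
            exact hcon ((hd n).1 p h0)
          rw [lp.coeFn_smul, Pi.smul_apply, h0, smul_zero]
        have h2 := hpt p
        simp only [this] at h2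
        exact h2.unique hasSum_zero
      obtain ⟨Y, hY⟩ : ∃ Y : Ell1 V W, Y.val = y := ⟨⟨y, S, T, hS, hT, hysupp⟩, rfl⟩
      refine ⟨Y, fun N => (hball (by positivity)).2 ⟨?_, ?_⟩⟩
      · intro p hp
        by_contra hcon
        refine hp ?_
        have hy0 : y p = 0 := by
          by_contra h0
          exact hcon (hysupp p h0)
        have hd0 : ∀ n, (d n).val p = 0 := fun n => by
          by_contra h0
          exact hcon ((hd n).1 p h0)
        rw [val_sub, hY, val_sum]
        change y p - (∑ n ∈ Finset.range N, (((1 / 2 : ℝ) ^ n) • d n).val :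
          lp (fun _ : V × W => ℂ) 1) p = 0
        rw [hy0, lp.coeFn_sum, Finset.sum_apply, Finset.sum_eq_zero, sub_zero]
        intro n _
        rw [val_rsmul]
        change ((1 / 2 : ℝ) ^ n) • (d n).val p = 0
        rw [hd0, smul_zero]
      · rw [val_sub, val_sum, hY]
        simp only [val_rsmul]
        have h1 := hs.sum_add_tsum_nat_add N
        rw [← hy] at h1
        rw [← h1, add_sub_cancel_left]
        refine (tsum_of_norm_bounded (g := fun n => R * (1 / 2 : ℝ) ^ (n + N))
          (a := 2 * (1 / 2 : ℝ) ^ N * R) ?_ fun n => hle (n + N)).trans ?_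
        · have := (hasSum_geometric_of_lt_one (r := (1 / 2 : ℝ)) (by norm_num)
            (by norm_num)).mul_left (R * (1 / 2 : ℝ) ^ N)
          have e : (fun n : ℕ => R * (1 / 2 : ℝ) ^ (n + N))
              = fun n => R * (1 / 2 : ℝ) ^ N * (1 / 2 : ℝ) ^ n := by
            funext n; rw [pow_add]; ring
          rw [e, show 2 * (1 / 2 : ℝ) ^ N * R = R * (1 / 2 : ℝ) ^ N * (1 - 1 / 2)⁻¹ by norm_num; ring]
          exact this
        · have : 0 ≤ (1 / 2 : ℝ) ^ N * R := by positivity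
          linarith

end Ell1

namespace Ell1

/-- The basis element at `(v, w)`. -/
def delta (v : V) (w : W) : Ell1 V W := by
  classical
  exact ⟨lp.single 1 (v, w) (1 : ℂ), {v}, {w}, isBounded_singleton, isBounded_singleton, by
    intro p hp
    by_cases h : p = (v, w)
    · subst h; simp
    · exact (hp (lp.single_apply_ne 1 _ _ h)).elim⟩

theorem val_delta [DecidableEq (V × W)] (v : V) (w : W) :
    (delta v w).val = lp.single 1 (v, w) (1 : ℂ) := by
  unfold delta val
  congr!

/-- Partial sums of the series `∑ c (v, w) • b v w`. -/
def psum (b : BHom V (BHom W X)) (c : Ell1 V W) (F : Finset (V × W)) : X :=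
  ∑ p ∈ F, c.val p • b p.1 p.2

/-- The partial sums converge to `x` with respect to `D`. -/
def SumsTo (D : Set X) (b : BHom V (BHom W X)) (c : Ell1 V W) (x : X) : Prop :=
  ∀ ε : ℝ, 0 < ε → ∃ F₀ : Finset (V × W), ∀ F, F₀ ⊆ F → x - psum b c F ∈ ε • D

theorem psum_mem {D : Set X} (hD : IsDisk D) (hn : D.Nonempty) {b : BHom V (BHom W X)}
    {c : Ell1 V W} {S : Set V} {T : Set W} (hc : SuppIn S T c.val)
    (hb : ∀ v ∈ S, ∀ w ∈ T, b v w ∈ D) (F : Finset (V × W)) :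
    psum b c F ∈ (∑ p ∈ F, ‖c.val p‖) • D := by
  classical
  induction F using Finset.induction_on with
  | empty => exact ⟨0, hD.zero_mem hn, by simp [psum]⟩
  | insert p F hp ih =>
    unfold psum at ih ⊢
    rw [Finset.sum_insert hp, Finset.sum_insert hp]
    refine hD.add_mem (norm_nonneg _) (Finset.sum_nonneg fun _ _ => norm_nonneg _) ?_ ih
    by_cases h0 : c.val p = 0
    · rw [h0]; exact ⟨0, hD.zero_mem hn, by simp⟩
    · have h1 := hb p.1 (hc p h0).1 p.2 (hc p h0).2
      simpa using hD.csmul_mem (r := 1) (c.val p) (by simpa using h1)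

theorem sum_norm_le (c : Ell1 V W) (F : Finset (V × W)) : ∑ p ∈ F, ‖c.val p‖ ≤ ‖c.val‖ := by
  have := lp.sum_rpow_le_norm_rpow (p := 1) (by simp) c.val F
  simpa using this

theorem summable_norm (c : Ell1 V W) : Summable fun p => ‖c.val p‖ := by
  simpa using (lp.memℓp c.val).summable (p := 1) (by simp)

theorem exists_sumsTo {D : Set X} (hD : IsCompletant D) (hn : D.Nonempty)
    {b : BHom V (BHom W X)} {c : Ell1 V W} {S : Set V} {T : Set W} (hc : SuppIn S T c.val)
    (hb : ∀ v ∈ S, ∀ w ∈ T, b v w ∈ D) : ∃ x, SumsTo D b c x := by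
  classical
  have hvan : ∀ n : ℕ, ∃ F₀ : Finset (V × W), ∀ F, Disjoint F F₀ →
      ∑ p ∈ F, ‖c.val p‖ < (1 / 2 : ℝ) ^ n := by
    intro n
    obtain ⟨F₀, h⟩ := summable_iff_vanishing_norm.1 (summable_norm c) ((1 / 2 : ℝ) ^ n)
      (by positivity)
    refine ⟨F₀, fun F hF => ?_⟩
    have := h F hF
    rwa [Real.norm_eq_abs, abs_of_nonneg (Finset.sum_nonneg fun _ _ => norm_nonneg _)] at this
  choose G hG using hvan
  let P : ℕ → Finset (V × W) := fun n => (Finset.range (n + 1)).biUnion G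
  have hGP : ∀ n, G n ⊆ P n := fun n => Finset.subset_biUnion_of_mem G (by simp)
  have hP : ∀ n, P n ⊆ P (n + 1) := fun n =>
    Finset.biUnion_subset_biUnion_of_subset_left _ (Finset.range_mono (by omega))
  have hdiff : ∀ n F, P n ⊆ F → psum b c F - psum b c (P n) ∈ ((1 / 2 : ℝ) ^ n) • D := by
    intro n F hF
    have h1 : psum b c F - psum b c (P n) = psum b c (F \ P n) := by
      unfold psum
      rw [sub_eq_iff_eq_add, Finset.sum_sdiff hF]
    rw [h1]
    exact hD.disk.smul_subset (Finset.sum_nonneg fun _ _ => norm_nonneg _)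
      (hG n _ (Finset.sdiff_disjoint.mono_right (hGP n))).le (psum_mem hD.disk hn hc hb _)
  choose d hdD hde using fun n => hdiff n (P (n + 1)) (hP n)
  obtain ⟨y, hy⟩ := hD.hasDyadicSums d hdD
  refine ⟨y + psum b c (P 0), fun ε hε => ?_⟩
  obtain ⟨n, hn'⟩ := exists_pow_lt_of_lt_one (show 0 < ε / 5 by positivity)
    (show (1 / 2 : ℝ) < 1 by norm_num)
  refine ⟨P n, fun F hF => ?_⟩
  have h1 := hy n
  simp only at hde
  simp_rw [hde] at h1
  rw [Finset.sum_range_sub (fun k => psum b c (P k))] at h1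
  have h2 := hD.disk.sub_mem (by positivity) (by positivity) h1 (hdiff n F hF)
  refine hD.disk.smul_subset (by positivity) (by linarith) ?_
    (r := 4 * (1 / 2 : ℝ) ^ n + (1 / 2 : ℝ) ^ n)
  convert h2 using 1
  abel

theorem SumsTo.mem {D : Set X} (hD : IsDisk D) (hn : D.Nonempty)
    {b : BHom V (BHom W X)} {c : Ell1 V W} {S : Set V} {T : Set W} (hc : SuppIn S T c.val)
    (hb : ∀ v ∈ S, ∀ w ∈ T, b v w ∈ D) {x : X} (h : SumsTo D b c x) {r : ℝ} (hr : ‖c.val‖ ≤ r) :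
    x ∈ (r + 1) • D := by
  obtain ⟨F, hF⟩ := h 1 one_pos
  have h1 := hD.add_mem zero_le_one (Finset.sum_nonneg fun _ _ => norm_nonneg _) (hF F le_rfl)
    (psum_mem hD hn hc hb F)
  rw [sub_add_cancel] at h1
  refine hD.smul_subset (add_nonneg zero_le_one (Finset.sum_nonneg fun _ _ => norm_nonneg _)) ?_ h1
  linarith [sum_norm_le c F]

theorem SumsTo.mono {D E : Set X} (hDE : D ⊆ E) {b : BHom V (BHom W X)} {c : Ell1 V W} {x : X}
    (h : SumsTo D b c x) : SumsTo E b c x := fun ε hε => by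
  obtain ⟨F₀, hF⟩ := h ε hε
  exact ⟨F₀, fun F hF' => Set.smul_set_mono hDE (hF F hF')⟩

theorem SumsTo.unique {D E : Set X} (hD : IsBounded D) (hE : IsBounded E)
    {b : BHom V (BHom W X)} {c : Ell1 V W} {x y : X} (hx : SumsTo D b c x)
    (hy : SumsTo E b c y) : x = y := by
  classical
  obtain ⟨K, hK1, hK2, hK3, hK4⟩ := exists_disk (hD.union hE)
  refine sub_eq_zero.1 (hK4.eq_zero fun ε hε => ?_)
  obtain ⟨F, hF⟩ := (hx.mono (Set.subset_union_left.trans hK1)) (ε / 2) (by positivity)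
  obtain ⟨G, hG⟩ := (hy.mono (Set.subset_union_right.trans hK1)) (ε / 2) (by positivity)
  have h1 := hK4.disk.sub_mem (by positivity) (by positivity)
    (hF (F ∪ G) Finset.subset_union_left) (hG (F ∪ G) Finset.subset_union_right)
  rwa [sub_sub_sub_cancel_right, add_halves] at h1

theorem exists_sum (b : BHom V (BHom W X)) (c : Ell1 V W) :
    ∃ x, ∃ D, IsBounded D ∧ IsDisk D ∧ SumsTo D b c x := by
  obtain ⟨S, T, hS, hT, hc⟩ := c.2
  obtain ⟨D, hD1, hD2, hD3, hD4⟩ := exists_disk (b.bounded₂ hS hT)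
  obtain ⟨x, hx⟩ := exists_sumsTo (b := b) hD4 hD2 hc fun v hv w hw => hD1 ⟨v, hv, w, hw, rfl⟩
  exact ⟨x, D, hD3, hD4.disk, hx⟩

/-- The sum `∑ c (v, w) • b v w`. -/
def bsum (b : BHom V (BHom W X)) (c : Ell1 V W) : X := (exists_sum b c).choose

theorem bsum_spec (b : BHom V (BHom W X)) (c : Ell1 V W) :
    ∃ D, IsBounded D ∧ IsDisk D ∧ SumsTo D b c (bsum b c) := (exists_sum b c).choose_spec

theorem bsum_eq {b : BHom V (BHom W X)} {c : Ell1 V W} {D : Set X} (hD : IsBounded D) {x : X}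
    (h : SumsTo D b c x) : bsum b c = x := by
  obtain ⟨E, hE, _, h'⟩ := bsum_spec b c
  exact h'.unique hE hD h

theorem bsum_mem {D : Set X} (hD : IsCompletant D) (hbd : IsBounded D) (hn : D.Nonempty)
    {b : BHom V (BHom W X)} {c : Ell1 V W} {S : Set V} {T : Set W} {r : ℝ}
    (hc : c ∈ ball S T r) (hb : ∀ v ∈ S, ∀ w ∈ T, b v w ∈ D) : bsum b c ∈ (r + 1) • D := by
  obtain ⟨x, hx⟩ := exists_sumsTo hD hn hc.1 hb
  rw [bsum_eq hbd hx]
  exact hx.mem hD.disk hn hc.1 hb hc.2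

/-- Extension of a bounded bilinear map to `Ell1 V W`. -/
def extend (b : BHom V (BHom W X)) : BHom (Ell1 V W) X :=
  BHom.mk
    { toFun := bsum b
      map_add' := by
        classical
        intro c c'
        obtain ⟨D, hD, _, h⟩ := bsum_spec b c
        obtain ⟨D', hD', _, h'⟩ := bsum_spec b c'
        obtain ⟨K, hK1, hK2, hK3, hK4⟩ := exists_disk (hD.union hD')
        refine bsum_eq hK3 fun ε hε => ?_
        obtain ⟨F, hF⟩ := (h.mono (Set.subset_union_left.trans hK1)) (ε / 2) (by positivity)
        obtain ⟨G, hG⟩ := (h'.mono (Set.subset_union_right.trans hK1)) (ε / 2) (by positivity)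
        refine ⟨F ∪ G, fun L hL => ?_⟩
        have h1 := hK4.disk.add_mem (by positivity) (by positivity)
          (hF L (Finset.subset_union_left.trans hL)) (hG L (Finset.subset_union_right.trans hL))
        rw [add_halves] at h1
        convert h1 using 1
        have : psum b (c + c') L = psum b c L + psum b c' L := by
          unfold psum
          rw [← Finset.sum_add_distrib]
          exact Finset.sum_congr rfl fun p _ => add_smul (c.val p) (c'.val p) _
        rw [this]
        abel
      map_smul' := by
        intro z c
        obtain ⟨D, hD, hD', h⟩ := bsum_spec b c
        refine bsum_eq hD fun ε hε => ?_
        obtain ⟨F, hF⟩ := h (ε / (1 + ‖z‖)) (by positivity)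
        refine ⟨F, fun L hL => ?_⟩
        have h1 := hD'.csmul_mem z (hF L hL)
        refine hD'.smul_subset (by positivity) ?_ (r := ‖z‖ * (ε / (1 + ‖z‖))) ?_
        · rw [mul_div_assoc', div_le_iff₀ (by positivity)]
          nlinarith [norm_nonneg z]
        · convert h1 using 1
          have : psum b (z • c) L = z • psum b c L := by
            unfold psum
            rw [Finset.smul_sum]
            exact Finset.sum_congr rfl fun p _ => mul_smul z (c.val p) _
          rw [this, smul_sub]
          rfl }
    (by
      intro B hB
      obtain ⟨S, T, r, hS, hT, h⟩ := isBounded_iff.1 hB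
      obtain ⟨D, hD1, hD2, hD3, hD4⟩ := exists_disk (b.bounded₂ hS hT)
      refine (isBounded_rsmul (r + 1) hD3).subset ?_
      rintro _ ⟨c, hc, rfl⟩
      exact bsum_mem hD4 hD3 hD2 (h hc) fun v hv w hw => hD1 ⟨v, hv, w, hw, rfl⟩)

theorem extend_apply (b : BHom V (BHom W X)) (c : Ell1 V W) : extend b c = bsum b c := rfl

theorem extend_delta (b : BHom V (BHom W X)) (v : V) (w : W) : extend b (delta v w) = b v w := by
  classical
  refine bsum_eq (isBounded_singleton (x := (0 : X))) fun ε hε => ⟨{(v, w)}, fun F hF => ?_⟩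
  have : psum b (delta v w) F = b v w := by
    unfold psum
    rw [Finset.sum_eq_single (v, w)]
    · rw [val_delta, lp.single_apply_self, one_smul]
    · intro p _ hp
      rw [val_delta, lp.single_apply_ne 1 _ _ hp, zero_smul]
    · intro h
      exact (h (hF (by simp))).elim
  rw [this]
  exact ⟨0, rfl, by simp⟩

/-- Bounded linear maps on `Ell1 V W` are determined on the basis elements. -/
theorem eq_zero_of_delta {f : BHom (Ell1 V W) X} (h : ∀ v w, f (delta v w) = 0) (c : Ell1 V W) :
    f c = 0 := by
  classical
  obtain ⟨S, T, hS, hT, hc⟩ := c.2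
  have hlim := lp.hasSum_single (p := 1) (by simp) c.val
  suffices c ∈ LinearMap.ker f.toLin from LinearMap.mem_ker.1 this
  obtain ⟨E, hE1, _, hE3, hE4⟩ := exists_disk (isBounded_iff.2 ⟨S, T, 1, hS, hT, le_rfl⟩)
  refine (isBornClosed_ker f).mem_of_approx hE3 fun ε hε => ?_
  obtain ⟨F, hF⟩ := (Metric.tendsto_nhds.1 hlim ε hε).exists
  refine ⟨∑ p ∈ F, c.val p • delta p.1 p.2, ?_, ?_⟩
  · refine Submodule.sum_mem _ fun p _ => Submodule.smul_mem _ _ ?_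
    exact LinearMap.mem_ker.2 (h p.1 p.2)
  · have hval : (∑ p ∈ F, c.val p • delta p.1 p.2).val
        = ∑ p ∈ F, lp.single 1 p (c.val p) := by
      rw [val_sum]
      refine Finset.sum_congr rfl fun p _ => ?_
      rw [val_smul, val_delta, ← lp.single_smul, smul_eq_mul, mul_one]
    refine Set.smul_set_mono hE1 ((mem_smul_ball hε).2 ⟨?_, ?_⟩)
    · intro p hp
      by_contra hcon
      refine hp ?_
      have h0 : c.val p = 0 := by
        by_contra h0
        exact hcon (hc p h0)
      rw [val_sub, hval]
      change c.val p - (∑ p ∈ F, lp.single 1 p (c.val p) : lp (fun _ : V × W => ℂ) 1) p = 0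
      rw [h0, zero_sub, neg_eq_zero, lp.coeFn_sum, Finset.sum_apply]
      refine Finset.sum_eq_zero fun q _ => ?_
      by_cases hq : p = q
      · subst hq; rw [lp.single_apply_self, h0]
      · exact lp.single_apply_ne 1 _ _ hq
    · rw [val_sub, hval, ← dist_eq_norm, dist_comm]
      exact hF.le

variable (V W) in
/-- The bilinear relations. -/
def bilinRel : Submodule ℂ (Ell1 V W) :=
  Submodule.span ℂ
    ({c | ∃ v v' w, c = delta (v + v') w - delta v w - delta v' w} ∪
     {c | ∃ v w w', c = delta v (w + w') - delta v w - delta v w'} ∪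
     {c | ∃ (z : ℂ) (v : V) (w : W), c = delta (z • v) w - z • delta v w} ∪
     {c | ∃ (z : ℂ) (v : V) (w : W), c = delta v (z • w) - z • delta v w})

end Ell1

variable (V W) in
/-- The completed bornological tensor product `V ⊗̂ W`. -/
def CTensor : Type _ := BQuot (Ell1.bilinRel V W)

namespace CTensor

instance : AddCommGroup (CTensor V W) := inferInstanceAs (AddCommGroup (BQuot _))
instance : Module ℂ (CTensor V W) := inferInstanceAs (Module ℂ (BQuot _))
instance : Bornology (CTensor V W) := inferInstanceAs (Bornology (BQuot _))
instance : CompleteBornology (CTensor V W) := inferInstanceAs (CompleteBornology (BQuot _))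

variable (V W) in
/-- The quotient map. -/
def proj : BHom (Ell1 V W) (CTensor V W) := BQuot.mk _

theorem proj_eq_zero_of_rel {c : Ell1 V W} (h : c ∈ Ell1.bilinRel V W) : proj V W c = 0 :=
  (BQuot.mk_eq_zero _).2 (le_bornClosure _ h)

variable (V W) in
/-- The canonical bounded bilinear map `V × W → V ⊗̂ W`. -/
def tmulHom : BHom V (BHom W (CTensor V W)) :=
  BHom.mk₂ (fun v w => proj V W (Ell1.delta v w))
    (fun v v' w => by
      rw [← sub_eq_zero, ← sub_sub, ← map_sub, ← map_sub]
      exact proj_eq_zero_of_rel (Submodule.subset_span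
        (Or.inl (Or.inl (Or.inl ⟨v, v', w, rfl⟩)))))
    (fun z v w => by
      rw [← sub_eq_zero, ← map_smul, ← map_sub]
      exact proj_eq_zero_of_rel (Submodule.subset_span (Or.inl (Or.inr ⟨z, v, w, rfl⟩))))
    (fun v w w' => by
      rw [← sub_eq_zero, ← sub_sub, ← map_sub, ← map_sub]
      exact proj_eq_zero_of_rel (Submodule.subset_span (Or.inl (Or.inl (Or.inr ⟨v, w, w', rfl⟩)))))
    (fun z v w => by
      rw [← sub_eq_zero, ← map_smul, ← map_sub]
      exact proj_eq_zero_of_rel (Submodule.subset_span (Or.inr ⟨z, v, w, rfl⟩)))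
    (fun s t hs ht => by
      classical
      have h : IsBounded (Set.image2 (fun v w => Ell1.delta v w) s t) := by
        refine Ell1.isBounded_iff.2 ⟨s, t, 1, hs, ht, ?_⟩
        rintro _ ⟨v, hv, w, hw, rfl⟩
        refine ⟨fun p hp => ?_, ?_⟩
        · by_cases h : p = (v, w)
          · subst h; exact ⟨hv, hw⟩
          · rw [Ell1.val_delta, lp.single_apply_ne 1 _ _ h] at hp
            exact (hp rfl).elim
        · rw [Ell1.val_delta, lp.norm_single (by simp)]
          simp
      have h2 := (proj V W).bounded _ h
      rwa [Set.image_image2] at h2)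

/-- The elementary tensor `v ⊗ w`. -/
def tmul (v : V) (w : W) : CTensor V W := tmulHom V W v w

@[simp] theorem tmulHom_apply (v : V) (w : W) : tmulHom V W v w = tmul v w := rfl

theorem bilinRel_le_ker (b : BHom V (BHom W X)) :
    bornClosure (Ell1.bilinRel V W) ≤ LinearMap.ker (Ell1.extend b).toLin := by
  refine bornClosure_le (isBornClosed_ker _) (Submodule.span_le.2 ?_)
  rintro c (((⟨v, v', w, rfl⟩ | ⟨v, w, w', rfl⟩) | ⟨z, v, w, rfl⟩) | ⟨z, v, w, rfl⟩) <;>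
  · rw [SetLike.mem_coe, LinearMap.mem_ker]
    simp [Ell1.extend_delta, sub_sub]

/-- The universal property: bounded bilinear maps `V × W → X` correspond to bounded linear maps
`V ⊗̂ W → X`. -/
def lift (b : BHom V (BHom W X)) : BHom (CTensor V W) X :=
  BHom.mk ((bornClosure (Ell1.bilinRel V W)).liftQ (Ell1.extend b).toLin (bilinRel_le_ker b))
    (fun s hs => by
      obtain ⟨t, ht, h⟩ := (BQuot.isBounded_iff _).1 hs
      refine ((Ell1.extend b).bounded t ht).subset ?_
      rintro _ ⟨x, hx, rfl⟩
      obtain ⟨c, hc, rfl⟩ := h hx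
      exact ⟨c, hc, rfl⟩)

theorem lift_proj (b : BHom V (BHom W X)) (c : Ell1 V W) :
    lift b (proj V W c) = Ell1.extend b c := rfl

@[simp] theorem lift_tmul (b : BHom V (BHom W X)) (v : V) (w : W) :
    lift b (tmul v w) = b v w := by
  change lift b (proj V W (Ell1.delta v w)) = b v w
  rw [lift_proj, Ell1.extend_delta]

theorem proj_surjective : Function.Surjective (proj V W) := BQuot.mk_surjective _

theorem hom_ext {f g : BHom (CTensor V W) X} (h : ∀ v w, f (tmul v w) = g (tmul v w)) :
    f = g := by
  ext x
  obtain ⟨c, rfl⟩ := proj_surjective x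
  have := Ell1.eq_zero_of_delta (f := (f - g).comp (proj V W))
    (fun v w => by
      simp only [BHom.comp_apply, BHom.sub_apply]
      exact sub_eq_zero.2 (h v w)) c
  simp only [BHom.comp_apply, BHom.sub_apply] at this
  exact sub_eq_zero.1 this

theorem isBounded_lift {B : Set (BHom V (BHom W X))} (hB : IsBounded B) :
    IsBounded (lift '' B) := by
  refine BHom.isBounded_iff.2 fun s hs => ?_
  obtain ⟨t, ht, h⟩ := (BQuot.isBounded_iff _).1 hs
  obtain ⟨S, T, r, hS, hT, h'⟩ := Ell1.isBounded_iff.1 ht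
  obtain ⟨D, hD1, hD2, hD3, hD4⟩ := exists_disk
    (BHom.isBounded_iff.1 (BHom.isBounded_iff.1 hB S hS) T hT)
  refine (isBounded_rsmul (r + 1) hD3).subset ?_
  rintro _ ⟨_, ⟨b, hb, rfl⟩, x, hx, rfl⟩
  obtain ⟨c, hc, rfl⟩ := h hx
  exact Ell1.bsum_mem hD4 hD3 hD2 (h' hc) fun v hv w hw =>
    hD1 ⟨b v, ⟨b, hb, v, hv, rfl⟩, w, hw, rfl⟩

end CTensor

end Tensor

/-! ## Operations on bounded bilinear maps and tensor products -/

section Operations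

variable {U V W X Y V' W' : Type*}
  [AddCommGroup U] [Module ℂ U] [Bornology U] [CompleteBornology U]
  [AddCommGroup V] [Module ℂ V] [Bornology V] [CompleteBornology V]
  [AddCommGroup W] [Module ℂ W] [Bornology W] [CompleteBornology W]
  [AddCommGroup X] [Module ℂ X] [Bornology X] [CompleteBornology X]
  [AddCommGroup Y] [Module ℂ Y] [Bornology Y] [CompleteBornology Y]
  [AddCommGroup V'] [Module ℂ V'] [Bornology V'] [CompleteBornology V']
  [AddCommGroup W'] [Module ℂ W'] [Bornology W'] [CompleteBornology W']

namespace BHom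

/-- `(v, w) ↦ g (b (v, w))`. -/
def postcomp (g : BHom X Y) (b : BHom V (BHom W X)) : BHom V (BHom W Y) :=
  mk₂ (fun v w => g (b v w)) (by simp) (by simp) (by simp) (by simp)
    (fun s t hs ht => by
      have := g.bounded _ (b.bounded₂ hs ht)
      rwa [Set.image_image2] at this)

@[simp] theorem postcomp_apply (g : BHom X Y) (b : BHom V (BHom W X)) (v : V) (w : W) :
    postcomp g b v w = g (b v w) := rfl

/-- `(v, w) ↦ b (f v, g w)`. -/
def precomp (b : BHom V' (BHom W' X)) (f : BHom V V') (g : BHom W W') : BHom V (BHom W X) :=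
  mk₂ (fun v w => b (f v) (g w)) (by simp) (by simp) (by simp) (by simp)
    (fun s t hs ht => by
      have := b.bounded₂ (f.bounded s hs) (g.bounded t ht)
      rwa [Set.image2_image_left, Set.image2_image_right] at this)

@[simp] theorem precomp_apply (b : BHom V' (BHom W' X)) (f : BHom V V') (g : BHom W W')
    (v : V) (w : W) : precomp b f g v w = b (f v) (g w) := rfl

/-- `(w, v) ↦ b (v, w)`. -/
def flip (b : BHom V (BHom W X)) : BHom W (BHom V X) :=
  mk₂ (fun w v => b v w) (by simp) (by simp) (by simp) (by simp)
    (fun s t hs ht => by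
      have := b.bounded₂ ht hs
      rwa [Set.image2_swap] at this)

@[simp] theorem flip_apply (b : BHom V (BHom W X)) (v : V) (w : W) : flip b w v = b v w := rfl

variable (W X) in
/-- The evaluation pairing `Hom(W, X) × W → X`. -/
def evalHom : BHom (BHom W X) (BHom W X) := BHom.id _

variable (V W X) in
/-- Composition of bounded linear maps as a bounded bilinear map. -/
def compHom : BHom (BHom W X) (BHom (BHom V W) (BHom V X)) :=
  mk₂ (fun g f => g.comp f) (fun _ _ _ => rfl) (fun _ _ _ => rfl)
    (fun g _ _ => ext fun x => by simp) (fun c g _ => ext fun x => by simp)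
    (fun L M hL hM => isBounded_iff.2 fun s hs => by
      refine (isBounded_iff.1 hL _ (isBounded_iff.1 hM s hs)).subset ?_
      rintro _ ⟨_, ⟨g, hg, f, hf, rfl⟩, x, hx, rfl⟩
      exact ⟨g, hg, f x, ⟨f, hf, x, hx, rfl⟩, rfl⟩)

@[simp] theorem compHom_apply (g : BHom W X) (f : BHom V W) : compHom V W X g f = g.comp f := rfl

/-- Evaluation at a point. -/
def eval (w : W) : BHom (BHom W X) X := flip (evalHom W X) w

@[simp] theorem eval_apply (w : W) (f : BHom W X) : eval w f = f w := rfl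

end BHom

namespace CTensor

theorem bilin_ext {f g : BHom (CTensor V W) (BHom (CTensor V' W') X)}
    (h : ∀ v w v' w', f (tmul v w) (tmul v' w') = g (tmul v w) (tmul v' w'))
    (x : CTensor V W) (y : CTensor V' W') : f x y = g x y := by
  have : f = g := hom_ext fun v w => hom_ext fun v' w' => h v w v' w'
  rw [this]

/-- The tensor product `f ⊗̂ g` of two bounded linear maps. -/
def map (f : BHom V V') (g : BHom W W') : BHom (CTensor V W) (CTensor V' W') :=
  lift (BHom.precomp (tmulHom V' W') f g)

@[simp] theorem map_tmul (f : BHom V V') (g : BHom W W') (v : V) (w : W) :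
    map f g (tmul v w) = tmul (f v) (g w) := by simp [map]

variable (V V' W W') in
/-- `(f, g) ↦ f ⊗̂ g` as a bounded bilinear map. -/
def mapHom : BHom (BHom V V') (BHom (BHom W W') (BHom (CTensor V W) (CTensor V' W'))) :=
  BHom.mk₂ map
    (fun f f' g => hom_ext fun v w => by
      simp only [BHom.add_apply, map_tmul]
      simp [← tmulHom_apply])
    (fun c f g => hom_ext fun v w => by
      simp only [BHom.smul_apply, map_tmul]
      simp [← tmulHom_apply])
    (fun f g g' => hom_ext fun v w => by
      simp only [BHom.add_apply, map_tmul]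
      simp [← tmulHom_apply])
    (fun c f g => hom_ext fun v w => by
      simp only [BHom.smul_apply, map_tmul]
      simp [← tmulHom_apply])
    (fun L M hL hM => by
      have : IsBounded (Set.image2 (fun f g => BHom.precomp (tmulHom V' W') f g) L M) := by
        refine BHom.isBounded_iff.2 fun s hs => BHom.isBounded_iff.2 fun t ht => ?_
        refine ((tmulHom V' W').bounded₂ (BHom.isBounded_iff.1 hL s hs)
          (BHom.isBounded_iff.1 hM t ht)).subset ?_
        rintro _ ⟨_, ⟨_, ⟨f, hf, g, hg, rfl⟩, v, hv, rfl⟩, w, hw, rfl⟩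
        exact ⟨f v, ⟨f, hf, v, hv, rfl⟩, g w, ⟨g, hg, w, hw, rfl⟩, rfl⟩
      have h2 := isBounded_lift this
      rwa [Set.image_image2] at h2)

@[simp] theorem mapHom_apply (f : BHom V V') (g : BHom W W') : mapHom V W V' W' f g = map f g :=
  rfl

variable (V W) in
/-- The flip `v ⊗ w ↦ w ⊗ v`. -/
def flip : BHom (CTensor V W) (CTensor W V) := lift (BHom.flip (tmulHom W V))

@[simp] theorem flip_tmul (v : V) (w : W) : flip V W (tmul v w) = tmul w v := by simp [flip]

variable (V W X) in
/-- The associativity isomorphism `(v ⊗ w) ⊗ x ↦ v ⊗ (w ⊗ x)`. -/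
def assoc : BHom (CTensor (CTensor V W) X) (CTensor V (CTensor W X)) :=
  lift (lift (BHom.precomp (BHom.compHom X (CTensor W X) (CTensor V (CTensor W X)))
    (tmulHom V (CTensor W X)) (tmulHom W X)))

@[simp] theorem assoc_tmul (v : V) (w : W) (x : X) :
    assoc V W X (tmul (tmul v w) x) = tmul v (tmul w x) := by
  simp [assoc]

end CTensor

end Operations

/-! ## The complex numbers -/

instance : CompleteBornology ℂ where
  smul_bounded c s hs := hs.smul₀ c
  exists_completant s hs := by
    obtain ⟨r, hr, h⟩ := hs.subset_closedBall_lt 0 0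
    have hg : ∀ x : ℂ, gauge (Metric.closedBall (0 : ℂ) r) x = ‖x‖ / r :=
      gauge_closedBall hr.le
    have hspan : Submodule.span ℂ (Metric.closedBall (0 : ℂ) r) = ⊤ := by
      rw [eq_top_iff]
      intro x _
      have h1 : (r : ℂ) ∈ Submodule.span ℂ (Metric.closedBall (0 : ℂ) r) :=
        Submodule.subset_span (by simp [abs_of_pos hr])
      have h2 := Submodule.smul_mem _ (x / r) h1
      rwa [smul_eq_mul, div_mul_cancel₀ _ (by exact_mod_cast hr.ne')] at h2
    refine ⟨_, h, Metric.isBounded_closedBall,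
      ⟨balanced_closedBall_zero, convex_closedBall _ _⟩, ?_, ?_⟩
    · intro x _ hx
      rw [hg, div_eq_zero_iff] at hx
      simpa [hr.ne'] using hx
    · intro u _ hc
      have hcs : CauchySeq u := by
        rw [Metric.cauchySeq_iff]
        intro ε hε
        obtain ⟨N, hN⟩ := hc (ε / r) (by positivity)
        refine ⟨N, fun m hm n hn => ?_⟩
        have := hN m hm n hn
        rw [hg, div_lt_div_iff_of_pos_right hr] at this
        rwa [dist_eq_norm]
      obtain ⟨x, hx⟩ := cauchySeq_tendsto_of_complete hcs
      refine ⟨x, by rw [hspan]; trivial, ?_⟩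
      simp_rw [hg]
      simpa using (tendsto_iff_norm_sub_tendsto_zero.1 hx).div_const r

section Slices

variable {V W : Type*}
  [AddCommGroup V] [Module ℂ V] [Bornology V] [CompleteBornology V]
  [AddCommGroup W] [Module ℂ W] [Bornology W] [CompleteBornology W]

/-- The scalar multiplication as a bounded bilinear map. -/
def BHom.smulHom (V : Type*) [AddCommGroup V] [Module ℂ V] [Bornology V] [CompleteBornology V] :
    BHom ℂ (BHom V V) :=
  BHom.mk₂ (fun z v => z • v) (fun _ _ _ => add_smul _ _ _) (fun _ _ _ => mul_smul _ _ _)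
    (fun _ _ _ => smul_add _ _ _) (fun c z v => smul_comm z c v)
    (fun s t hs ht => by
      obtain ⟨r, hr⟩ := hs.exists_norm_le
      obtain ⟨D, hD1, _, hD3, hD4⟩ := exists_disk ht
      refine (isBounded_rsmul r hD3).subset ?_
      rintro _ ⟨z, hz, v, hv, rfl⟩
      have := hD4.disk.csmul_mem (r := 1) z (by simpa using hD1 hv)
      rw [mul_one] at this
      exact hD4.disk.smul_subset (norm_nonneg _) (hr z hz) this)

/-- The slice map `id ⊗̂ ω`. -/
def idTensor (V : Type*) [AddCommGroup V] [Module ℂ V] [Bornology V] [CompleteBornology V]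
    (ω : BHom W ℂ) : BHom (CTensor V W) V :=
  CTensor.lift (BHom.flip (BHom.precomp (BHom.smulHom V) ω (BHom.id V)))

@[simp] theorem idTensor_tmul (ω : BHom W ℂ) (v : V) (w : W) :
    idTensor V ω (CTensor.tmul v w) = ω w • v := by
  simp [idTensor]; rfl

/-- The slice map `ω ⊗̂ id`. -/
def tensorId (W : Type*) [AddCommGroup W] [Module ℂ W] [Bornology W] [CompleteBornology W]
    (ω : BHom V ℂ) : BHom (CTensor V W) W :=
  CTensor.lift (BHom.precomp (BHom.smulHom W) ω (BHom.id W))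

@[simp] theorem tensorId_tmul (ω : BHom V ℂ) (v : V) (w : W) :
    tensorId W ω (CTensor.tmul v w) = ω v • w := by
  simp [tensorId]; rfl

end Slices

/-! ## The approximation property -/

section Approximation

variable {V : Type*} [AddCommGroup V] [Module ℂ V] [Bornology V] [CompleteBornology V]

/-- A compact disk: a disk which is a (sequentially) compact subset of the Banach space `⟨T⟩` for
some bounded completant disk `T`. -/
def IsCompactDisk (S : Set V) : Prop :=
  IsDisk S ∧ ∃ T : Set V, IsBounded T ∧ IsCompletant T ∧ S ⊆ Submodule.span ℂ T ∧
    ∀ u : ℕ → V, (∀ n, u n ∈ S) → ∃ x ∈ S, ∃ k : ℕ → ℕ, StrictMono k ∧ ConvergesIn T (u ∘ k) x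

/-- Finite rank operators: the finite sums `x ↦ ∑ ωᵢ(x) wᵢ` with bounded functionals `ωᵢ`. -/
def IsFiniteRank (f : BHom V V) : Prop :=
  ∃ (k : ℕ) (ω : Fin k → BHom V ℂ) (w : Fin k → V), ∀ x, f x = ∑ i, ω i x • w i

variable (V) in
/-- The approximation property: for every compact disk `S` there are finite rank operators
converging to the identity in `Hom(⟨S⟩, V)`, that is, such that the differences map `S` into
`εₙ T` for one bounded disk `T` and a null sequence `εₙ`. -/
def ApproximationProperty : Prop :=
  ∀ S : Set V, IsCompactDisk S → ∃ f : ℕ → BHom V V, (∀ n, IsFiniteRank (f n)) ∧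
    ∃ T : Set V, IsDisk T ∧ IsBounded T ∧ ∃ ε : ℕ → ℝ, Tendsto ε atTop (𝓝 0) ∧
      ∀ n, ∀ x ∈ S, f n x - x ∈ ε n • T

end Approximation

/-! ## Bornological algebras and multipliers -/

/-- The multiplication of a bornological algebra is bounded. -/
class BornologicalAlgebra (A : Type*) [NonUnitalRing A] [Bornology A] : Prop where
  mul_bounded : ∀ s t : Set A, IsBounded s → IsBounded t → IsBounded (s * t)

instance : BornologicalAlgebra ℂ where
  mul_bounded s t hs ht := by
    obtain ⟨a, ha⟩ := hs.exists_norm_le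
    obtain ⟨b, hb⟩ := ht.exists_norm_le
    refine isBounded_iff_forall_norm_le.2 ⟨a * b, ?_⟩
    rintro _ ⟨x, hx, y, hy, rfl⟩
    simp only [norm_mul]
    exact mul_le_mul (ha x hx) (hb y hy) (norm_nonneg _) ((norm_nonneg _).trans (ha x hx))

section Algebra

variable (A B K L : Type*)
  [NonUnitalRing A] [Module ℂ A] [IsScalarTower ℂ A A] [SMulCommClass ℂ A A]
  [Bornology A] [CompleteBornology A] [BornologicalAlgebra A]
  [NonUnitalRing B] [Module ℂ B] [IsScalarTower ℂ B B] [SMulCommClass ℂ B B]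
  [Bornology B] [CompleteBornology B] [BornologicalAlgebra B]
  [NonUnitalRing K] [Module ℂ K] [IsScalarTower ℂ K K] [SMulCommClass ℂ K K]
  [Bornology K] [CompleteBornology K] [BornologicalAlgebra K]
  [NonUnitalRing L] [Module ℂ L] [IsScalarTower ℂ L L] [SMulCommClass ℂ L L]
  [Bornology L] [CompleteBornology L] [BornologicalAlgebra L]

/-- The multiplication as a bounded bilinear map. -/
def mulHom : BHom A (BHom A A) :=
  BHom.mk₂ (· * ·) add_mul smul_mul_assoc mul_add mul_smul_comm
    (fun s t hs ht => BornologicalAlgebra.mul_bounded s t hs ht)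

variable {A B K L}

@[simp] theorem mulHom_apply (a b : A) : mulHom A a b = a * b := rfl

namespace CTensor

/-- The multiplication of `A ⊗̂ B`, with `(a ⊗ b) (a' ⊗ b') = a a' ⊗ b b'`. -/
def mulT : BHom (CTensor A B) (BHom (CTensor A B) (CTensor A B)) :=
  lift (BHom.precomp (mapHom A B A B) (mulHom A) (mulHom B))

theorem mulT_tmul (a a' : A) (b b' : B) :
    mulT (tmul a b) (tmul a' b') = tmul (a * a') (b * b') := by simp [mulT]

theorem mulT_assoc (x y z : CTensor A B) : mulT (mulT x y) z = mulT x (mulT y z) := by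
  refine bilin_ext (f := BHom.postcomp (BHom.flip mulT z) mulT)
    (g := BHom.precomp mulT (BHom.id _) (BHom.flip mulT z)) (fun a b a' b' => ?_) x y
  have : mulT (mulT (tmul a b) (tmul a' b')) =
      (mulT (tmul a b)).comp (mulT (tmul a' b')) :=
    hom_ext fun a'' b'' => by simp [mulT_tmul, mul_assoc]
  exact DFunLike.congr_fun this z

instance : NonUnitalRing (CTensor A B) where
  __ := (inferInstance : AddCommGroup (CTensor A B))
  mul x y := mulT x y
  left_distrib x y z := map_add (mulT x) y z
  right_distrib x y z := by
    change mulT (x + y) z = mulT x z + mulT y z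
    simp
  zero_mul x := by
    change mulT 0 x = 0
    simp
  mul_zero x := map_zero (mulT x)
  mul_assoc := mulT_assoc

theorem mul_def (x y : CTensor A B) : x * y = mulT x y := rfl

@[simp] theorem tmul_mul_tmul (a a' : A) (b b' : B) :
    (tmul a b * tmul a' b' : CTensor A B) = tmul (a * a') (b * b') := mulT_tmul a a' b b'

instance : IsScalarTower ℂ (CTensor A B) (CTensor A B) where
  smul_assoc c x y := by
    change mulT (c • x) y = c • mulT x y
    simp

instance : SMulCommClass ℂ (CTensor A B) (CTensor A B) where
  smul_comm c x y := by
    change c • mulT x y = mulT x (c • y)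
    simp

instance : BornologicalAlgebra (CTensor A B) where
  mul_bounded _ _ hs ht := (mulT (A := A) (B := B)).bounded₂ hs ht

end CTensor

variable (K) in
/-- The multiplier algebra `M(K)`: pairs `(L, R)` of bounded linear maps with `L (f g) = L(f) g`,
`R (f g) = f R(g)` and `f L(g) = R(f) g`. The product of `(L, R)` and `(L', R')` is
`(L ∘ L', R' ∘ R)`. -/
def multiplierSubalgebra : Subalgebra ℂ (Module.End ℂ K × (Module.End ℂ K)ᵐᵒᵖ) where
  carrier := {m | IsBoundedMap m.1 ∧ IsBoundedMap m.2.unop ∧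
    (∀ f g, m.1 (f * g) = m.1 f * g) ∧ (∀ f g, m.2.unop (f * g) = f * m.2.unop g) ∧
    ∀ f g, f * m.1 g = m.2.unop f * g}
  mul_mem' := by
    rintro ⟨l, r⟩ ⟨l', r'⟩ ⟨h1, h2, h3, h4, h5⟩ ⟨h1', h2', h3', h4', h5'⟩
    refine ⟨fun s hs => ?_, fun s hs => ?_, fun f g => ?_, fun f g => ?_, fun f g => ?_⟩
    · have := h1 _ (h1' s hs)
      rwa [Set.image_image] at this
    · have := h2' _ (h2 s hs)
      rwa [Set.image_image] at this
    · change l (l' (f * g)) = l (l' f) * g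
      simp only at h3 h3'
      rw [h3', h3]
    · change r'.unop (r.unop (f * g)) = f * r'.unop (r.unop g)
      simp only at h4 h4'
      rw [h4, h4']
    · change f * l (l' g) = r'.unop (r.unop f) * g
      simp only at h5 h5'
      rw [h5, h5']
  add_mem' := by
    rintro ⟨l, r⟩ ⟨l', r'⟩ ⟨h1, h2, h3, h4, h5⟩ ⟨h1', h2', h3', h4', h5'⟩
    refine ⟨(boundedMaps K K).add_mem h1 h1', (boundedMaps K K).add_mem h2 h2',
      fun f g => ?_, fun f g => ?_, fun f g => ?_⟩
    · change l (f * g) + l' (f * g) = (l f + l' f) * g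
      simp only at h3 h3'
      rw [h3, h3', add_mul]
    · change r.unop (f * g) + r'.unop (f * g) = f * (r.unop g + r'.unop g)
      simp only at h4 h4'
      rw [h4, h4', mul_add]
    · change f * (l g + l' g) = (r.unop f + r'.unop f) * g
      simp only at h5 h5'
      rw [mul_add, add_mul, h5, h5']
  algebraMap_mem' := by
    intro c
    refine ⟨(boundedMaps K K).smul_mem c (BHom.id K).2,
      (boundedMaps K K).smul_mem c (BHom.id K).2, fun f g => ?_, fun f g => ?_, fun f g => ?_⟩
    · exact (smul_mul_assoc c f g).symm
    · exact (mul_smul_comm c f g).symm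
    · exact (mul_smul_comm c f g).trans (smul_mul_assoc c f g).symm

variable (K) in
/-- The multiplier algebra `M(K)`. -/
def Multiplier : Type _ := multiplierSubalgebra K

namespace Multiplier

instance : Ring (Multiplier K) := inferInstanceAs (Ring (multiplierSubalgebra K))
instance : Algebra ℂ (Multiplier K) := inferInstanceAs (Algebra ℂ (multiplierSubalgebra K))

/-- Left multiplication `x ↦ m · x` by a multiplier. -/
def left (m : Multiplier K) : BHom K K := BHom.mk m.1.1 m.2.1

/-- Right multiplication `x ↦ x · m` by a multiplier. -/
def right (m : Multiplier K) : BHom K K := BHom.mk m.1.2.unop m.2.2.1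

theorem left_mul' (m : Multiplier K) (x y : K) : m.left (x * y) = m.left x * y := m.2.2.2.1 x y

theorem right_mul' (m : Multiplier K) (x y : K) : m.right (x * y) = x * m.right y :=
  m.2.2.2.2.1 x y

theorem compat (m : Multiplier K) (x y : K) : x * m.left y = m.right x * y := m.2.2.2.2.2 x y

@[ext] theorem ext {m n : Multiplier K} (h1 : ∀ x, m.left x = n.left x)
    (h2 : ∀ x, m.right x = n.right x) : m = n :=
  Subtype.ext (Prod.ext (LinearMap.ext h1) (MulOpposite.unop_injective (LinearMap.ext h2)))

/-- Build a multiplier. -/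
def mk (l r : BHom K K) (h1 : ∀ f g, l (f * g) = l f * g) (h2 : ∀ f g, r (f * g) = f * r g)
    (h3 : ∀ f g, f * l g = r f * g) : Multiplier K :=
  ⟨(l.toLin, MulOpposite.op r.toLin), l.bounded, r.bounded, h1, h2, h3⟩

@[simp] theorem left_mk (l r : BHom K K) (h1 h2 h3) : (mk l r h1 h2 h3).left = l := rfl
@[simp] theorem right_mk (l r : BHom K K) (h1 h2 h3) : (mk l r h1 h2 h3).right = r := rfl
@[simp] theorem left_mul (m n : Multiplier K) (x : K) : (m * n).left x = m.left (n.left x) := rfl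
@[simp] theorem right_mul (m n : Multiplier K) (x : K) :
    (m * n).right x = n.right (m.right x) := rfl
@[simp] theorem left_add (m n : Multiplier K) : (m + n).left = m.left + n.left := rfl
@[simp] theorem right_add (m n : Multiplier K) : (m + n).right = m.right + n.right := rfl
@[simp] theorem left_smul (c : ℂ) (m : Multiplier K) : (c • m).left = c • m.left := rfl
@[simp] theorem right_smul (c : ℂ) (m : Multiplier K) : (c • m).right = c • m.right := rfl
@[simp] theorem left_one (x : K) : (1 : Multiplier K).left x = x := rfl
@[simp] theorem right_one (x : K) : (1 : Multiplier K).right x = x := rfl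

/-- The bornology of `M(K)`: the left and the right multiplications are equibounded. -/
instance : Bornology (Multiplier K) :=
  Bornology.ofBounded {M | IsBounded (left '' M) ∧ IsBounded (right '' M)}
    (by simp)
    (fun _ h _ h' => ⟨h.1.subset (Set.image_mono h'), h.2.subset (Set.image_mono h')⟩)
    (fun _ h _ h' => by
      simp only [Set.mem_ofPred_eq, Set.image_union, isBounded_union]
      exact ⟨⟨h.1, h'.1⟩, h.2, h'.2⟩)
    (fun m => by simp)

theorem isBounded_iff {M : Set (Multiplier K)} :
    IsBounded M ↔ IsBounded (left '' M) ∧ IsBounded (right '' M) :=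
  Bornology.isBounded_ofBounded_iff _

/-- The tensor product of two multipliers, acting on `K ⊗̂ L`. -/
def tensor (m : Multiplier K) (n : Multiplier L) : Multiplier (CTensor K L) :=
  mk (CTensor.map m.left n.left) (CTensor.map m.right n.right)
    (CTensor.bilin_ext (f := BHom.postcomp (CTensor.map m.left n.left) CTensor.mulT)
      (g := BHom.precomp CTensor.mulT (CTensor.map m.left n.left) (BHom.id _))
      (fun a b a' b' => by simp [CTensor.mulT_tmul, left_mul']))
    (CTensor.bilin_ext (f := BHom.postcomp (CTensor.map m.right n.right) CTensor.mulT)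
      (g := BHom.precomp CTensor.mulT (BHom.id _) (CTensor.map m.right n.right))
      (fun a b a' b' => by simp [CTensor.mulT_tmul, right_mul']))
    (CTensor.bilin_ext (f := BHom.precomp CTensor.mulT (BHom.id _) (CTensor.map m.left n.left))
      (g := BHom.precomp CTensor.mulT (CTensor.map m.right n.right) (BHom.id _))
      (fun a b a' b' => by simp [CTensor.mulT_tmul, compat]))

@[simp] theorem tensor_left (m : Multiplier K) (n : Multiplier L) :
    (tensor m n).left = CTensor.map m.left n.left := rfl
@[simp] theorem tensor_right (m : Multiplier K) (n : Multiplier L) :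
    (tensor m n).right = CTensor.map m.right n.right := rfl

/-- The multiplier given by an element of the algebra. -/
def of (a : K) : Multiplier K :=
  mk (mulHom K a) (BHom.flip (mulHom K) a) (fun f g => (mul_assoc a f g).symm)
    (fun f g => mul_assoc f g a) (fun f g => (mul_assoc f a g).symm)

@[simp] theorem of_left (a x : K) : (of a).left x = a * x := rfl
@[simp] theorem of_right (a x : K) : (of a).right x = x * a := rfl

end Multiplier

variable (A K) in
/-- A (bounded) homomorphism `A → M(K)`. -/
structure MultHom extends A →ₙₐ[ℂ] Multiplier K where
  bounded' : IsBoundedMap toFun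

namespace MultHom

instance : CoeFun (MultHom A K) (fun _ => A → Multiplier K) := ⟨fun f => f.toNonUnitalAlgHom⟩

/-- The left action of `A` on `K`, as a bounded bilinear map. -/
def leftHom (f : MultHom A K) : BHom A (BHom K K) :=
  BHom.mk
    { toFun := fun a => (f a).left
      map_add' := fun a b => by rw [map_add, Multiplier.left_add]
      map_smul' := fun c a => by rw [map_smul, Multiplier.left_smul]; rfl }
    (fun s hs => by
      have := (Multiplier.isBounded_iff.1 (f.bounded' s hs)).1
      rwa [Set.image_image] at this)

/-- The right action of `A` on `K`, as a bounded bilinear map. -/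
def rightHom (f : MultHom A K) : BHom A (BHom K K) :=
  BHom.mk
    { toFun := fun a => (f a).right
      map_add' := fun a b => by rw [map_add, Multiplier.right_add]
      map_smul' := fun c a => by rw [map_smul, Multiplier.right_smul]; rfl }
    (fun s hs => by
      have := (Multiplier.isBounded_iff.1 (f.bounded' s hs)).2
      rwa [Set.image_image] at this)

@[simp] theorem leftHom_apply (f : MultHom A K) (a : A) : f.leftHom a = (f a).left := rfl
@[simp] theorem rightHom_apply (f : MultHom A K) (a : A) : f.rightHom a = (f a).right := rfl

variable (A) in
/-- The canonical homomorphism `ι : A → M(A)`. -/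
def incl : MultHom A A where
  toFun := Multiplier.of
  map_smul' c a := by ext x <;> simp [smul_mul_assoc, mul_smul_comm]
  map_zero' := by
    have h : ∀ m : Multiplier A, m + m = m → m = 0 := fun m hm => by simpa using hm
    exact h _ (by ext x <;> simp)
  map_add' a b := by ext x <;> simp [add_mul, mul_add]
  map_mul' a b := by ext x <;> simp [mul_assoc]
  bounded' s hs := by
    rw [Multiplier.isBounded_iff, Set.image_image, Set.image_image]
    exact ⟨(mulHom A).bounded s hs, (BHom.flip (mulHom A)).bounded s hs⟩

@[simp] theorem incl_apply (a : A) : incl A a = Multiplier.of a := rfl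

section TensorHom

variable (f : MultHom A K) (g : MultHom B L)

/-- The left action of `A ⊗̂ B` on `K ⊗̂ L`. -/
def tensorLeft : BHom (CTensor A B) (BHom (CTensor K L) (CTensor K L)) :=
  CTensor.lift (BHom.precomp (CTensor.mapHom K L K L) f.leftHom g.leftHom)

/-- The right action of `A ⊗̂ B` on `K ⊗̂ L`. -/
def tensorRight : BHom (CTensor A B) (BHom (CTensor K L) (CTensor K L)) :=
  CTensor.lift (BHom.precomp (CTensor.mapHom K L K L) f.rightHom g.rightHom)

theorem tensorLeft_tmul (a : A) (b : B) :
    tensorLeft f g (CTensor.tmul a b) = (Multiplier.tensor (f a) (g b)).left := by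
  simp [tensorLeft]

theorem tensorRight_tmul (a : A) (b : B) :
    tensorRight f g (CTensor.tmul a b) = (Multiplier.tensor (f a) (g b)).right := by
  simp [tensorRight]

/-- The multiplier of `K ⊗̂ L` given by an element of `A ⊗̂ B`. -/
def tensorFun (x : CTensor A B) : Multiplier (CTensor K L) :=
  Multiplier.mk (tensorLeft f g x) (tensorRight f g x)
    (fun y z => by
      have : (BHom.eval (y * z)).comp (tensorLeft f g) =
          (BHom.flip (mulHom _) z).comp ((BHom.eval y).comp (tensorLeft f g)) :=
        CTensor.hom_ext fun a b => by
          simp only [BHom.comp_apply, tensorLeft_tmul, BHom.eval_apply]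
          exact Multiplier.left_mul' _ y z
      exact DFunLike.congr_fun this x)
    (fun y z => by
      have : (BHom.eval (y * z)).comp (tensorRight f g) =
          (mulHom _ y).comp ((BHom.eval z).comp (tensorRight f g)) :=
        CTensor.hom_ext fun a b => by
          simp only [BHom.comp_apply, tensorRight_tmul, BHom.eval_apply]
          exact Multiplier.right_mul' _ y z
      exact DFunLike.congr_fun this x)
    (fun y z => by
      have : (mulHom _ y).comp ((BHom.eval z).comp (tensorLeft f g)) =
          (BHom.flip (mulHom _) z).comp ((BHom.eval y).comp (tensorRight f g)) :=
        CTensor.hom_ext fun a b => by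
          simp only [BHom.comp_apply, tensorRight_tmul, tensorLeft_tmul, BHom.eval_apply]
          exact Multiplier.compat _ y z
      exact DFunLike.congr_fun this x)

@[simp] theorem tensorFun_left (x : CTensor A B) : (tensorFun f g x).left = tensorLeft f g x := rfl
@[simp] theorem tensorFun_right (x : CTensor A B) : (tensorFun f g x).right = tensorRight f g x :=
  rfl

/-- The induced homomorphism `f ⊗̂ g : A ⊗̂ B → M(K ⊗̂ L)`, with `a ⊗ b ↦ f(a) ⊗ g(b)`. -/
def tensor : MultHom (CTensor A B) (CTensor K L) where
  toFun := tensorFun f g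
  map_smul' c x := by ext y <;> simp
  map_zero' := by
    have h : ∀ m : Multiplier (CTensor K L), m + m = m → m = 0 := fun m hm => by simpa using hm
    exact h _ (by ext x <;> simp)
  map_add' x y := by ext z <;> simp
  map_mul' x x' := by
    ext y
    · refine CTensor.bilin_ext
        (f := BHom.postcomp ((BHom.eval y).comp (tensorLeft f g)) CTensor.mulT)
        (g := BHom.precomp (tensorLeft f g) (BHom.id _) ((BHom.eval y).comp (tensorLeft f g)))
        (fun a b a' b' => ?_) x x'
      simp only [BHom.postcomp_apply, BHom.comp_apply, BHom.precomp_apply, BHom.id_apply,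
        CTensor.mulT_tmul, tensorLeft_tmul, BHom.eval_apply, map_mul, Multiplier.tensor_left]
      have : CTensor.map (f a * f a').left (g b * g b').left =
          (CTensor.map (f a).left (g b).left).comp (CTensor.map (f a').left (g b').left) :=
        CTensor.hom_ext fun v w => by simp
      exact DFunLike.congr_fun this y
    · refine CTensor.bilin_ext
        (f := BHom.postcomp ((BHom.eval y).comp (tensorRight f g)) CTensor.mulT)
        (g := BHom.flip (BHom.precomp (tensorRight f g) (BHom.id _)
          ((BHom.eval y).comp (tensorRight f g))))
        (fun a b a' b' => ?_) x x'
      simp only [BHom.postcomp_apply, BHom.comp_apply, BHom.precomp_apply, BHom.id_apply,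
        CTensor.mulT_tmul, tensorRight_tmul, BHom.eval_apply, map_mul, Multiplier.tensor_right,
        BHom.flip_apply]
      have : CTensor.map (f a * f a').right (g b * g b').right =
          (CTensor.map (f a').right (g b').right).comp (CTensor.map (f a).right (g b).right) :=
        CTensor.hom_ext fun v w => by simp
      exact DFunLike.congr_fun this y
  bounded' s hs := by
    rw [Multiplier.isBounded_iff, Set.image_image, Set.image_image]
    exact ⟨(tensorLeft f g).bounded s hs, (tensorRight f g).bounded s hs⟩

theorem tensor_tmul (a : A) (b : B) :
    tensor f g (CTensor.tmul a b) = Multiplier.tensor (f a) (g b) := by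
  change tensorFun f g _ = _
  refine Multiplier.ext (fun x => ?_) (fun x => ?_)
  · simp [tensorLeft_tmul]
  · simp [tensorRight_tmul]

end TensorHom

/-- `F : M(A) → M(K)` is a (bounded) unital homomorphism extending `f : A → M(K)`. For essential
`f` there is exactly one such `F`. -/
def IsExtension (f : MultHom A K) (F : Multiplier A →ₐ[ℂ] Multiplier K) : Prop :=
  IsBoundedMap F ∧ ∀ a, F (Multiplier.of a) = f a

end MultHom

end Algebra

/-! ## Essential algebras and homomorphisms -/

section Essential

variable {A V W X : Type*}
  [AddCommGroup V] [Module ℂ V] [Bornology V] [CompleteBornology V]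
  [AddCommGroup W] [Module ℂ W] [Bornology W] [CompleteBornology W]
  [AddCommGroup X] [Module ℂ X] [Bornology X] [CompleteBornology X]

/-- For a right action `r` of `A` on `V` and a left action `l` of `A` on `W`, the completed
balanced tensor product `V ⊗̂_A W`: the quotient of `V ⊗̂ W` by the closed subspace generated by
`v a ⊗ w - v ⊗ a w`. -/
def BalancedTensor (r : V → A → V) (l : A → W → W) : Type _ :=
  BQuot (Submodule.span ℂ {x : CTensor V W | ∃ v a w,
    x = CTensor.tmul (r v a) w - CTensor.tmul v (l a w)})

namespace BalancedTensor

variable (r : V → A → V) (l : A → W → W)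

instance : AddCommGroup (BalancedTensor r l) := inferInstanceAs (AddCommGroup (BQuot _))
instance : Module ℂ (BalancedTensor r l) := inferInstanceAs (Module ℂ (BQuot _))
instance : Bornology (BalancedTensor r l) := inferInstanceAs (Bornology (BQuot _))
instance : CompleteBornology (BalancedTensor r l) :=
  inferInstanceAs (CompleteBornology (BQuot _))

/-- The quotient map `V ⊗̂ W → V ⊗̂_A W`. -/
def mk : BHom (CTensor V W) (BalancedTensor r l) := BQuot.mk _

end BalancedTensor

/-- The bilinear map `m : V × W → X` induces a bornological isomorphism `V ⊗̂_A W ≅ X`. -/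
def InducesIso (r : V → A → V) (l : A → W → W) (m : V → W → X) : Prop :=
  ∃ e : BHom (BalancedTensor r l) X, IsBornIso e ∧
    ∀ v w, e (BalancedTensor.mk r l (CTensor.tmul v w)) = m v w

end Essential

/-! ## Bornological quantum groups -/

section QuantumGroup

variable (H : Type*)
  [NonUnitalRing H] [Module ℂ H] [IsScalarTower ℂ H H] [SMulCommClass ℂ H H]
  [Bornology H] [CompleteBornology H] [BornologicalAlgebra H]

/-- `H` is essential: the multiplication induces an isomorphism `H ⊗̂_H H ≅ H`. -/
def IsEssentialAlgebra : Prop :=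
  InducesIso (A := H) (V := H) (W := H) (X := H) (· * ·) (· * ·) (· * ·)

variable {H}

/-- A homomorphism `f : H → M(K)` is essential if it turns `K` into an essential left and right
`H`-module: `H ⊗̂_H K ≅ K` and `K ⊗̂_H H ≅ K`. -/
def MultHom.IsEssential {K : Type*}
    [NonUnitalRing K] [Module ℂ K] [IsScalarTower ℂ K K] [SMulCommClass ℂ K K]
    [Bornology K] [CompleteBornology K] [BornologicalAlgebra K] (f : MultHom H K) : Prop :=
  InducesIso (A := H) (V := H) (W := K) (X := K) (· * ·)
    (fun h k => (f h).left k) (fun h k => (f h).left k) ∧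
  InducesIso (A := H) (V := K) (W := H) (X := K)
    (fun k h => (f h).right k) (· * ·) (fun k h => (f h).right k)

/-- Coassociativity `(Δ ⊗̂ id) Δ = (id ⊗̂ Δ) Δ`, where `Δ ⊗̂ id : H ⊗̂ H → M((H ⊗̂ H) ⊗̂ H)` and
`id ⊗̂ Δ : H ⊗̂ H → M(H ⊗̂ (H ⊗̂ H))` are extended to `M(H ⊗̂ H)` and the two triple tensor
products are identified by associativity. -/
def IsCoassociative (Δ : MultHom H (CTensor H H)) : Prop :=
  ∃ (F : Multiplier (CTensor H H) →ₐ[ℂ] Multiplier (CTensor (CTensor H H) H))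
    (G : Multiplier (CTensor H H) →ₐ[ℂ] Multiplier (CTensor H (CTensor H H))),
    (MultHom.tensor Δ (MultHom.incl H)).IsExtension F ∧
    (MultHom.tensor (MultHom.incl H) Δ).IsExtension G ∧
    ∀ (h : H) (x : CTensor (CTensor H H) H),
      CTensor.assoc H H H ((F (Δ h)).left x) = (G (Δ h)).left (CTensor.assoc H H H x) ∧
      CTensor.assoc H H H ((F (Δ h)).right x) = (G (Δ h)).right (CTensor.assoc H H H x)

/-- A bounded functional is faithful if `ω(fg) = 0` for all `g` implies `f = 0` and `ω(fg) = 0`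
for all `f` implies `g = 0`. -/
def IsFaithful (ω : BHom H ℂ) : Prop :=
  (∀ f, (∀ g, ω (f * g) = 0) → f = 0) ∧ (∀ g, (∀ f, ω (f * g) = 0) → g = 0)

variable (H) in
/-- A bornological quantum group structure on the bornological algebra `H`. The Galois maps, which
take values in `H ⊗̂ H ⊆ M(H ⊗̂ H)`, are recorded together with the comultiplication that
determines them. -/
structure BornologicalQuantumGroup where
  nontrivial : Nontrivial H
  essential : IsEssentialAlgebra H
  approximation : ApproximationProperty H
  /-- The comultiplication `Δ : H → M(H ⊗̂ H)`. -/
  Δ : MultHom H (CTensor H H)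
  essential_Δ : Δ.IsEssential
  coassociative : IsCoassociative Δ
  /-- The Galois map `γ_l(f ⊗ g) = Δ(f) (g ⊗ 1)`. -/
  γl : BHom (CTensor H H) (CTensor H H)
  /-- The Galois map `γ_r(f ⊗ g) = Δ(f) (1 ⊗ g)`. -/
  γr : BHom (CTensor H H) (CTensor H H)
  /-- The Galois map `ρ_l(f ⊗ g) = (f ⊗ 1) Δ(g)`. -/
  ρl : BHom (CTensor H H) (CTensor H H)
  /-- The Galois map `ρ_r(f ⊗ g) = (1 ⊗ f) Δ(g)`. -/
  ρr : BHom (CTensor H H) (CTensor H H)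
  γl_spec : ∀ f g : H, Multiplier.of (γl (CTensor.tmul f g)) =
    Δ f * Multiplier.tensor (Multiplier.of g) 1
  γr_spec : ∀ f g : H, Multiplier.of (γr (CTensor.tmul f g)) =
    Δ f * Multiplier.tensor 1 (Multiplier.of g)
  ρl_spec : ∀ f g : H, Multiplier.of (ρl (CTensor.tmul f g)) =
    Multiplier.tensor (Multiplier.of f) 1 * Δ g
  ρr_spec : ∀ f g : H, Multiplier.of (ρr (CTensor.tmul f g)) =
    Multiplier.tensor 1 (Multiplier.of f) * Δ g
  γl_iso : IsBornIso γl
  γr_iso : IsBornIso γr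
  ρl_iso : IsBornIso ρl
  ρr_iso : IsBornIso ρr
  /-- The left Haar functional. -/
  φ : BHom H ℂ
  faithful : IsFaithful φ
  /-- Left invariance `(id ⊗̂ φ) Δ(f) = φ(f) 1` in `M(H)`, where the multiplier
  `(id ⊗̂ φ) Δ(f)` acts by `g ↦ (id ⊗̂ φ) γ_l(f ⊗ g)` from the left and by
  `g ↦ (id ⊗̂ φ) ρ_l(g ⊗ f)` from the right. -/
  leftInvariant : ∀ f g : H, idTensor H φ (γl (CTensor.tmul f g)) = φ f • g ∧
    idTensor H φ (ρl (CTensor.tmul g f)) = φ f • g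

/-- `ε` is the counit and `S` the antipode of the bornological quantum group `H`. -/
structure IsCounitAntipode (Q : BornologicalQuantumGroup H) (ε : BHom H ℂ) (S : BHom H H) :
    Prop where
  counit_mul : ∀ f g, ε (f * g) = ε f * ε g
  /-- The homomorphism `ε` is essential: `H ⊗̂_H ℂ ≅ ℂ` and `ℂ ⊗̂_H H ≅ ℂ`. -/
  counit_essential :
    InducesIso (A := H) (V := H) (W := ℂ) (X := ℂ) (· * ·)
      (fun h z => ε h * z) (fun h z => ε h * z) ∧
    InducesIso (A := H) (V := ℂ) (W := H) (X := ℂ)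
      (fun z h => z * ε h) (· * ·) (fun z h => z * ε h)
  /-- `(ε ⊗̂ id) Δ(f) = f` in `M(H)`. -/
  counit_left : ∀ f g, tensorId H ε (Q.γr (CTensor.tmul f g)) = f * g ∧
    tensorId H ε (Q.ρr (CTensor.tmul g f)) = g * f
  /-- `(id ⊗̂ ε) Δ(f) = f` in `M(H)`. -/
  counit_right : ∀ f g, idTensor H ε (Q.γl (CTensor.tmul f g)) = f * g ∧
    idTensor H ε (Q.ρl (CTensor.tmul g f)) = g * f
  antipode_iso : IsBornIso S
  antipode_mul : ∀ f g, S (f * g) = S g * S f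
  /-- `S` is a coalgebra antihomomorphism, `Δ(S(h)) = (S ⊗̂ S) τ Δ(h)`, where the algebra
  antiautomorphism `θ = (S ⊗̂ S) τ` of `H ⊗̂ H` is extended to multipliers by
  `θ(m) θ(x) = θ(x m)` and `θ(x) θ(m) = θ(m x)`. -/
  antipode_comul : ∀ (h : H) (x : CTensor H H),
    (Q.Δ (S h)).left (CTensor.map S S (CTensor.flip H H x)) =
      CTensor.map S S (CTensor.flip H H ((Q.Δ h).right x)) ∧
    (Q.Δ (S h)).right (CTensor.map S S (CTensor.flip H H x)) =
      CTensor.map S S (CTensor.flip H H ((Q.Δ h).left x))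
  /-- `μ (S ⊗̂ id) γ_r = ε ⊗̂ id`. -/
  antipode_left : ∀ x : CTensor H H,
    CTensor.lift (mulHom H) (CTensor.map S (BHom.id H) (Q.γr x)) = tensorId H ε x
  /-- `μ (id ⊗̂ S) ρ_l = id ⊗̂ ε`. -/
  antipode_right : ∀ x : CTensor H H,
    CTensor.lift (mulHom H) (CTensor.map (BHom.id H) S (Q.ρl x)) = idTensor H ε x

end QuantumGroup

end BornQG

end

/-!
By the approximation property, an element of `V ⊗̂ W` vanishes as soon as all its slices
`(ω ⊗ id) x` do: the finite rank operators kill it, and they approximate the identity on a compact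
disk carrying its first legs. This allows identities in tensor powers of `H` to be checked after
multiplying single legs.

Coassociativity shows that `μ ρ_l⁻¹` and `μ γ_r⁻¹` satisfy
`a ⊗ μ γ_r⁻¹(b ⊗ c) = μ ρ_l⁻¹(a ⊗ b) ⊗ c`, so `b ↦ μ γ_r⁻¹(b ⊗ ·)` and `b ↦ μ ρ_l⁻¹(· ⊗ b)` take
values in the scalars and agree: this is the counit `ε`. The antipode is defined by
`b S(x) = (id ⊗ ε) ρ_l⁻¹(b ⊗ x)`; it satisfies `S((id ⊗ φ)(Δ(a)(1 ⊗ b))) = (id ⊗ φ)((1 ⊗ a)Δ(b))`,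
and the opposite algebra with the same comultiplication provides its inverse.

The functional `φ S` is right invariant. Slicing by `φ` and by `φ S` rewrites `φ(x d)` as
`φ S(α(d) x)` and `φ S(d x)` as `φ(α'(d) x)`, both reversibly; hence `φ(f g) = φ(g σ(f))`, and
faithfulness makes `σ` multiplicative and unique. Since `φ S²` is left invariant, it is a multiple
of `φ`, and comparing `φ S²(g σ(f))` with `φ S²(f g)` gives `S² σ = σ S²`.
-/

noncomputable section

namespace BornQG

section DiskSpan

variable {V : Type*} [AddCommGroup V] [Module ℂ V] {D : Set V}

theorem IsDisk.gauge_add_le (hD : IsDisk D) (hn : D.Nonempty) {x y : V}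
    (hx : x ∈ Submodule.span ℂ D) (hy : y ∈ Submodule.span ℂ D) :
    gauge D (x + y) ≤ gauge D x + gauge D y := by
  refine le_of_forall_pos_le_add fun δ hδ => ?_
  have hx_mem : x ∈ (gauge D x + δ / 2) • D := hD.mem_smul_of_gauge_lt hn hx (by linarith)
  have hy_mem : y ∈ (gauge D y + δ / 2) • D := hD.mem_smul_of_gauge_lt hn hy (by linarith)
  have hx_nonneg := gauge_nonneg (s := D) x
  have hy_nonneg := gauge_nonneg (s := D) y
  calc gauge D (x + y) ≤ gauge D x + δ / 2 + (gauge D y + δ / 2) :=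
        gauge_le_of_mem (by positivity) (hD.add_mem (by positivity) (by positivity) hx_mem hy_mem)
    _ = gauge D x + gauge D y + δ := by ring

theorem IsDisk.smul_subset_abs_smul {D : Set V} (hD : IsDisk D) (r : ℝ) : r • D ⊆ |r| • D := by
  rintro _ ⟨x, hx, rfl⟩
  simpa using hD.csmul_mem (r := 1) (r : ℂ) (by simpa using hx)

/-- The gauge norm on the linear span `⟨D⟩` of a completant disk. It depends on the proof that `D`
is a completant disk, so it is not registered as an instance. -/
@[reducible] def IsCompletant.normedAddCommGroup (hD : IsCompletant D) (hn : D.Nonempty) :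
    NormedAddCommGroup (Submodule.span ℂ D) :=
  AddGroupNorm.toNormedAddCommGroup
    { toFun := fun x => gauge D x
      map_zero' := gauge_zero
      add_le' := fun x y => hD.disk.gauge_add_le hn x.2 y.2
      neg' := fun x => gauge_neg (s := D) (fun _ => hD.disk.1.neg_mem_iff.2) x
      eq_zero_of_map_eq_zero' := fun x hx => Subtype.ext (hD.separated x x.2 hx) }

/-- The span `⟨D⟩` of a completant disk as a complex normed space under the gauge norm. -/
@[reducible] def IsCompletant.normedSpace (hD : IsCompletant D) (hn : D.Nonempty) :
    letI := hD.normedAddCommGroup hn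
    NormedSpace ℂ (Submodule.span ℂ D) :=
  letI := hD.normedAddCommGroup hn
  { norm_smul_le := fun z x => (gauge_smul hD.disk.1 z (x : V)).le }

theorem IsCompletant.mem_smul_of_norm_lt (hD : IsCompletant D) (hn : D.Nonempty)
    {x : Submodule.span ℂ D} {r : ℝ} :
    letI := hD.normedAddCommGroup hn
    ‖x‖ < r → (x : V) ∈ r • D :=
  hD.disk.mem_smul_of_gauge_lt hn x.2

theorem IsCompletant.completeSpace (hD : IsCompletant D) (hn : D.Nonempty) :
    letI := hD.normedAddCommGroup hn
    CompleteSpace (Submodule.span ℂ D) := by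
  let := hD.normedAddCommGroup hn
  refine Metric.complete_of_cauchySeq_tendsto fun u hu => ?_
  obtain ⟨x, hx, hux⟩ := hD.complete (fun n => (u n : V)) (fun n => (u n).2) fun δ hδ => by
    obtain ⟨N, hN⟩ := Metric.cauchySeq_iff.1 hu δ hδ
    exact ⟨N, fun m hm n hn => (dist_eq_norm (u m) (u n)).symm.trans_lt (hN m hm n hn)⟩
  exact ⟨⟨x, hx⟩, tendsto_iff_norm_sub_tendsto_zero.2 hux⟩

theorem IsCompletant.totallyBounded_preimage (hD : IsCompletant D) (hn : D.Nonempty) {A : Set V}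
    (hA : ∀ δ : ℝ, 0 < δ → {a ∈ A | a ∉ δ • D}.Finite) :
    letI := hD.normedAddCommGroup hn
    TotallyBounded ((↑) ⁻¹' A : Set (Submodule.span ℂ D)) := by
  let := hD.normedAddCommGroup hn
  refine Metric.totallyBounded_iff.2 fun δ hδ => ?_
  have hfin := (hA (δ / 2) (by positivity)).preimage
    (f := ((↑) : Submodule.span ℂ D → V)) Subtype.val_injective.injOn
  refine ⟨insert 0 _, hfin.insert 0, fun x hx => mem_iUnion₂.2 ?_⟩
  by_cases hxδ : (x : V) ∈ (δ / 2) • D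
  · refine ⟨0, mem_insert _ _, mem_ball_zero_iff.2 ?_⟩
    exact (gauge_le_of_mem (by positivity) hxδ).trans_lt (half_lt_self hδ)
  · exact ⟨x, mem_insert_of_mem _ ⟨hx, hxδ⟩, Metric.mem_ball_self hδ⟩

theorem totallyBounded_balancedHull {𝕜 E : Type*} [NormedField 𝕜] [ProperSpace 𝕜]
    [AddCommGroup E] [Module 𝕜 E] [UniformSpace E] [ContinuousSMul 𝕜 E] [CompleteSpace E]
    {A : Set E} (hA : TotallyBounded A) : TotallyBounded (balancedHull 𝕜 A) := by
  have hcompact : IsCompact (closure A) := hA.closure.isCompact_of_isClosed isClosed_closure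
  have himage : IsCompact ((Metric.closedBall (0 : 𝕜) 1) • closure A) :=
    (isCompact_closedBall 0 1).smul_set hcompact
  refine himage.totallyBounded.subset fun x hx => ?_
  obtain ⟨z, hz, a, ha, rfl⟩ := mem_balancedHull_iff.1 hx
  exact smul_mem_smul (mem_closedBall_zero_iff.2 hz) (subset_closure ha)

theorem balanced_convexHull_real {E : Type*} [AddCommGroup E] [Module ℂ E] {B : Set E}
    (hB : Balanced ℂ B) : Balanced ℂ (convexHull ℝ B) := by
  refine balanced_iff_smul_mem.2 fun z hz x hx => ?_
  have hpreimage : Convex ℝ ((fun y : E => z • y) ⁻¹' convexHull ℝ B) :=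
    (convex_convexHull ℝ B).is_linear_preimage
      ⟨fun x y => smul_add z x y, fun r x => smul_comm z r x⟩
  exact convexHull_min (fun y hy => subset_convexHull ℝ B (hB.smul_mem hz hy) :
    B ⊆ (fun y : E => z • y) ⁻¹' convexHull ℝ B) hpreimage hx

theorem IsCompletant.isCompactDisk_image [Bornology V] (hD : IsCompletant D) (hn : D.Nonempty)
    (hb : IsBounded D) {K : Set (Submodule.span ℂ D)} (hbal : Balanced ℂ K) (hconv : Convex ℝ K) :
    letI := hD.normedAddCommGroup hn
    IsCompact K → IsCompactDisk ((↑) '' K : Set V) := by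
  let := hD.normedAddCommGroup hn
  intro hK
  refine ⟨⟨?_, ?_⟩, D, hb, hD, ?_, fun u hu => ?_⟩
  · rw [balanced_iff_smul_mem]
    rintro z hz _ ⟨x, hx, rfl⟩
    exact ⟨z • x, hbal.smul_mem hz hx, rfl⟩
  · exact hconv.is_linear_image ⟨fun _ _ => rfl, fun _ _ => rfl⟩
  · rintro _ ⟨x, _, rfl⟩
    exact x.2
  · choose y hyK hyu using hu
    obtain rfl : (fun n => (y n : V)) = u := funext hyu
    obtain ⟨x, hx, k, hk, hlim⟩ := hK.tendsto_subseq hyK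
    exact ⟨x, mem_image_of_mem _ hx, k, hk, fun n => (y _).2, x.2,
      tendsto_iff_norm_sub_tendsto_zero.1 hlim⟩

theorem IsCompletant.exists_isCompactDisk [Bornology V] (hD : IsCompletant D) (hn : D.Nonempty)
    (hb : IsBounded D) {A : Set V} (hAD : A ⊆ Submodule.span ℂ D)
    (hA : ∀ δ : ℝ, 0 < δ → {a ∈ A | a ∉ δ • D}.Finite) :
    ∃ S, IsCompactDisk S ∧ A ⊆ S := by
  let := hD.normedAddCommGroup hn
  let := hD.normedSpace hn
  have := hD.completeSpace hn
  let B : Set (Submodule.span ℂ D) := balancedHull ℂ ((↑) ⁻¹' A)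
  have hB : TotallyBounded B := totallyBounded_balancedHull (hD.totallyBounded_preimage hn hA)
  have hK : IsCompact (closure (convexHull ℝ B)) :=
    hB.convexHull.closure.isCompact_of_isClosed isClosed_closure
  have hbal : Balanced ℂ (closure (convexHull ℝ B)) :=
    (balanced_convexHull_real (balancedHull.balanced _)).closure
  refine ⟨_, hD.isCompactDisk_image hn hb hbal (convex_convexHull ℝ B).closure hK, fun a ha => ?_⟩
  exact ⟨⟨a, hAD ha⟩, subset_closure (subset_convexHull ℝ B (subset_balancedHull ℂ ha)), rfl⟩

theorem IsCompletant.exists_sum_of_summable (hD : IsCompletant D) (hn : D.Nonempty) {ι : Type*}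
    {f : ι → V} {r : ι → ℝ} (hr : ∀ i, 0 ≤ r i) (hs : Summable r) (hf : ∀ i, f i ∈ r i • D) :
    ∃ x, (∀ δ : ℝ, 0 < δ → ∃ F₀ : Finset ι, ∀ F, F₀ ⊆ F → x - ∑ i ∈ F, f i ∈ δ • D) ∧
      ∀ δ : ℝ, ∑' i, r i < δ → x ∈ δ • D := by
  let := hD.normedAddCommGroup hn
  have := hD.completeSpace hn
  let g : ι → Submodule.span ℂ D := fun i => ⟨f i, smul_subset_span _ (hf i)⟩
  have hg_le : ∀ i, ‖g i‖ ≤ r i := fun i => gauge_le_of_mem (hr i) (hf i)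
  have hg : Summable g := Summable.of_norm_bounded hs hg_le
  refine ⟨(∑' i, g i : Submodule.span ℂ D), fun δ hδ => ?_, fun δ hδ => ?_⟩
  · obtain ⟨F₀, hF₀⟩ := eventually_atTop.1 (Metric.tendsto_nhds.1 hg.hasSum δ hδ)
    refine ⟨F₀, fun F hF => ?_⟩
    have hdist : ‖∑' i, g i - ∑ i ∈ F, g i‖ < δ := by
      rw [← dist_eq_norm, dist_comm]
      exact hF₀ F hF
    simpa [g] using hD.mem_smul_of_norm_lt hn hdist
  · exact hD.mem_smul_of_norm_lt hn ((tsum_of_norm_bounded hs.hasSum hg_le).trans_lt hδ)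

end DiskSpan

section SummableWeights

open scoped ENNReal

variable {ι : Type*}

theorem exists_finset_tsum_compl_lt {a : ι → ℝ≥0∞} (ha : ∑' i, a i ≠ ∞) {δ : ℝ≥0∞} (hδ : 0 < δ) :
    ∃ F : Finset ι, ∑' i, (F : Set ι)ᶜ.indicator a i < δ := by
  obtain ⟨F, hF⟩ :=
    ((ENNReal.tendsto_tsum_compl_atTop_zero ha).eventually (gt_mem_nhds hδ)).exists
  refine ⟨F, ?_⟩
  rw [← tsum_subtype]
  exact hF

theorem exists_weights_tsum_mul_ne_top {a : ι → ℝ≥0∞} (ha : ∑' i, a i ≠ ∞) :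
    ∃ m : ι → ℝ≥0∞, (∀ i, 1 ≤ m i) ∧ ∑' i, a i * m i ≠ ∞ ∧ ∀ N : ℕ, {i | m i ≤ N}.Finite := by
  obtain ⟨δ, hδ_pos, hδ_sum⟩ := ENNReal.exists_pos_sum_of_countable' one_ne_zero ℕ
  choose F hF using fun n => exists_finset_tsum_compl_lt ha (hδ_pos n)
  -- `m i - 1` is the number of the sets `F n` which miss `i`.
  let m : ι → ℝ≥0∞ := fun i => 1 + ∑' n, (F n : Set ι)ᶜ.indicator 1 i
  have hmul : ∀ i, a i * m i = a i + ∑' n, (F n : Set ι)ᶜ.indicator a i := fun i => by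
    simp_rw [m, mul_add, mul_one, ← ENNReal.tsum_mul_left, ← indicator_mul_right, Pi.one_apply,
      mul_one]
  have hsum : ∑' n, ∑' i, (F n : Set ι)ᶜ.indicator a i ≠ ∞ :=
    ((ENNReal.tsum_le_tsum fun n => (hF n).le).trans_lt (hδ_sum.trans ENNReal.one_lt_top)).ne
  refine ⟨m, fun i => le_self_add, ?_, fun N => ?_⟩
  · simp_rw [hmul, ENNReal.tsum_add, ENNReal.tsum_comm (α := ι)]
    exact ENNReal.add_ne_top.2 ⟨ha, hsum⟩
  · refine ((Finset.range N).finite_toSet.biUnion fun n _ => (F n).finite_toSet).subset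
      fun i hi => ?_
    by_contra hmiss
    have hone : ∀ n ∈ Finset.range N, (F n : Set ι)ᶜ.indicator (1 : ι → ℝ≥0∞) i = 1 :=
      fun n hn => indicator_of_mem (mem_compl fun h => hmiss (mem_biUnion hn h)) 1
    have hcount : (N : ℝ≥0∞) ≤ ∑' n, (F n : Set ι)ᶜ.indicator 1 i := by
      simpa only [Finset.sum_congr rfl hone, Finset.sum_const, Finset.card_range, nsmul_one]
        using ENNReal.sum_le_tsum (f := fun n => (F n : Set ι)ᶜ.indicator (1 : ι → ℝ≥0∞) i)
          (Finset.range N)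
    have hlt : (N : ℝ≥0∞) < 1 + N := by
      rw [add_comm]
      exact ENNReal.lt_add_right (ENNReal.natCast_ne_top N) one_ne_zero
    exact (hlt.trans_le (add_le_add_right hcount 1)).not_ge hi

theorem exists_weights_summable_mul {a : ι → ℝ} (ha : ∀ i, 0 ≤ a i) (hs : Summable a) :
    ∃ g : ι → ℝ, (∀ i, 1 ≤ g i) ∧ Summable (fun i => a i * g i) ∧
      ∀ N : ℝ, {i | a i ≠ 0 ∧ g i ≤ N}.Finite := by
  obtain ⟨m, hm_one, hm_sum, hm_fin⟩ := exists_weights_tsum_mul_ne_top hs.tsum_ofReal_ne_top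
  have hm_top : ∀ i, a i ≠ 0 → m i ≠ ∞ := fun i hi h => by
    refine ENNReal.ne_top_of_tsum_ne_top hm_sum i ?_
    rw [h, ENNReal.mul_top (ENNReal.ofReal_pos.2 ((ha i).lt_of_ne' hi)).ne']
  have hmul : ∀ i, a i * max 1 (m i).toReal = (ENNReal.ofReal (a i) * m i).toReal := fun i => by
    rcases eq_or_ne (a i) 0 with hi | hi
    · simp [hi]
    · have hone : 1 ≤ (m i).toReal := by
        simpa using ENNReal.toReal_mono (hm_top i hi) (hm_one i)
      rw [ENNReal.toReal_mul, ENNReal.toReal_ofReal (ha i), max_eq_right hone]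
  refine ⟨fun i => max 1 (m i).toReal, fun i => le_max_left _ _, ?_, fun N => ?_⟩
  · simpa only [hmul] using ENNReal.summable_toReal hm_sum
  · obtain ⟨K, hK⟩ := exists_nat_ge N
    refine (hm_fin K).subset fun i hi => ?_
    rw [mem_ofPred_eq, ← ENNReal.toReal_le_toReal (hm_top i hi.1) (ENNReal.natCast_ne_top K),
      ENNReal.toReal_natCast]
    exact (le_max_right _ _).trans (hi.2.trans hK)

end SummableWeights

section SliceSeparation

variable {V W X : Type*}
  [AddCommGroup V] [Module ℂ V] [Bornology V] [CompleteBornology V]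
  [AddCommGroup W] [Module ℂ W] [Bornology W] [CompleteBornology W]
  [AddCommGroup X] [Module ℂ X] [Bornology X] [CompleteBornology X]

theorem Ell1.extend_mem_smul {b : BHom V (BHom W X)} {c : Ell1 V W} {K : Set V} {T : Set W}
    {E : Set X} (hE : IsCompletant E) (hn : E.Nonempty) (hEb : IsBounded E) {g : V × W → ℝ}
    (hg : ∀ p, 0 ≤ g p) (hs : Summable fun p => ‖c.val p‖ * g p)
    (hK : ∀ p, c.val p ≠ 0 → p.1 ∈ g p • K) (hT : ∀ p, c.val p ≠ 0 → p.2 ∈ T)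
    {ε δ : ℝ} (hε : 0 ≤ ε) (hb : ∀ x ∈ K, ∀ w ∈ T, b x w ∈ ε • E)
    (hδ : (∑' p, ‖c.val p‖ * g p) * ε < δ) : extend b c ∈ δ • E := by
  have hterm : ∀ p, c.val p • b p.1 p.2 ∈ (‖c.val p‖ * g p * ε) • E := fun p => by
    rcases eq_or_ne (c.val p) 0 with hp | hp
    · simpa [hp] using zero_mem_smul_set (a := (0 : ℝ)) (hE.disk.zero_mem hn)
    · obtain ⟨x, hx, hxp : g p • x = p.1⟩ := hK p hp
      have hbx : b p.1 p.2 = (g p : ℂ) • b x p.2 := by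
        rw [← hxp, ← Complex.coe_smul, map_smul, BHom.smul_apply]
      have hmem := hE.disk.csmul_mem (c.val p * g p) (hb x hx p.2 (hT p hp))
      rw [hbx, smul_smul]
      simpa only [norm_mul, Complex.norm_real, Real.norm_of_nonneg (hg p)] using hmem
  obtain ⟨y, hy_sum, hy_mem⟩ := hE.exists_sum_of_summable hn
    (fun p => mul_nonneg (mul_nonneg (norm_nonneg _) (hg p)) hε) (hs.mul_right ε) hterm
  rw [extend_apply, bsum_eq hEb hy_sum]
  exact hy_mem δ (by rwa [tsum_mul_right])

theorem Ell1.exists_isCompactDisk_mem_smul (c : Ell1 V W) :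
    ∃ (K : Set V) (g : V × W → ℝ), IsCompactDisk K ∧ (∀ p, 0 ≤ g p) ∧
      Summable (fun p => ‖c.val p‖ * g p) ∧ ∀ p, c.val p ≠ 0 → p.1 ∈ g p • K := by
  obtain ⟨S, T, hS, -, hc⟩ := c.2
  obtain ⟨D, hSD, hn, hDb, hD⟩ := exists_disk hS
  obtain ⟨g, hg_one, hg_sum, hg_fin⟩ :=
    exists_weights_summable_mul (fun _ => norm_nonneg _) (summable_norm c)
  have hg_pos : ∀ p, 0 < g p := fun p => one_pos.trans_le (hg_one p)
  have hmem : ∀ p, c.val p ≠ 0 → (g p)⁻¹ • p.1 ∈ (g p)⁻¹ • D := fun p hp =>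
    smul_mem_smul_set (hSD (hc p hp).1)
  obtain ⟨K, hK, hAK⟩ := hD.exists_isCompactDisk hn hDb
    (A := {a | ∃ p, c.val p ≠ 0 ∧ (g p)⁻¹ • p.1 = a})
    (by rintro _ ⟨p, hp, rfl⟩; exact smul_subset_span _ (hmem p hp))
    fun δ hδ => by
      refine ((hg_fin δ⁻¹).image fun p => (g p)⁻¹ • p.1).subset ?_
      rintro _ ⟨⟨p, hp, rfl⟩, hpδ⟩
      refine ⟨p, ⟨norm_ne_zero_iff.2 hp, ?_⟩, rfl⟩
      by_contra! hlt
      exact hpδ (hD.disk.smul_subset (inv_nonneg.2 (hg_pos p).le)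
        (inv_le_of_inv_le₀ hδ hlt.le) (hmem p hp))
  refine ⟨K, g, hK, fun p => (hg_pos p).le, hg_sum, fun p hp => ?_⟩
  exact (mem_smul_set_iff_inv_smul_mem₀ (hg_pos p).ne' _ _).2 (hAK ⟨p, hp, rfl⟩)

theorem CTensor.smul_tmul (c : ℂ) (v : V) (w : W) : tmul (c • v) w = c • tmul v w := by
  simp only [← tmulHom_apply, map_smul, BHom.smul_apply]

theorem CTensor.tmul_smul (c : ℂ) (v : V) (w : W) : tmul v (c • w) = c • tmul v w := by
  simp only [← tmulHom_apply, map_smul]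

theorem IsFiniteRank.map_eq_zero {f : BHom V V} (hf : IsFiniteRank f) {x : CTensor V W}
    (hx : ∀ ω : BHom V ℂ, tensorId W ω x = 0) : CTensor.map f (BHom.id W) x = 0 := by
  obtain ⟨k, ω, v, hfv⟩ := hf
  have hmap : CTensor.map f (BHom.id W) =
      ∑ i, (CTensor.tmulHom V W (v i)).comp (tensorId W (ω i)) := by
    refine CTensor.hom_ext fun a b => ?_
    rw [CTensor.map_tmul, hfv, ← CTensor.tmulHom_apply, map_sum, BHom.sum_apply, BHom.sum_apply]
    simp only [map_smul, BHom.smul_apply, BHom.comp_apply, tensorId_tmul, BHom.id_apply]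
  rw [hmap, BHom.sum_apply]
  exact Finset.sum_eq_zero fun i _ => by rw [BHom.comp_apply, hx, map_zero]

theorem ApproximationProperty.eq_zero_of_tensorId (hV : ApproximationProperty V)
    {x : CTensor V W} (hx : ∀ ω : BHom V ℂ, tensorId W ω x = 0) : x = 0 := by
  obtain ⟨c, rfl⟩ := CTensor.proj_surjective x
  obtain ⟨S, T, -, hT, hc⟩ := c.2
  obtain ⟨K, g, hK, hg, hs, hcK⟩ := c.exists_isCompactDisk_mem_smul
  obtain ⟨f, hf, T', hT', hT'b, ε, hε, hfε⟩ := hV K hK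
  obtain ⟨E, hTE, hn, hEb, hE⟩ := exists_disk ((CTensor.tmulHom V W).bounded₂ hT'b hT)
  refine hE.eq_zero fun δ hδ => ?_
  set M := ∑' p, ‖c.val p‖ * g p
  obtain ⟨k, hk⟩ : ∃ k, M * |ε k| < δ := by
    have hlim : Tendsto (fun k => M * |ε k|) atTop (𝓝 0) := by simpa using hε.abs.const_mul M
    exact (hlim.eventually_lt_const hδ).exists
  let b : BHom V (BHom W (CTensor V W)) :=
    BHom.precomp (CTensor.tmulHom V W) (BHom.id V - f k) (BHom.id W)
  have hb : ∀ v ∈ K, ∀ w ∈ T, b v w ∈ |ε k| • E := fun v hv w hw => by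
    obtain ⟨t, ht, htv⟩ := hT'.smul_subset_abs_smul _ (hT'.neg_mem (hfε k v hv))
    refine ⟨CTensor.tmul t w, hTE ⟨t, ht, w, hw, rfl⟩, ?_⟩
    change _ = CTensor.tmul (v - f k v) w
    rw [← neg_sub (f k v), ← htv]
    simp only [← Complex.coe_smul, CTensor.smul_tmul]
  have hsub : CTensor.map (BHom.id V - f k) (BHom.id W) =
      BHom.id (CTensor V W) - CTensor.map (f k) (BHom.id W) := CTensor.hom_ext fun v w => by
    simp only [CTensor.map_tmul, BHom.sub_apply, BHom.id_apply]
    simp only [← CTensor.tmulHom_apply, map_sub, BHom.sub_apply]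
  -- The finite rank operator `f k` kills the tensor, which therefore is its own error term.
  have herror : Ell1.extend b c = CTensor.proj V W c :=
    calc Ell1.extend b c = CTensor.map (BHom.id V - f k) (BHom.id W) (CTensor.proj V W c) := rfl
      _ = CTensor.proj V W c := by
        rw [hsub, BHom.sub_apply, (hf k).map_eq_zero hx, BHom.id_apply, sub_zero]
  exact herror ▸ Ell1.extend_mem_smul hE hn hEb hg hs hcK (fun p hp => (hc p hp).2)
    (abs_nonneg _) hb hk

end SliceSeparation

section TensorCalculus

variable {U V W X Y V' W' V'' W'' : Type*}
  [AddCommGroup U] [Module ℂ U] [Bornology U] [CompleteBornology U]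
  [AddCommGroup V] [Module ℂ V] [Bornology V] [CompleteBornology V]
  [AddCommGroup W] [Module ℂ W] [Bornology W] [CompleteBornology W]
  [AddCommGroup X] [Module ℂ X] [Bornology X] [CompleteBornology X]
  [AddCommGroup Y] [Module ℂ Y] [Bornology Y] [CompleteBornology Y]
  [AddCommGroup V'] [Module ℂ V'] [Bornology V'] [CompleteBornology V']
  [AddCommGroup W'] [Module ℂ W'] [Bornology W'] [CompleteBornology W']
  [AddCommGroup V''] [Module ℂ V''] [Bornology V''] [CompleteBornology V'']
  [AddCommGroup W''] [Module ℂ W''] [Bornology W''] [CompleteBornology W'']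

/-! ## Tensor products of maps -/

/-- The bounded bilinear map underlying a bounded linear map on a tensor product, in curried
form. -/
def BHom.curry (f : BHom (CTensor V W) X) : BHom V (BHom W X) :=
  BHom.postcomp f (CTensor.tmulHom V W)

@[simp] theorem BHom.curry_apply (f : BHom (CTensor V W) X) (v : V) (w : W) :
    f.curry v w = f (CTensor.tmul v w) := rfl

@[simp] theorem BHom.comp_id (f : BHom V W) : f.comp (BHom.id V) = f := rfl

@[simp] theorem BHom.id_comp (f : BHom V W) : (BHom.id W).comp f = f := rfl

/-- The inverse of a bornological isomorphism, as a bounded linear map. -/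
def IsBornIso.inverse {f : BHom V W} (hf : IsBornIso f) : BHom W V :=
  BHom.mk (LinearEquiv.ofBijective f.toLin hf.1).symm.toLinearMap fun s hs =>
    (hf.2.2 s hs).subset <| by
      rintro _ ⟨x, hx, rfl⟩
      rw [Set.mem_preimage]
      exact ((LinearEquiv.ofBijective f.toLin hf.1).apply_symm_apply x).symm ▸ hx

@[simp] theorem IsBornIso.apply_inverse {f : BHom V W} (hf : IsBornIso f) (y : W) :
    f (hf.inverse y) = y :=
  (LinearEquiv.ofBijective f.toLin hf.1).apply_symm_apply y

@[simp] theorem IsBornIso.inverse_apply {f : BHom V W} (hf : IsBornIso f) (x : V) :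
    hf.inverse (f x) = x :=
  (LinearEquiv.ofBijective f.toLin hf.1).symm_apply_apply x

theorem IsBornIso.of_inverse {f : BHom V W} (g : BHom W V) (hgf : Function.LeftInverse g f)
    (hfg : Function.RightInverse g f) : IsBornIso f :=
  ⟨⟨hgf.injective, hfg.surjective⟩, f.bounded,
    fun s hs => (g.bounded s hs).subset fun x hx => ⟨f x, hx, hgf x⟩⟩

namespace CTensor

theorem eq_of_tmul (f g : BHom (CTensor V W) X) (h : ∀ v w, f (tmul v w) = g (tmul v w))
    (x : CTensor V W) : f x = g x := by
  rw [hom_ext h]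

theorem eq_of_tmul_tmul (f g : BHom (CTensor (CTensor U V) W) X)
    (h : ∀ u v w, f (tmul (tmul u v) w) = g (tmul (tmul u v) w))
    (x : CTensor (CTensor U V) W) : f x = g x :=
  eq_of_tmul f g (fun y w => eq_of_tmul (f.curry.flip w) (g.curry.flip w) (fun u v => h u v w) y) x

theorem eq_of_surjective {T : BHom (CTensor V W) U} (hT : Function.Surjective T)
    (f g : BHom U X) (h : ∀ v w, f (T (tmul v w)) = g (T (tmul v w))) (x : U) : f x = g x := by
  obtain ⟨y, rfl⟩ := hT x
  exact eq_of_tmul (f.comp T) (g.comp T) h y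

theorem map_map (f : BHom V' V'') (g : BHom W' W'') (f' : BHom V V') (g' : BHom W W')
    (x : CTensor V W) : map f g (map f' g' x) = map (f.comp f') (g.comp g') x :=
  eq_of_tmul ((map f g).comp (map f' g')) _ (fun v w => by simp) x

@[simp] theorem map_id (x : CTensor V W) : map (BHom.id V) (BHom.id W) x = x :=
  eq_of_tmul _ (BHom.id _) (fun v w => by simp) x

theorem map_id_id : map (BHom.id V) (BHom.id W) = BHom.id (CTensor V W) :=
  BHom.ext map_id

@[simp] theorem flip_flip (x : CTensor V W) : flip W V (flip V W x) = x :=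
  eq_of_tmul ((flip W V).comp (flip V W)) (BHom.id _) (fun v w => by simp) x

theorem flip_map (f : BHom V V') (g : BHom W W') (x : CTensor V W) :
    flip V' W' (map f g x) = map g f (flip V W x) :=
  eq_of_tmul ((flip V' W').comp (map f g)) ((map g f).comp (flip V W)) (fun v w => by simp) x

variable (V W) in
theorem isBornIso_flip : IsBornIso (flip V W) :=
  .of_inverse (flip W V) flip_flip flip_flip

theorem assoc_map (f : BHom V V') (g : BHom W W') (h : BHom X Y) (x : CTensor (CTensor V W) X) :
    assoc V' W' Y (map (map f g) h x) = map f (map g h) (assoc V W X x) :=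
  eq_of_tmul_tmul ((assoc V' W' Y).comp (map (map f g) h)) ((map f (map g h)).comp (assoc V W X))
    (fun u v w => by simp) x

theorem map_id_idTensor_assoc (η : BHom W ℂ) (x : CTensor (CTensor U V) W) :
    map (BHom.id U) (idTensor V η) (assoc U V W x) = idTensor (CTensor U V) η x :=
  eq_of_tmul_tmul ((map (BHom.id U) (idTensor V η)).comp (assoc U V W))
    (idTensor (CTensor U V) η) (fun u v w => by simp [tmul_smul]) x

end CTensor

theorem tensorId_map (ω : BHom V' ℂ) (f : BHom V V') (g : BHom W W') (x : CTensor V W) :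
    tensorId W' ω (CTensor.map f g x) = g (tensorId W (ω.comp f) x) :=
  CTensor.eq_of_tmul ((tensorId W' ω).comp (CTensor.map f g)) (g.comp (tensorId W (ω.comp f)))
    (fun v w => by simp) x

theorem idTensor_map (ω : BHom W' ℂ) (f : BHom V V') (g : BHom W W') (x : CTensor V W) :
    idTensor V' ω (CTensor.map f g x) = f (idTensor V (ω.comp g) x) :=
  CTensor.eq_of_tmul ((idTensor V' ω).comp (CTensor.map f g)) (f.comp (idTensor V (ω.comp g)))
    (fun v w => by simp) x

@[simp] theorem tensorId_flip (ω : BHom V ℂ) (x : CTensor W V) :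
    tensorId W ω (CTensor.flip W V x) = idTensor W ω x :=
  CTensor.eq_of_tmul ((tensorId W ω).comp (CTensor.flip W V)) (idTensor W ω) (fun v w => by simp) x

@[simp] theorem idTensor_flip (ω : BHom V ℂ) (x : CTensor V W) :
    idTensor W ω (CTensor.flip V W x) = tensorId W ω x :=
  CTensor.eq_of_tmul ((idTensor W ω).comp (CTensor.flip V W)) (tensorId W ω) (fun v w => by simp) x

theorem apply_idTensor (ω : BHom V ℂ) (η : BHom W ℂ) (x : CTensor V W) :
    ω (idTensor V η x) = η (tensorId W ω x) :=
  CTensor.eq_of_tmul (ω.comp (idTensor V η)) (η.comp (tensorId W ω))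
    (fun v w => by simp [mul_comm]) x

variable (V) in
/-- The bounded functionals separate the points of `V`. -/
def HasSeparatingDual : Prop := ∀ v : V, (∀ ω : BHom V ℂ, ω v = 0) → v = 0

theorem ApproximationProperty.hasSeparatingDual_tensor (hV : ApproximationProperty V)
    (hW : HasSeparatingDual W) : HasSeparatingDual (CTensor V W) := fun _ hx =>
  hV.eq_zero_of_tensorId fun ω => hW _ fun η => hx (η.comp (tensorId W ω))

theorem ApproximationProperty.eq_zero_of_map_id (hV : ApproximationProperty V) {ι : Type*}
    {f : ι → BHom W W'} (hf : ∀ w, (∀ i, f i w = 0) → w = 0) {x : CTensor V W}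
    (hx : ∀ i, CTensor.map (BHom.id V) (f i) x = 0) : x = 0 :=
  hV.eq_zero_of_tensorId fun ω => hf _ fun i => by
    rw [← BHom.comp_id ω, ← tensorId_map, hx, map_zero]

theorem ApproximationProperty.eq_zero_of_map_left (hV : ApproximationProperty V)
    (hW : HasSeparatingDual W) {ι : Type*} {f : ι → BHom V V'}
    (hf : ∀ v, (∀ i, f i v = 0) → v = 0) {x : CTensor V W}
    (hx : ∀ i, CTensor.map (f i) (BHom.id W) x = 0) : x = 0 :=
  hV.eq_zero_of_tensorId fun ω => hW _ fun η => by
    have hslice : idTensor V η x = 0 := hf _ fun i => by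
      rw [← BHom.comp_id η, ← idTensor_map, hx, map_zero]
    rw [← apply_idTensor, hslice, map_zero]

end TensorCalculus

section TensorAlgebra

variable {A B : Type*}
  [NonUnitalRing A] [Module ℂ A] [IsScalarTower ℂ A A] [SMulCommClass ℂ A A]
  [Bornology A] [CompleteBornology A] [BornologicalAlgebra A]
  [NonUnitalRing B] [Module ℂ B] [IsScalarTower ℂ B B] [SMulCommClass ℂ B B]
  [Bornology B] [CompleteBornology B] [BornologicalAlgebra B]

theorem CTensor.mul_tmul (x : CTensor A B) (a : A) (b : B) :
    x * tmul a b = map (BHom.flip (mulHom A) a) (BHom.flip (mulHom B) b) x :=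
  eq_of_tmul (BHom.flip (mulHom _) (tmul a b)) _ (fun v w => by simp) x

theorem CTensor.tmul_mul (x : CTensor A B) (a : A) (b : B) :
    tmul a b * x = map (mulHom A a) (mulHom B b) x :=
  eq_of_tmul (mulHom _ (tmul a b)) _ (fun v w => by simp) x

theorem ApproximationProperty.eq_zero_of_mul_tmul (hA : ApproximationProperty A)
    (hB : HasSeparatingDual B) (hmulA : ∀ x : A, (∀ y, x * y = 0) → x = 0)
    (hmulB : ∀ x : B, (∀ y, x * y = 0) → x = 0) {x : CTensor A B}
    (hx : ∀ a b, x * CTensor.tmul a b = 0) : x = 0 := by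
  refine hA.eq_zero_of_map_id (f := (mulHom B).flip) hmulB fun b => ?_
  refine hA.eq_zero_of_map_left hB (f := (mulHom A).flip) hmulA fun a => ?_
  rw [CTensor.map_map, BHom.comp_id, BHom.id_comp, ← CTensor.mul_tmul, hx]

theorem ApproximationProperty.eq_zero_of_tmul_mul (hA : ApproximationProperty A)
    (hB : HasSeparatingDual B) (hmulA : ∀ x : A, (∀ y, y * x = 0) → x = 0)
    (hmulB : ∀ x : B, (∀ y, y * x = 0) → x = 0) {x : CTensor A B}
    (hx : ∀ a b, CTensor.tmul a b * x = 0) : x = 0 := by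
  refine hA.eq_zero_of_map_id (f := mulHom B) hmulB fun b => ?_
  refine hA.eq_zero_of_map_left hB (f := mulHom A) hmulA fun a => ?_
  rw [CTensor.map_map, BHom.comp_id, BHom.id_comp, ← CTensor.tmul_mul, hx]

end TensorAlgebra

open CTensor

section GaloisSystem

variable {V : Type*} [AddCommGroup V] [Module ℂ V] [Bornology V] [CompleteBornology V]

/-! ## Counit and antipode of a Galois system -/

/-- The relations satisfied by the maps `L (a ⊗ b) = (a ⊗ 1) Δ(b)`, `R (a ⊗ b) = Δ(a) (1 ⊗ b)`,
`P (a ⊗ b) = (1 ⊗ a) Δ(b)` and `D c x = x Δ(c)` of a bornological quantum group with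
multiplication `m`. They make sense without multiplier algebras, and hold for the opposite
quantum group as well, so that every consequence has a mirror image. -/
structure IsGaloisSystem (m : BHom V (BHom V V)) (L R P : BHom (CTensor V V) (CTensor V V))
    (D : V → BHom (CTensor V V) (CTensor V V)) : Prop where
  L_iso : IsBornIso L
  R_iso : IsBornIso R
  mul_assoc : ∀ a b c, m (m a b) c = m a (m b c)
  nondeg_left : ∀ x, (∀ b, m b x = 0) → x = 0
  left_R : ∀ a p q, map (m a) (BHom.id V) (R (tmul p q)) =
    map (BHom.id V) (m.flip q) (L (tmul a p))
  left_P : ∀ b x c, map (m b) (BHom.id V) (P (tmul x c)) =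
    map (BHom.id V) (m x) (L (tmul b c))
  D_tmul : ∀ c p q, D c (tmul p q) = map (BHom.id V) (m q) (L (tmul p c))
  L_mul : ∀ a b c, L (tmul a (m b c)) = D c (L (tmul a b))
  coassoc : ∀ a b c, CTensor.assoc V V V (map (L.curry a) (BHom.id V) (R (tmul b c))) =
    map (BHom.id V) (R.curry.flip c) (L (tmul a b))

/-- For `R (a ⊗ b) = Δ(a) (1 ⊗ b)`, the slice map `a ↦ (id ⊗ η) (Δ(a) (1 ⊗ c))`. -/
def galoisSlice (R : BHom (CTensor V V) (CTensor V V)) (η : BHom V ℂ) (c : V) : BHom V V :=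
  (idTensor V η).comp (R.curry.flip c)

namespace IsGaloisSystem

variable {m : BHom V (BHom V V)} {L R P : BHom (CTensor V V) (CTensor V V)}
    {D : V → BHom (CTensor V V) (CTensor V V)} (h : IsGaloisSystem m L R P D)

include h

theorem eq_of_mul_eq {x y : V} (hxy : ∀ b, m b x = m b y) : x = y :=
  sub_eq_zero.1 (h.nondeg_left _ fun b => by rw [map_sub, hxy, sub_self])

theorem map_mul_inverse_R (a : V) (u : CTensor V V) :
    map (BHom.id V) ((lift m).comp h.R_iso.inverse)
      (CTensor.assoc V V V (map (L.curry a) (BHom.id V) u)) = map (m a) (BHom.id V) u := by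
  refine eq_of_surjective h.R_iso.1.2
    ((map (BHom.id V) ((lift m).comp h.R_iso.inverse)).comp
      ((CTensor.assoc V V V).comp (map (L.curry a) (BHom.id V)))) _ (fun p q => ?_) u
  have hslice : ((lift m).comp h.R_iso.inverse).comp (R.curry.flip q) = m.flip q := by
    ext y
    simp
  rw [BHom.comp_apply, BHom.comp_apply, h.coassoc, CTensor.map_map, h.left_R, hslice,
    BHom.comp_id]

theorem tmul_mul_inverse_R (a b c : V) :
    tmul a (lift m (h.R_iso.inverse (tmul b c))) =
      tmul (lift m (h.L_iso.inverse (tmul a b))) c := by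
  have hL : ∀ v, map (BHom.id V) ((lift m).comp h.R_iso.inverse)
      (CTensor.assoc V V V (tmul v c)) = tmul (lift m (h.L_iso.inverse v)) c := fun v =>
    eq_of_surjective h.L_iso.1.2
      (((map (BHom.id V) ((lift m).comp h.R_iso.inverse)).comp
        (CTensor.assoc V V V)).curry.flip c)
      (((tmulHom V V).flip c).comp ((lift m).comp h.L_iso.inverse))
      (fun a b => by simpa using h.map_mul_inverse_R a (tmul b c)) v
  simpa using hL (tmul a b)

theorem exists_counit {φ : BHom V ℂ} {e : V} (hφ : φ e = 1) :
    ∃ ε : BHom V ℂ, (∀ x, idTensor V ε (L x) = lift m x) ∧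
      ∀ x, tensorId V ε (R x) = lift m x := by
  let ε : BHom V ℂ := φ.comp ((lift m).comp (h.L_iso.inverse.comp (tmulHom V V e)))
  have hR : ∀ b c, lift m (h.R_iso.inverse (tmul b c)) = ε b • c := fun b c => by
    simpa [hφ, ε] using congrArg (tensorId V φ) (h.tmul_mul_inverse_R e b c)
  have hL : ∀ a b, lift m (h.L_iso.inverse (tmul a b)) = ε b • a := fun a b => by
    simpa [hφ, hR] using (congrArg (idTensor V φ) (h.tmul_mul_inverse_R a b e)).symm
  refine ⟨ε, fun x => ?_, fun x => ?_⟩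
  · simpa using (eq_of_tmul ((lift m).comp h.L_iso.inverse) (idTensor V ε)
      (fun a b => by simp [hL]) (L x)).symm
  · simpa using (eq_of_tmul ((lift m).comp h.R_iso.inverse) (tensorId V ε)
      (fun a b => by simp [hR]) (R x)).symm

theorem L_slice (η : BHom V ℂ) (c : V) (z : CTensor V V) :
    L (map (BHom.id V) (galoisSlice R η c) z) = map (BHom.id V) (galoisSlice R η c) (L z) := by
  refine eq_of_tmul (L.comp (map (BHom.id V) (galoisSlice R η c)))
    ((map (BHom.id V) (galoisSlice R η c)).comp L) (fun a b => ?_) z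
  have hcoassoc := congrArg (map (BHom.id V) (idTensor V η)) (h.coassoc a b c)
  rw [map_id_idTensor_assoc, idTensor_map, CTensor.map_map] at hcoassoc
  rw [BHom.comp_apply, map_tmul]
  exact hcoassoc

theorem inverse_L_slice (η : BHom V ℂ) (c : V) (z : CTensor V V) :
    h.L_iso.inverse (map (BHom.id V) (galoisSlice R η c) z) =
      map (BHom.id V) (galoisSlice R η c) (h.L_iso.inverse z) := by
  apply h.L_iso.1.1
  rw [IsBornIso.apply_inverse, h.L_slice, IsBornIso.apply_inverse]

theorem idTensor_D {η : BHom V ℂ} (hη : ∀ g f, idTensor V η (L (tmul g f)) = η f • g) (c : V)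
    (w : CTensor V V) :
    idTensor V η (D c w) = idTensor V (η.comp (m.flip c)) (h.L_iso.inverse w) := by
  refine eq_of_surjective h.L_iso.1.2 ((idTensor V η).comp (D c))
    ((idTensor V (η.comp (m.flip c))).comp h.L_iso.inverse) (fun p q => ?_) w
  rw [BHom.comp_apply, BHom.comp_apply, ← h.L_mul, hη, IsBornIso.inverse_apply, idTensor_tmul,
    BHom.comp_apply, BHom.flip_apply]

section Counit

variable {ε : BHom V ℂ} (hL : ∀ x, idTensor V ε (L x) = lift m x)
  (hR : ∀ x, tensorId V ε (R x) = lift m x)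

include hL in
theorem idTensor_counit_D (c : V) (w : CTensor V V) :
    idTensor V ε (D c w) = m (idTensor V ε w) c := by
  refine eq_of_surjective h.L_iso.1.2 ((idTensor V ε).comp (D c))
    ((m.flip c).comp (idTensor V ε)) (fun a b => ?_) w
  simp only [BHom.comp_apply, BHom.flip_apply]
  rw [← h.L_mul, hL, hL, lift_tmul, lift_tmul, h.mul_assoc]

include hL in
theorem counit_mul [Nontrivial V] (q y : V) : ε (m q y) = ε q * ε y := by
  have hslice : ∀ w, idTensor V (ε.comp (m q)) w = ε q • idTensor V ε w := fun w => by
    refine eq_of_surjective h.L_iso.1.2 (idTensor V (ε.comp (m q)))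
      (ε q • idTensor V ε) (fun p c => ?_) w
    calc idTensor V (ε.comp (m q)) (L (tmul p c))
        = idTensor V ε (map (BHom.id V) (m q) (L (tmul p c))) := by
          rw [idTensor_map, BHom.id_apply]
      _ = m (idTensor V ε (tmul p q)) c := by rw [← h.D_tmul, h.idTensor_counit_D hL]
      _ = (ε q • idTensor V ε) (L (tmul p c)) := by
          rw [BHom.smul_apply, hL, idTensor_tmul, lift_tmul, map_smul, BHom.smul_apply]
  obtain ⟨x, hx⟩ := exists_ne (0 : V)
  refine smul_left_injective ℂ hx ?_
  simpa [smul_smul] using hslice (tmul x y)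

omit h in
include hR in
theorem counit_comp_galoisSlice (η : BHom V ℂ) (c : V) :
    ε.comp (galoisSlice R η c) = η.comp (m.flip c) := by
  ext y
  calc ε (idTensor V η (R (tmul y c))) = η (lift m (tmul y c)) := by rw [apply_idTensor, hR]
    _ = η (m y c) := by rw [lift_tmul]

include hR in
theorem mul_slice_P {η : BHom V ℂ} (hη : ∀ g f, idTensor V η (L (tmul g f)) = η f • g)
    (b : V) (u : CTensor V V) :
    m b (idTensor V η (P u)) = idTensor V ε (h.L_iso.inverse (tmul b (idTensor V η (R u)))) := by
  refine eq_of_tmul ((m b).comp ((idTensor V η).comp P))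
    ((idTensor V ε).comp (h.L_iso.inverse.comp ((tmulHom V V b).comp
      ((idTensor V η).comp R)))) (fun x c => ?_) u
  calc m b (idTensor V η (P (tmul x c)))
      = idTensor V η (D c (tmul b x)) := by
        rw [← BHom.comp_id η, ← idTensor_map, h.left_P, ← h.D_tmul, BHom.comp_id]
    _ = idTensor V (ε.comp (galoisSlice R η c)) (h.L_iso.inverse (tmul b x)) := by
        rw [h.idTensor_D hη, counit_comp_galoisSlice hR]
    _ = idTensor V ε (h.L_iso.inverse (map (BHom.id V) (galoisSlice R η c) (tmul b x))) := by
        rw [h.inverse_L_slice, idTensor_map, BHom.id_apply]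
    _ = idTensor V ε (h.L_iso.inverse (tmul b (idTensor V η (R (tmul x c))))) := by
        rw [map_tmul, BHom.id_apply]; rfl

include hR in
theorem exists_antipode {φ : BHom V ℂ} {e : V} (he : φ e = 1)
    (hφ : ∀ g f, idTensor V φ (L (tmul g f)) = φ f • g) :
    ∃ S : BHom V V, ∀ b x, m b (S x) = idTensor V ε (h.L_iso.inverse (tmul b x)) :=
  ⟨(idTensor V φ).comp (P.comp (h.R_iso.inverse.comp ((tmulHom V V).flip e))),
    fun b x => by simpa [he] using h.mul_slice_P hR hφ b (h.R_iso.inverse (tmul x e))⟩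

variable {S : BHom V V} (hS : ∀ b x, m b (S x) = idTensor V ε (h.L_iso.inverse (tmul b x)))

include hR hS in
theorem antipode_slice {η : BHom V ℂ} (hη : ∀ g f, idTensor V η (L (tmul g f)) = η f • g)
    (u : CTensor V V) : S (idTensor V η (R u)) = idTensor V η (P u) :=
  h.eq_of_mul_eq fun b => by rw [hS, h.mul_slice_P hR hη]

include hS in
theorem mul_antipode_L (x : CTensor V V) :
    lift m (map (BHom.id V) S (L x)) = idTensor V ε x := by
  simpa using eq_of_tmul ((lift m).comp (map (BHom.id V) S))
    ((idTensor V ε).comp h.L_iso.inverse) (fun b x => by simp [hS]) (L x)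

theorem mul_mul_map_assoc (S : BHom V V) (v : CTensor V V) (z : V) :
    lift m (map (BHom.id V) ((lift m).comp (map S (BHom.id V)))
      (CTensor.assoc V V V (tmul v z))) = m (lift m (map (BHom.id V) S v)) z :=
  eq_of_tmul (((lift m).comp ((map (BHom.id V) ((lift m).comp (map S (BHom.id V)))).comp
      (CTensor.assoc V V V))).curry.flip z)
    ((m.flip z).comp ((lift m).comp (map (BHom.id V) S))) (fun x y => by simp [h.mul_assoc]) v

include hS in
theorem mul_mul_map_assoc_L (a : V) (u : CTensor V V) :
    lift m (map (BHom.id V) ((lift m).comp (map S (BHom.id V)))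
      (CTensor.assoc V V V (map (L.curry a) (BHom.id V) u))) = m a (tensorId V ε u) := by
  refine eq_of_tmul ((lift m).comp ((map (BHom.id V) ((lift m).comp (map S (BHom.id V)))).comp
    ((CTensor.assoc V V V).comp (map (L.curry a) (BHom.id V))))) ((m a).comp (tensorId V ε))
    (fun y z => ?_) u
  simp only [BHom.comp_apply, map_tmul, BHom.id_apply, BHom.curry_apply, h.mul_mul_map_assoc,
    h.mul_antipode_L hS, idTensor_tmul, tensorId_tmul, map_smul, BHom.smul_apply]

include hL hR hS in
theorem mul_antipode_R (x : CTensor V V) :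
    lift m (map S (BHom.id V) (R x)) = tensorId V ε x := by
  set E := (lift m).comp (map S (BHom.id V)) with hE
  have hslice : ∀ (q : V) (w : CTensor V V),
      lift m (map (BHom.id V) (E.comp (R.curry.flip q)) w) = m (idTensor V ε w) q := fun q w => by
    refine eq_of_surjective h.L_iso.1.2
      ((lift m).comp (map (BHom.id V) (E.comp (R.curry.flip q))))
      ((m.flip q).comp (idTensor V ε)) (fun a p => ?_) w
    calc lift m (map (BHom.id V) (E.comp (R.curry.flip q)) (L (tmul a p)))
        = lift m (map (BHom.id V) E (CTensor.assoc V V V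
            (map (L.curry a) (BHom.id V) (R (tmul p q))))) := by
          rw [h.coassoc, CTensor.map_map, BHom.comp_id]
      _ = m a (m p q) := by rw [hE, h.mul_mul_map_assoc_L hS, hR, lift_tmul]
      _ = m (idTensor V ε (L (tmul a p))) q := by rw [hL, lift_tmul, h.mul_assoc]
  refine eq_of_tmul (E.comp R) (tensorId V ε) (fun y q => h.eq_of_mul_eq fun b => ?_) x
  simpa using hslice q (tmul b y)

include hL hS in
theorem mul_antipode_D [Nontrivial V] (z : V) (v : CTensor V V) :
    lift m (map (BHom.id V) S (D z v)) = ε z • lift m (map (BHom.id V) S v) := by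
  refine eq_of_surjective h.L_iso.1.2 ((lift m).comp ((map (BHom.id V) S).comp (D z)))
    (ε z • (lift m).comp (map (BHom.id V) S)) (fun a b => ?_) v
  simp only [BHom.comp_apply, BHom.smul_apply]
  rw [← h.L_mul, h.mul_antipode_L hS, h.mul_antipode_L hS, idTensor_tmul, idTensor_tmul,
    h.counit_mul hL, smul_smul, mul_comm]

include hL hS in
theorem antipode_mul [Nontrivial V] (q y : V) : S (m q y) = m (S y) (S q) := by
  have hmul : ∀ w : CTensor V V, lift m (map (BHom.id V) (S.comp (m q)) w) =
      m (lift m (map (BHom.id V) S w)) (S q) := fun w => by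
    refine eq_of_surjective h.L_iso.1.2 ((lift m).comp (map (BHom.id V) (S.comp (m q))))
      ((m.flip (S q)).comp ((lift m).comp (map (BHom.id V) S))) (fun p z => ?_) w
    calc lift m (map (BHom.id V) (S.comp (m q)) (L (tmul p z)))
        = lift m (map (BHom.id V) S (D z (tmul p q))) := by
          rw [h.D_tmul, CTensor.map_map, BHom.comp_id]
      _ = ε z • m p (S q) := by
          rw [h.mul_antipode_D hL hS, map_tmul, BHom.id_apply, lift_tmul]
      _ = m (lift m (map (BHom.id V) S (L (tmul p z)))) (S q) := by
          rw [h.mul_antipode_L hS, idTensor_tmul, map_smul, BHom.smul_apply]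
  refine h.eq_of_mul_eq fun b => ?_
  simpa [h.mul_assoc] using hmul (tmul b y)

end Counit

end IsGaloisSystem

end GaloisSystem

section MultiplierAlgebra

variable {A B C K V W X : Type*}
  [NonUnitalRing A] [Module ℂ A] [IsScalarTower ℂ A A] [SMulCommClass ℂ A A]
  [Bornology A] [CompleteBornology A] [BornologicalAlgebra A]
  [NonUnitalRing B] [Module ℂ B] [IsScalarTower ℂ B B] [SMulCommClass ℂ B B]
  [Bornology B] [CompleteBornology B] [BornologicalAlgebra B]
  [NonUnitalRing C] [Module ℂ C] [IsScalarTower ℂ C C] [SMulCommClass ℂ C C]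
  [Bornology C] [CompleteBornology C] [BornologicalAlgebra C]
  [AddCommGroup V] [Module ℂ V] [Bornology V] [CompleteBornology V]
  [AddCommGroup W] [Module ℂ W] [Bornology W] [CompleteBornology W]
  [AddCommGroup X] [Module ℂ X] [Bornology X] [CompleteBornology X]

/-! ## Multipliers and the Galois maps -/

namespace Multiplier

theorem of_left_apply (m : Multiplier A) (x : A) : of (m.left x) = m * of x :=
  Multiplier.ext (fun y => (m.left_mul' x y).symm) (fun y => m.compat y x)

theorem of_right_apply (m : Multiplier A) (x : A) : of (m.right x) = of x * m :=
  Multiplier.ext (fun y => (m.compat x y).symm) (fun y => (m.right_mul' y x).symm)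

theorem of_mul (x y : A) : of (x * y) = of x * of y :=
  of_left_apply (of x) y

theorem of_tmul_fst_snd (a : A) (b : B) : of (tmul a b) = tensor (of a) 1 * tensor 1 (of b) := by
  refine Multiplier.ext (fun x => ?_) (fun x => ?_)
  · rw [of_left, tmul_mul, left_mul, tensor_left, tensor_left, CTensor.map_map]
    rfl
  · rw [of_right, mul_tmul, right_mul, tensor_right, tensor_right, CTensor.map_map]
    rfl

theorem of_tmul_snd_fst (a : A) (b : B) : of (tmul a b) = tensor 1 (of b) * tensor (of a) 1 := by
  refine Multiplier.ext (fun x => ?_) (fun x => ?_)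
  · rw [of_left, tmul_mul, left_mul, tensor_left, tensor_left, CTensor.map_map]
    rfl
  · rw [of_right, mul_tmul, right_mul, tensor_right, tensor_right, CTensor.map_map]
    rfl

theorem of_map_mul_left_fst (a : A) (x : CTensor A B) :
    of (map (mulHom A a) (BHom.id B) x) = tensor (of a) 1 * of x :=
  of_left_apply (tensor (of a) 1) x

theorem of_map_mul_left_snd (b : B) (x : CTensor A B) :
    of (map (BHom.id A) (mulHom B b) x) = tensor 1 (of b) * of x :=
  of_left_apply (tensor 1 (of b)) x

theorem of_map_mul_right_fst (a : A) (x : CTensor A B) :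
    of (map ((mulHom A).flip a) (BHom.id B) x) = of x * tensor (of a) 1 :=
  of_right_apply (tensor (of a) 1) x

theorem of_map_mul_right_snd (b : B) (x : CTensor A B) :
    of (map (BHom.id A) ((mulHom B).flip b) x) = of x * tensor 1 (of b) :=
  of_right_apply (tensor 1 (of b)) x

end Multiplier

theorem InducesIso.surjective {r : V → K → V} {l : K → W → W} {b : BHom V (BHom W X)}
    (h : InducesIso r l (fun v w => b v w)) : Function.Surjective (lift b) := by
  obtain ⟨e, he, hmk⟩ := h
  have hfactor : lift b = e.comp (BalancedTensor.mk r l) := hom_ext fun v w => by simp [hmk]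
  rw [hfactor]
  exact he.1.2.comp (BQuot.mk_surjective _)

theorem CTensor.assoc_mul_tmul_tmul (x : CTensor (CTensor A B) C) (a : A) (b : B) (c : C) :
    assoc A B C (x * tmul (tmul a b) c) = assoc A B C x * tmul a (tmul b c) := by
  have hAB : (mulHom (CTensor A B)).flip (tmul a b) = map ((mulHom A).flip a) ((mulHom B).flip b) :=
    BHom.ext fun y => mul_tmul y a b
  have hBC : (mulHom (CTensor B C)).flip (tmul b c) = map ((mulHom B).flip b) ((mulHom C).flip c) :=
    BHom.ext fun y => mul_tmul y b c
  rw [mul_tmul, mul_tmul, hAB, hBC, assoc_map]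

end MultiplierAlgebra

namespace BornologicalQuantumGroup

variable {H : Type*}
  [NonUnitalRing H] [Module ℂ H] [IsScalarTower ℂ H H] [SMulCommClass ℂ H H]
  [Bornology H] [CompleteBornology H] [BornologicalAlgebra H] (Q : BornologicalQuantumGroup H)

include Q

theorem eq_zero_of_mul_left {x : H} (hx : ∀ b, b * x = 0) : x = 0 :=
  Q.faithful.2 x fun f => by rw [hx, map_zero]

theorem eq_zero_of_mul_right {x : H} (hx : ∀ b, x * b = 0) : x = 0 :=
  Q.faithful.1 x fun f => by rw [hx, map_zero]

theorem eq_of_mul_left {x y : H} (h : ∀ b, b * x = b * y) : x = y :=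
  sub_eq_zero.1 (Q.eq_zero_of_mul_left fun b => by rw [mul_sub, h, sub_self])

theorem eq_of_mul_right {x y : H} (h : ∀ b, x * b = y * b) : x = y :=
  sub_eq_zero.1 (Q.eq_zero_of_mul_right fun b => by rw [sub_mul, h, sub_self])

theorem hasSeparatingDual : HasSeparatingDual H := fun x hx =>
  Q.faithful.1 x fun g => hx (Q.φ.comp ((mulHom H).flip g))

theorem mul_surjective : Function.Surjective (lift (mulHom H)) :=
  InducesIso.surjective (b := mulHom H) Q.essential

theorem exists_φ_eq_one : ∃ f, Q.φ f = 1 := by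
  obtain ⟨x, hx⟩ := @exists_ne H Q.nontrivial 0
  obtain ⟨g, hg⟩ : ∃ g, Q.φ (x * g) ≠ 0 := by
    by_contra! hφ
    exact hx (Q.faithful.1 x hφ)
  exact ⟨(Q.φ (x * g))⁻¹ • (x * g), by rw [map_smul, smul_eq_mul, inv_mul_cancel₀ hg]⟩

theorem tensor_eq_zero_of_mul_right {x : CTensor H H} (hx : ∀ y, x * y = 0) : x = 0 :=
  Q.approximation.eq_zero_of_mul_tmul Q.hasSeparatingDual (fun _ => Q.eq_zero_of_mul_right)
    (fun _ => Q.eq_zero_of_mul_right) fun _ _ => hx _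

theorem tensor_eq_zero_of_mul_left {x : CTensor H H} (hx : ∀ y, y * x = 0) : x = 0 :=
  Q.approximation.eq_zero_of_tmul_mul Q.hasSeparatingDual (fun _ => Q.eq_zero_of_mul_left)
    (fun _ => Q.eq_zero_of_mul_left) fun _ _ => hx _

theorem of_injective {x y : CTensor H H} (h : Multiplier.of x = Multiplier.of y) : x = y :=
  sub_eq_zero.1 <| Q.tensor_eq_zero_of_mul_right fun z => by
    rw [sub_mul, sub_eq_zero, ← Multiplier.of_left, h, Multiplier.of_left]

theorem eq_of_mul_tmul_tmul {x y : CTensor H (CTensor H H)}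
    (h : ∀ a b c, x * tmul a (tmul b c) = y * tmul a (tmul b c)) : x = y := by
  refine sub_eq_zero.1 (Q.approximation.eq_zero_of_mul_tmul
    (Q.approximation.hasSeparatingDual_tensor Q.hasSeparatingDual)
    (fun _ => Q.eq_zero_of_mul_right) (fun _ => Q.tensor_eq_zero_of_mul_right) fun a z => ?_)
  refine eq_of_tmul ((mulHom _ (x - y)).comp (tmulHom _ _ a)) 0 (fun b c => ?_) z
  simp only [BHom.comp_apply, tmulHom_apply, mulHom_apply, BHom.zero_apply]
  rw [sub_mul, h, sub_self]

theorem mul_left_γr (a p q : H) : map (mulHom H a) (BHom.id H) (Q.γr (tmul p q)) =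
    map (BHom.id H) ((mulHom H).flip q) (Q.ρl (tmul a p)) :=
  Q.of_injective (by
    rw [Multiplier.of_map_mul_left_fst, Multiplier.of_map_mul_right_snd, Q.γr_spec, Q.ρl_spec,
      mul_assoc])

theorem mul_right_γl (a p q : H) : map (BHom.id H) (mulHom H a) (Q.γl (tmul p q)) =
    map ((mulHom H).flip q) (BHom.id H) (Q.ρr (tmul a p)) :=
  Q.of_injective (by
    rw [Multiplier.of_map_mul_left_snd, Multiplier.of_map_mul_right_fst, Q.γl_spec, Q.ρr_spec,
      mul_assoc])

theorem mul_left_γl (a p q : H) : map (mulHom H a) (BHom.id H) (Q.γl (tmul p q)) =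
    map ((mulHom H).flip q) (BHom.id H) (Q.ρl (tmul a p)) :=
  Q.of_injective (by
    rw [Multiplier.of_map_mul_left_fst, Multiplier.of_map_mul_right_fst, Q.γl_spec, Q.ρl_spec,
      mul_assoc])

theorem mul_right_γr (a p q : H) : map (BHom.id H) (mulHom H a) (Q.γr (tmul p q)) =
    map (BHom.id H) ((mulHom H).flip q) (Q.ρr (tmul a p)) :=
  Q.of_injective (by
    rw [Multiplier.of_map_mul_left_snd, Multiplier.of_map_mul_right_snd, Q.γr_spec, Q.ρr_spec,
      mul_assoc])

theorem Δ_right_tmul_eq_ρl (c p q : H) : (Q.Δ c).right (tmul p q) =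
    map (BHom.id H) (mulHom H q) (Q.ρl (tmul p c)) :=
  Q.of_injective (by
    rw [Multiplier.of_right_apply, Multiplier.of_tmul_snd_fst, Multiplier.of_map_mul_left_snd,
      Q.ρl_spec, mul_assoc])

theorem Δ_right_tmul_eq_ρr (c p q : H) : (Q.Δ c).right (tmul p q) =
    map (mulHom H p) (BHom.id H) (Q.ρr (tmul q c)) :=
  Q.of_injective (by
    rw [Multiplier.of_right_apply, Multiplier.of_tmul_fst_snd, Multiplier.of_map_mul_left_fst,
      Q.ρr_spec, mul_assoc])

theorem Δ_left_tmul_eq_γl (c p q : H) : (Q.Δ c).left (tmul p q) =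
    map (BHom.id H) ((mulHom H).flip q) (Q.γl (tmul c p)) :=
  Q.of_injective (by
    rw [Multiplier.of_left_apply, Multiplier.of_tmul_fst_snd, Multiplier.of_map_mul_right_snd,
      Q.γl_spec, mul_assoc])

theorem Δ_left_tmul_eq_γr (c p q : H) : (Q.Δ c).left (tmul p q) =
    map ((mulHom H).flip p) (BHom.id H) (Q.γr (tmul c q)) :=
  Q.of_injective (by
    rw [Multiplier.of_left_apply, Multiplier.of_tmul_snd_fst, Multiplier.of_map_mul_right_fst,
      Q.γr_spec, mul_assoc])

theorem mul_left_ρr (b x c : H) : map (mulHom H b) (BHom.id H) (Q.ρr (tmul x c)) =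
    map (BHom.id H) (mulHom H x) (Q.ρl (tmul b c)) := by
  rw [← Δ_right_tmul_eq_ρl, Δ_right_tmul_eq_ρr]

theorem γr_mul_right (b x c : H) : map ((mulHom H).flip b) (BHom.id H) (Q.γr (tmul c x)) =
    map (BHom.id H) ((mulHom H).flip x) (Q.γl (tmul c b)) := by
  rw [← Δ_left_tmul_eq_γl, Δ_left_tmul_eq_γr]

theorem ρl_tmul_mul (a b c : H) : Q.ρl (tmul a (b * c)) = (Q.Δ c).right (Q.ρl (tmul a b)) :=
  Q.of_injective (by rw [Multiplier.of_right_apply, Q.ρl_spec, Q.ρl_spec, map_mul, mul_assoc])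

theorem ρr_tmul_mul (a b c : H) : Q.ρr (tmul a (b * c)) = (Q.Δ c).right (Q.ρr (tmul a b)) :=
  Q.of_injective (by rw [Multiplier.of_right_apply, Q.ρr_spec, Q.ρr_spec, map_mul, mul_assoc])

theorem γl_mul_tmul (a b c : H) : Q.γl (tmul (c * b) a) = (Q.Δ c).left (Q.γl (tmul b a)) :=
  Q.of_injective (by rw [Multiplier.of_left_apply, Q.γl_spec, Q.γl_spec, map_mul, mul_assoc])

theorem γr_mul (b c : H) (x : CTensor H H) :
    Q.γr (tmul b c) * x = (Q.Δ b).left (map (BHom.id H) (mulHom H c) x) :=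
  congrArg (fun m => Multiplier.left m x) (Q.γr_spec b c)

theorem mul_ρl (a b : H) (x : CTensor H H) :
    x * Q.ρl (tmul a b) = (Q.Δ b).right (map ((mulHom H).flip a) (BHom.id H) x) :=
  congrArg (fun m => Multiplier.right m x) (Q.ρl_spec a b)

theorem ρl_mul (a b : H) (x : CTensor H H) :
    Q.ρl (tmul a b) * x = map (mulHom H a) (BHom.id H) ((Q.Δ b).left x) :=
  congrArg (fun m => Multiplier.left m x) (Q.ρl_spec a b)

theorem Δ_left_surjective : Function.Surjective (lift Q.Δ.leftHom) := Q.essential_Δ.1.surjective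

theorem Δ_right_surjective : Function.Surjective (lift Q.Δ.rightHom.flip) :=
  InducesIso.surjective (b := Q.Δ.rightHom.flip) Q.essential_Δ.2

theorem eq_zero_of_Δ_left {y : CTensor H H} (h : ∀ v, (Q.Δ v).left y = 0) : y = 0 := by
  refine Q.tensor_eq_zero_of_mul_left fun z => ?_
  refine eq_of_surjective Q.Δ_right_surjective ((mulHom _).flip y) 0 (fun x v => ?_) z
  simp only [lift_tmul, BHom.flip_apply, mulHom_apply, MultHom.rightHom_apply, BHom.zero_apply]
  rw [← Multiplier.compat, h, mul_zero]

section Coassociativity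

variable {F : Multiplier (CTensor H H) →ₐ[ℂ] Multiplier (CTensor (CTensor H H) H)}
  {G : Multiplier (CTensor H H) →ₐ[ℂ] Multiplier (CTensor H (CTensor H H))}

theorem extension_left_apply_Δ_left (hF : (MultHom.tensor Q.Δ (MultHom.incl H)).IsExtension F)
    (b c u c' d : H) (y : CTensor H H) :
    (F (Q.Δ b)).left (tmul ((Q.Δ u).left y) (c * (c' * d))) =
      (MultHom.tensor Q.Δ (MultHom.incl H) (Q.γr (tmul b c))).left
        (tmul ((Q.Δ u).left y) (c' * d)) := by
  have hΔ : Q.Δ b * Multiplier.of (tmul u (c * c')) =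
      Multiplier.of (Q.γr (tmul b c)) * Multiplier.of (tmul u c') := by
    rw [← Multiplier.of_mul, γr_mul, Multiplier.of_left_apply, map_tmul, BHom.id_apply,
      mulHom_apply]
  simpa only [map_mul, hF.2, MultHom.tensor_tmul, Multiplier.left_mul, Multiplier.tensor_left,
    map_tmul, MultHom.incl_apply, Multiplier.of_left, mul_assoc] using
    congrArg (fun m => Multiplier.left (F m) (tmul y d)) hΔ

theorem extension_left_apply (hF : (MultHom.tensor Q.Δ (MultHom.incl H)).IsExtension F)
    (b c : H) (Y : CTensor H H) (e : H) : (F (Q.Δ b)).left (tmul Y (c * e)) =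
      (MultHom.tensor Q.Δ (MultHom.incl H) (Q.γr (tmul b c))).left (tmul Y e) := by
  refine eq_of_surjective Q.mul_surjective
    ((F (Q.Δ b)).left.comp ((tmulHom _ _ Y).comp (mulHom H c)))
    ((MultHom.tensor Q.Δ (MultHom.incl H) (Q.γr (tmul b c))).left.comp (tmulHom _ _ Y))
    (fun c' d => ?_) e
  simp only [lift_tmul, BHom.comp_apply, mulHom_apply, tmulHom_apply]
  refine eq_of_surjective Q.Δ_left_surjective
    ((F (Q.Δ b)).left.comp ((tmulHom _ _).flip (c * (c' * d))))
    ((MultHom.tensor Q.Δ (MultHom.incl H) (Q.γr (tmul b c))).left.comp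
      ((tmulHom _ _).flip (c' * d))) (fun u y => ?_) Y
  simpa using Q.extension_left_apply_Δ_left hF b c u c' d y

theorem map_extension_left_apply (hG : (MultHom.tensor (MultHom.incl H) Q.Δ).IsExtension G)
    (a b : H) (Z : CTensor H (CTensor H H)) :
    map (mulHom H a) (BHom.id _) ((G (Q.Δ b)).left Z) =
      (MultHom.tensor (MultHom.incl H) Q.Δ (Q.ρl (tmul a b))).left Z := by
  have hΔ (a' v : H) : Multiplier.of (tmul (a' * a) v) * Q.Δ b =
      Multiplier.of (tmul a' v) * Multiplier.of (Q.ρl (tmul a b)) := by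
    rw [← Multiplier.of_mul, mul_ρl, Multiplier.of_right_apply, map_tmul, BHom.id_apply,
      BHom.flip_apply, mulHom_apply]
  have heq (a' v : H) : map (mulHom H a') (Q.Δ v).left
      (map (mulHom H a) (BHom.id _) ((G (Q.Δ b)).left Z)) = map (mulHom H a') (Q.Δ v).left
      ((MultHom.tensor (MultHom.incl H) Q.Δ (Q.ρl (tmul a b))).left Z) := by
    have hG' := congrArg (fun m => Multiplier.left (G m) Z) (hΔ a' v)
    simp only [map_mul, hG.2, MultHom.tensor_tmul, Multiplier.left_mul, Multiplier.tensor_left,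
      MultHom.incl_apply] at hG'
    rw [CTensor.map_map]
    exact hG'
  refine sub_eq_zero.1 ?_
  refine Q.approximation.eq_zero_of_map_id (f := fun v => (Q.Δ v).left)
    (fun _ => Q.eq_zero_of_Δ_left) fun v => ?_
  refine Q.approximation.eq_zero_of_map_left
    (Q.approximation.hasSeparatingDual_tensor Q.hasSeparatingDual) (f := fun a => mulHom H a)
    (fun _ => Q.eq_zero_of_mul_left) fun a' => ?_
  rw [CTensor.map_map, BHom.comp_id, BHom.id_comp, map_sub, heq, sub_self]

theorem ρl_γr_comm (a b c : H) :
    CTensor.assoc H H H (map (Q.ρl.curry a) (BHom.id H) (Q.γr (tmul b c))) =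
      map (BHom.id H) (Q.γr.curry.flip c) (Q.ρl (tmul a b)) := by
  obtain ⟨F, G, hF, hG, hFG⟩ := Q.coassociative
  refine Q.eq_of_mul_tmul_tmul fun y₁ y₂ e => ?_
  have hleft : map (map (mulHom H a) (BHom.id H)) (BHom.id H)
      ((MultHom.tensor Q.Δ (MultHom.incl H) (Q.γr (tmul b c))).left (tmul (tmul y₁ y₂) e)) =
      map (Q.ρl.curry a) (BHom.id H) (Q.γr (tmul b c)) * tmul (tmul y₁ y₂) e := by
    refine eq_of_tmul ((map (map (mulHom H a) (BHom.id H)) (BHom.id H)).comp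
      ((BHom.eval (tmul (tmul y₁ y₂) e)).comp
        (MultHom.tensor Q.Δ (MultHom.incl H)).leftHom))
      (((mulHom _).flip (tmul (tmul y₁ y₂) e)).comp
        (map (Q.ρl.curry a) (BHom.id H))) (fun x y => ?_) _
    simp [MultHom.tensor_tmul, ρl_mul]
  have hright : (MultHom.tensor (MultHom.incl H) Q.Δ (Q.ρl (tmul a b))).left
      (tmul y₁ (tmul y₂ (c * e))) =
      map (BHom.id H) (Q.γr.curry.flip c) (Q.ρl (tmul a b)) * tmul y₁ (tmul y₂ e) := by
    refine eq_of_tmul ((BHom.eval (tmul y₁ (tmul y₂ (c * e)))).comp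
        (MultHom.tensor (MultHom.incl H) Q.Δ).leftHom)
      (((mulHom _).flip (tmul y₁ (tmul y₂ e))).comp
        (map (BHom.id H) (Q.γr.curry.flip c))) (fun x y => ?_) _
    simp [MultHom.tensor_tmul, γr_mul]
  rw [← assoc_mul_tmul_tmul, ← hleft, ← Q.extension_left_apply hF, assoc_map, (hFG b _).1,
    CTensor.map_id_id, Q.map_extension_left_apply hG, assoc_tmul, hright]

end Coassociativity

end BornologicalQuantumGroup

section InducedIsomorphism

variable {A U U' V W X : Type*}
  [AddCommGroup U] [Module ℂ U] [Bornology U] [CompleteBornology U]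
  [AddCommGroup U'] [Module ℂ U'] [Bornology U'] [CompleteBornology U']
  [AddCommGroup V] [Module ℂ V] [Bornology V] [CompleteBornology V]
  [AddCommGroup W] [Module ℂ W] [Bornology W] [CompleteBornology W]
  [AddCommGroup X] [Module ℂ X] [Bornology X] [CompleteBornology X]

theorem IsBornIso.comp {g : BHom W X} {f : BHom V W} (hg : IsBornIso g) (hf : IsBornIso f) :
    IsBornIso (g.comp f) :=
  .of_inverse (hf.inverse.comp hg.inverse) (fun x => by simp) (fun y => by simp)

/-- The bounded linear map on the quotient by the bornological closure of `R` induced by a bounded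
linear map vanishing on `R`. -/
def BQuot.lift {R : Submodule ℂ V} (f : BHom V X) (hf : R ≤ LinearMap.ker f.toLin) :
    BHom (BQuot R) X :=
  BHom.mk ((bornClosure R).liftQ f.toLin (bornClosure_le (isBornClosed_ker f) hf)) fun s hs => by
    obtain ⟨t, ht, hst⟩ := (BQuot.isBounded_iff _).1 hs
    refine (f.bounded t ht).subset ?_
    rintro _ ⟨x, hx, rfl⟩
    obtain ⟨v, hv, rfl⟩ := hst hx
    exact ⟨v, hv, rfl⟩

theorem InducesIso.of_inverse {r : V → A → V} {l : A → W → W} (f : BHom (CTensor V W) X)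
    (hf : ∀ v a w, f (tmul (r v a) w) = f (tmul v (l a w)))
    (g : BHom X (CTensor V W)) (hfg : ∀ x, f (g x) = x)
    (hgf : ∀ v w, BalancedTensor.mk r l (g (f (tmul v w))) = BalancedTensor.mk r l (tmul v w)) :
    InducesIso r l (fun v w => f (tmul v w)) := by
  have hker : Submodule.span ℂ {x : CTensor V W | ∃ v a w,
      x = tmul (r v a) w - tmul v (l a w)} ≤ LinearMap.ker f.toLin := by
    refine Submodule.span_le.2 ?_
    rintro _ ⟨v, a, w, rfl⟩
    rw [SetLike.mem_coe, LinearMap.mem_ker, BHom.toLin_apply, map_sub, hf, sub_self]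
  let e : BHom (BalancedTensor r l) X := BQuot.lift f hker
  have he : ∀ x, e (BalancedTensor.mk r l x) = f x := fun x => rfl
  refine ⟨e, .of_inverse ((BalancedTensor.mk r l).comp g) (fun x => ?_) (fun y => ?_),
    fun v w => he _⟩
  · obtain ⟨x, rfl⟩ := BQuot.mk_surjective _ x
    exact eq_of_tmul ((BalancedTensor.mk r l).comp (g.comp f)) (BalancedTensor.mk r l) hgf x
  · rw [BHom.comp_apply, he, hfg]

theorem BalancedTensor.mk_tmul (r : V → A → V) (l : A → W → W) (v : V) (a : A) (w : W) :
    mk r l (tmul (r v a) w) = mk r l (tmul v (l a w)) := by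
  rw [← sub_eq_zero, ← map_sub]
  exact (BQuot.mk_eq_zero _).2 (le_bornClosure _ (Submodule.subset_span ⟨v, a, w, rfl⟩))

theorem idTensor_smul (c : ℂ) (η : BHom W ℂ) (x : CTensor V W) :
    idTensor V (c • η) x = c • idTensor V η x :=
  eq_of_tmul (idTensor V (c • η)) (c • idTensor V η) (fun v w => by simp [smul_smul]) x

theorem tensorId_smul (c : ℂ) (ω : BHom V ℂ) (x : CTensor V W) :
    tensorId W (c • ω) x = c • tensorId W ω x :=
  eq_of_tmul (tensorId W (c • ω)) (c • tensorId W ω) (fun v w => by simp [smul_smul]) x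

/-- The contraction `u ⊗ v ↦ (w ↦ β w v • u)` of the second leg of a tensor with a bounded bilinear
form `β`. -/
def contractRight (β : BHom W (BHom V ℂ)) : BHom (CTensor U V) (BHom W U) :=
  BHom.flip ((BHom.compHom _ _ _ (idTensor U (BHom.id ℂ))).comp
    ((mapHom U V U ℂ (BHom.id U)).comp β))

theorem contractRight_apply (β : BHom W (BHom V ℂ)) (x : CTensor U V) (w : W) :
    contractRight β x w = idTensor U (β w) x :=
  idTensor_map (BHom.id ℂ) (BHom.id U) (β w) x

theorem map_contractRight_flip (β : BHom W (BHom V ℂ)) (S : BHom U' X) (x : CTensor U V)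
    (y : CTensor U' W) :
    map (contractRight β x) S (CTensor.flip U' W y) =
      map (BHom.id U) (S.comp (contractRight β.flip y)) x :=
  bilin_ext
    (f := BHom.precomp ((mapHom W U' U X).flip S) (contractRight β) (CTensor.flip U' W))
    (g := BHom.flip ((mapHom U V U X (BHom.id U)).comp
      ((BHom.compHom _ _ _ S).comp (contractRight β.flip))))
    (fun u v u' w => by
      simp [contractRight_apply, CTensor.smul_tmul, CTensor.tmul_smul]) x y

/-- The map `S ⊗ S` preceded by the flip, by which an algebra antihomomorphism `S` acts on
tensor products. -/
def antiTensor (S : BHom V W) : BHom (CTensor V V) (CTensor W W) :=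
  (map S S).comp (flip V V)

@[simp] theorem antiTensor_tmul (S : BHom V W) (x y : V) :
    antiTensor S (tmul x y) = tmul (S y) (S x) := by simp [antiTensor]

theorem map_antiTensor {S : BHom V W} {f f' : BHom V V} {g g' : BHom W W}
    (hf : g.comp S = S.comp f) (hf' : g'.comp S = S.comp f') (x : CTensor V V) :
    map g g' (antiTensor S x) = antiTensor S (map f' f x) := by
  rw [antiTensor, BHom.comp_apply, BHom.comp_apply, flip_map, CTensor.map_map, CTensor.map_map,
    hf, hf']

theorem idTensor_antiTensor (S : BHom V W) (η : BHom W ℂ) (u : CTensor V V) :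
    idTensor W η (antiTensor S u) = S (tensorId V (η.comp S) u) := by
  rw [antiTensor, BHom.comp_apply, idTensor_map, idTensor_flip]

theorem tensorId_antiTensor (S : BHom V W) (η : BHom W ℂ) (u : CTensor V V) :
    tensorId W η (antiTensor S u) = S (idTensor V (η.comp S) u) := by
  rw [antiTensor, BHom.comp_apply, tensorId_map, tensorId_flip]

end InducedIsomorphism

namespace BornologicalQuantumGroup

variable {H : Type*}
  [NonUnitalRing H] [Module ℂ H] [IsScalarTower ℂ H H] [SMulCommClass ℂ H H]
  [Bornology H] [CompleteBornology H] [BornologicalAlgebra H] (Q : BornologicalQuantumGroup H)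

include Q

theorem mul_idTensor_γr (η : BHom H ℂ) (a p q : H) :
    a * idTensor H η (Q.γr (tmul p q)) =
      idTensor H (η.comp ((mulHom H).flip q)) (Q.ρl (tmul a p)) := by
  simpa only [idTensor_map, BHom.comp_id, BHom.id_apply, mulHom_apply] using
    congrArg (idTensor H η) (Q.mul_left_γr a p q)

theorem mul_idTensor_ρr (η : BHom H ℂ) (a p q : H) :
    a * idTensor H η (Q.ρr (tmul p q)) = idTensor H (η.comp (mulHom H p)) (Q.ρl (tmul a q)) := by
  simpa only [idTensor_map, BHom.comp_id, BHom.id_apply, mulHom_apply] using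
    congrArg (idTensor H η) (Q.mul_left_ρr a p q)

theorem mul_idTensor_γl (η : BHom H ℂ) (a p q : H) :
    a * idTensor H η (Q.γl (tmul p q)) = idTensor H η (Q.ρl (tmul a p)) * q := by
  simpa only [idTensor_map, BHom.comp_id, BHom.flip_apply, mulHom_apply] using
    congrArg (idTensor H η) (Q.mul_left_γl a p q)

theorem tensorId_ρr_mul (ω : BHom H ℂ) (a p q : H) :
    tensorId H ω (Q.ρr (tmul a p)) * q = a * tensorId H ω (Q.γr (tmul p q)) := by
  simpa only [tensorId_map, BHom.comp_id, BHom.flip_apply, mulHom_apply] using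
    (congrArg (tensorId H ω) (Q.mul_right_γr a p q)).symm

theorem tensorId_ρl_mul (ω : BHom H ℂ) (a p q : H) :
    tensorId H ω (Q.ρl (tmul a p)) * q = tensorId H (ω.comp (mulHom H a)) (Q.γr (tmul p q)) := by
  simpa only [tensorId_map, BHom.comp_id, BHom.id_apply, BHom.flip_apply, mulHom_apply] using
    (congrArg (tensorId H ω) (Q.mul_left_γr a p q)).symm

theorem mul_tensorId_γl (ω : BHom H ℂ) (a p q : H) :
    a * tensorId H ω (Q.γl (tmul p q)) =
      tensorId H (ω.comp ((mulHom H).flip q)) (Q.ρr (tmul a p)) := by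
  simpa only [tensorId_map, BHom.comp_id, BHom.id_apply, mulHom_apply] using
    congrArg (tensorId H ω) (Q.mul_right_γl a p q)

theorem idTensor_γr_surjective : Function.Surjective ((idTensor H Q.φ).comp Q.γr) := fun x => by
  obtain ⟨f, hf⟩ := Q.exists_φ_eq_one
  exact ⟨Q.γr_iso.inverse (tmul x f), by simp [hf]⟩

theorem idTensor_ρr_surjective : Function.Surjective ((idTensor H Q.φ).comp Q.ρr) := fun x => by
  obtain ⟨f, hf⟩ := Q.exists_φ_eq_one
  exact ⟨Q.ρr_iso.inverse (tmul x f), by simp [hf]⟩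

theorem γl_mul (b c : H) (x : CTensor H H) :
    Q.γl (tmul b c) * x = (Q.Δ b).left (map (mulHom H c) (BHom.id H) x) :=
  congrArg (fun m => Multiplier.left m x) (Q.γl_spec b c)

theorem mul_ρr (a b : H) (x : CTensor H H) :
    x * Q.ρr (tmul a b) = (Q.Δ b).right (map (BHom.id H) ((mulHom H).flip a) x) :=
  congrArg (fun m => Multiplier.right m x) (Q.ρr_spec a b)

theorem eq_of_map_mul_left {W : Type*} [AddCommGroup W] [Module ℂ W] [Bornology W]
    [CompleteBornology W] (hW : HasSeparatingDual W) {x y : CTensor H W}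
    (h : ∀ p, map (mulHom H p) (BHom.id W) x = map (mulHom H p) (BHom.id W) y) : x = y :=
  sub_eq_zero.1 <| Q.approximation.eq_zero_of_map_left hW (f := fun p => mulHom H p)
    (fun _ => Q.eq_zero_of_mul_left) fun p => by rw [map_sub, h, sub_self]

theorem ρl_ρr_comm (p x c : H) :
    CTensor.assoc H H H (map (Q.ρl.curry p) (BHom.id H) (Q.ρr (tmul x c))) =
      map (BHom.id H) (Q.ρr.curry x) (Q.ρl (tmul p c)) := by
  refine sub_eq_zero.1 (Q.approximation.eq_zero_of_map_id
    (f := fun q => map (BHom.id H) ((mulHom H).flip q)) (fun w =>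
      Q.approximation.eq_zero_of_map_id fun _ => Q.eq_zero_of_mul_right) fun q => ?_)
  rw [map_sub, sub_eq_zero]
  have hγr : (map (BHom.id H) (mulHom H x)).comp (Q.γr.curry.flip q) =
      (map (BHom.id H) ((mulHom H).flip q)).comp (Q.ρr.curry x) :=
    BHom.ext fun y => Q.mul_right_γr x y q
  calc map (BHom.id H) (map (BHom.id H) ((mulHom H).flip q))
        (CTensor.assoc H H H (map (Q.ρl.curry p) (BHom.id H) (Q.ρr (tmul x c))))
      = CTensor.assoc H H H (map (Q.ρl.curry p) (BHom.id H)
          (map (BHom.id H) ((mulHom H).flip q) (Q.ρr (tmul x c)))) := by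
        rw [← assoc_map, map_id_id, CTensor.map_map, CTensor.map_map]; rfl
    _ = map (BHom.id H) (map (BHom.id H) (mulHom H x))
          (CTensor.assoc H H H (map (Q.ρl.curry p) (BHom.id H) (Q.γr (tmul c q)))) := by
        rw [← Q.mul_right_γr, ← assoc_map, map_id_id, CTensor.map_map, CTensor.map_map]; rfl
    _ = map (BHom.id H) (map (BHom.id H) ((mulHom H).flip q))
          (map (BHom.id H) (Q.ρr.curry x) (Q.ρl (tmul p c))) := by
        rw [Q.ρl_γr_comm, CTensor.map_map, CTensor.map_map, BHom.comp_id, hγr]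

theorem γl_ρr_comm (a b c : H) :
    CTensor.assoc H H H (map (Q.γl.curry.flip a) (BHom.id H) (Q.ρr (tmul c b))) =
      map (BHom.id H) (Q.ρr.curry c) (Q.γl (tmul b a)) := by
  refine Q.eq_of_map_mul_left
    (Q.approximation.hasSeparatingDual_tensor Q.hasSeparatingDual) fun p => ?_
  have hγl : (map (mulHom H p) (BHom.id H)).comp (Q.γl.curry.flip a) =
      (map ((mulHom H).flip a) (BHom.id H)).comp (Q.ρl.curry p) :=
    BHom.ext fun y => Q.mul_left_γl p y a
  calc map (mulHom H p) (BHom.id (CTensor H H))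
        (CTensor.assoc H H H (map (Q.γl.curry.flip a) (BHom.id H) (Q.ρr (tmul c b))))
      = map ((mulHom H).flip a) (BHom.id (CTensor H H))
          (CTensor.assoc H H H (map (Q.ρl.curry p) (BHom.id H) (Q.ρr (tmul c b)))) := by
        rw [← map_id_id, ← assoc_map, ← assoc_map, CTensor.map_map, CTensor.map_map, hγl]
    _ = map (BHom.id H) (Q.ρr.curry c)
          (map ((mulHom H).flip a) (BHom.id H) (Q.ρl (tmul p b))) := by
        rw [Q.ρl_ρr_comm, CTensor.map_map, CTensor.map_map]; rfl
    _ = map (mulHom H p) (BHom.id (CTensor H H))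
          (map (BHom.id H) (Q.ρr.curry c) (Q.γl (tmul b a))) := by
        rw [← Q.mul_left_γl, CTensor.map_map, CTensor.map_map]; rfl

theorem ρl_tmul_idTensor_ρr (η : BHom H ℂ) (p x c : H) :
    Q.ρl (tmul p (idTensor H η (Q.ρr (tmul x c)))) =
      map (BHom.id H) ((idTensor H η).comp (Q.ρr.curry x)) (Q.ρl (tmul p c)) := by
  have hcoassoc := congrArg (map (BHom.id H) (idTensor H η)) (Q.ρl_ρr_comm p x c)
  rw [map_id_idTensor_assoc, idTensor_map, CTensor.map_map] at hcoassoc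
  exact hcoassoc

theorem galoisSystem : IsGaloisSystem (mulHom H) Q.ρl Q.γr Q.ρr (fun c => (Q.Δ c).right) where
  L_iso := Q.ρl_iso
  R_iso := Q.γr_iso
  mul_assoc := mul_assoc
  nondeg_left _ hx := Q.eq_zero_of_mul_left hx
  left_R := Q.mul_left_γr
  left_P := Q.mul_left_ρr
  D_tmul := Q.Δ_right_tmul_eq_ρl
  L_mul := Q.ρl_tmul_mul
  coassoc := Q.ρl_γr_comm

theorem galoisSystem_op : IsGaloisSystem (mulHom H).flip (Q.γl.comp (flip H H))
    (Q.ρr.comp (flip H H)) (Q.γr.comp (flip H H)) (fun c => (Q.Δ c).left) where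
  L_iso := Q.γl_iso.comp (isBornIso_flip H H)
  R_iso := Q.ρr_iso.comp (isBornIso_flip H H)
  mul_assoc a b c := (mul_assoc c b a).symm
  nondeg_left _ hx := Q.eq_zero_of_mul_right hx
  left_R a p q := by simpa using! (Q.mul_right_γl q p a).symm
  left_P b x c := by simpa using! Q.γr_mul_right b x c
  D_tmul c p q := by simpa using! Q.Δ_left_tmul_eq_γl c p q
  L_mul a b c := by simpa using! Q.γl_mul_tmul a b c
  coassoc a b c := by
    have hγl : (Q.γl.comp (flip H H)).curry a = Q.γl.curry.flip a := by ext; simp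
    have hρr : (Q.ρr.comp (flip H H)).curry.flip c = Q.ρr.curry c := by ext; simp
    rw [hγl, hρr]
    simpa using Q.γl_ρr_comm a b c

/-- Left invariance `(id ⊗ η) Δ(f) = η(f) 1` of a functional `η`, tested by multiplication from
the left. -/
def IsLeftInvariant (η : BHom H ℂ) : Prop := ∀ g f, idTensor H η (Q.ρl (tmul g f)) = η f • g

theorem isLeftInvariant_φ : Q.IsLeftInvariant Q.φ := fun g f => (Q.leftInvariant f g).2

/-- A counit `ε` and an antipode `S` with inverse `T`, given by the part of the axioms that the
Galois maps yield directly. The field `slice` is the characterization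
`S ((id ⊗ η) (Δ(a) (1 ⊗ b))) = (id ⊗ η) ((1 ⊗ a) Δ(b))` of the antipode. -/
structure IsHopf (ε : BHom H ℂ) (S T : BHom H H) : Prop where
  counit_ρl : ∀ x, idTensor H ε (Q.ρl x) = lift (mulHom H) x
  counit_γr : ∀ x, tensorId H ε (Q.γr x) = lift (mulHom H) x
  counit_mul : ∀ f g, ε (f * g) = ε f * ε g
  antipode_ρl : ∀ x, lift (mulHom H) (map (BHom.id H) S (Q.ρl x)) = idTensor H ε x
  antipode_γr : ∀ x, lift (mulHom H) (map S (BHom.id H) (Q.γr x)) = tensorId H ε x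
  antipode_mul : ∀ f g, S (f * g) = S g * S f
  slice : ∀ η, Q.IsLeftInvariant η → ∀ u, S (idTensor H η (Q.γr u)) = idTensor H η (Q.ρr u)
  left_inv : ∀ x, T (S x) = x
  right_inv : ∀ x, S (T x) = x

theorem exists_isHopf : ∃ ε S T, Q.IsHopf ε S T := by
  have := Q.nontrivial
  obtain ⟨e, he⟩ := Q.exists_φ_eq_one
  have hG := Q.galoisSystem
  have hG_op := Q.galoisSystem_op
  have hφ_op : ∀ g f, idTensor H Q.φ ((Q.γl.comp (flip H H)) (tmul g f)) = Q.φ f • g :=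
    fun g f => by simpa using (Q.leftInvariant f g).1
  obtain ⟨ε, hL, hR⟩ := hG.exists_counit he
  obtain ⟨S, hS⟩ := hG.exists_antipode hR he Q.isLeftInvariant_φ
  obtain ⟨ε_op, -, hR_op⟩ := hG_op.exists_counit he
  obtain ⟨T, hT⟩ := hG_op.exists_antipode hR_op he hφ_op
  have hS_slice := hG.antipode_slice hR hS Q.isLeftInvariant_φ
  have hT_slice : ∀ u, T (idTensor H Q.φ (Q.ρr u)) = idTensor H Q.φ (Q.γr u) := fun u => by
    simpa using hG_op.antipode_slice hR_op hT hφ_op (flip H H u)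
  refine ⟨ε, S, T, hL, hR, hG.counit_mul hL, hG.mul_antipode_L hS, hG.mul_antipode_R hL hR hS,
    hG.antipode_mul hL hS, fun η hη => hG.antipode_slice hR hS hη, fun x => ?_, fun x => ?_⟩
  · obtain ⟨u, rfl⟩ := Q.idTensor_γr_surjective x
    rw [BHom.comp_apply, hS_slice, hT_slice]
  · obtain ⟨u, rfl⟩ := Q.idTensor_ρr_surjective x
    rw [BHom.comp_apply, hT_slice, hS_slice]

end BornologicalQuantumGroup

namespace BornologicalQuantumGroup.IsHopf

variable {H : Type*}
  [NonUnitalRing H] [Module ℂ H] [IsScalarTower ℂ H H] [SMulCommClass ℂ H H]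
  [Bornology H] [CompleteBornology H] [BornologicalAlgebra H] {Q : BornologicalQuantumGroup H}
  {ε : BHom H ℂ} {S T : BHom H H} (hQ : Q.IsHopf ε S T)

include hQ

theorem injective : Function.Injective S := Function.LeftInverse.injective hQ.left_inv

theorem mul_left_comp_antipode (b : H) :
    (mulHom H (S b)).comp S = S.comp ((mulHom H).flip b) :=
  BHom.ext fun x => (hQ.antipode_mul x b).symm

theorem mul_right_comp_antipode (b : H) :
    ((mulHom H).flip (S b)).comp S = S.comp (mulHom H b) :=
  BHom.ext fun x => (hQ.antipode_mul b x).symm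

theorem antiTensor_surjective : Function.Surjective (antiTensor S) := fun x =>
  ⟨antiTensor T x, eq_of_tmul ((antiTensor S).comp (antiTensor T)) (BHom.id _)
    (fun a b => by simp [hQ.right_inv]) x⟩

theorem antiTensor_mul (x y : CTensor H H) :
    antiTensor S (x * y) = antiTensor S y * antiTensor S x :=
  bilin_ext (f := BHom.postcomp (antiTensor S) (mulHom _))
    (g := BHom.flip (BHom.precomp (mulHom _) (antiTensor S) (antiTensor S)))
    (fun v w v' w' => by simp [hQ.antipode_mul]) x y

theorem slice_mul_antipode (b x : H) :
    ((mulHom H).flip (S b)).comp ((idTensor H Q.φ).comp (Q.ρr.curry x)) =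
      S.comp (contractRight (BHom.postcomp Q.φ (mulHom H)).flip (Q.ρl (tmul b x))) := by
  ext y
  calc idTensor H Q.φ (Q.ρr (tmul x y)) * S b
      = S (b * idTensor H Q.φ (Q.γr (tmul x y))) := by
        rw [hQ.antipode_mul, hQ.slice _ Q.isLeftInvariant_φ]
    _ = S (contractRight (BHom.postcomp Q.φ (mulHom H)).flip (Q.ρl (tmul b x)) y) := by
        rw [Q.mul_idTensor_γr, contractRight_apply]; rfl

theorem mul_antipode_galoisSlice (p c : H) :
    ((mulHom H p).comp S).comp (galoisSlice Q.γr Q.φ c) =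
      contractRight (BHom.postcomp Q.φ (mulHom H)) (Q.ρl (tmul p c)) := by
  ext y
  calc p * S (idTensor H Q.φ (Q.γr (tmul y c)))
      = idTensor H (Q.φ.comp (mulHom H y)) (Q.ρl (tmul p c)) := by
        rw [hQ.slice _ Q.isLeftInvariant_φ, Q.mul_idTensor_ρr]
    _ = contractRight (BHom.postcomp Q.φ (mulHom H)) (Q.ρl (tmul p c)) y := by
        rw [contractRight_apply]; rfl

theorem γr_antipode (h b : H) : Q.γr (tmul (S h) (S b)) = antiTensor S (Q.ρl (tmul b h)) := by
  refine eq_of_surjective Q.idTensor_γr_surjective ((Q.γr.curry.flip (S b)).comp S)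
    ((antiTensor S).comp (Q.ρl.curry b)) (fun x c => ?_) h
  refine Q.eq_of_map_mul_left Q.hasSeparatingDual fun p => ?_
  let β := BHom.postcomp Q.φ (mulHom H)
  have hρl : Q.ρl (tmul b (idTensor H Q.φ (Q.γr (tmul x c)))) =
      map (BHom.id H) (galoisSlice Q.γr Q.φ c) (Q.ρl (tmul b x)) := by
    rw [← Q.galoisSystem.L_slice, map_tmul]; rfl
  calc map (mulHom H p) (BHom.id H)
        (Q.γr (tmul (S (idTensor H Q.φ (Q.γr (tmul x c)))) (S b)))
      = map (BHom.id H) (((mulHom H).flip (S b)).comp ((idTensor H Q.φ).comp (Q.ρr.curry x)))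
          (Q.ρl (tmul p c)) := by
        rw [Q.mul_left_γr, hQ.slice _ Q.isLeftInvariant_φ, Q.ρl_tmul_idTensor_ρr,
          CTensor.map_map, BHom.comp_id]
    _ = map (contractRight β (Q.ρl (tmul p c))) S (flip H H (Q.ρl (tmul b x))) := by
        rw [hQ.slice_mul_antipode, map_contractRight_flip]
    _ = map (mulHom H p) (BHom.id H)
          (antiTensor S (Q.ρl (tmul b (idTensor H Q.φ (Q.γr (tmul x c)))))) := by
        rw [hρl, antiTensor, BHom.comp_apply, flip_map, CTensor.map_map, CTensor.map_map,
          ← hQ.mul_antipode_galoisSlice]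
        rfl

theorem Δ_antipode_left (h : H) (x : CTensor H H) :
    (Q.Δ (S h)).left (antiTensor S x) = antiTensor S ((Q.Δ h).right x) := by
  refine eq_of_tmul ((Q.Δ (S h)).left.comp (antiTensor S)) ((antiTensor S).comp (Q.Δ h).right)
    (fun a b => ?_) x
  rw [BHom.comp_apply, BHom.comp_apply, antiTensor_tmul, Q.Δ_left_tmul_eq_γr,
    Q.Δ_right_tmul_eq_ρl, hQ.γr_antipode,
    map_antiTensor (hQ.mul_right_comp_antipode b) (g' := BHom.id H) (f' := BHom.id H) rfl]

theorem eq_of_mul_antiTensor {x y : CTensor H H}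
    (h : ∀ u, x * antiTensor S u = y * antiTensor S u) : x = y :=
  sub_eq_zero.1 (Q.tensor_eq_zero_of_mul_right fun z => by
    obtain ⟨u, rfl⟩ := hQ.antiTensor_surjective z
    rw [sub_mul, h, sub_self])

theorem eq_of_antiTensor_mul {x y : CTensor H H}
    (h : ∀ u, antiTensor S u * x = antiTensor S u * y) : x = y :=
  sub_eq_zero.1 (Q.tensor_eq_zero_of_mul_left fun z => by
    obtain ⟨u, rfl⟩ := hQ.antiTensor_surjective z
    rw [mul_sub, h, sub_self])

theorem Δ_antipode_right (h : H) (x : CTensor H H) :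
    (Q.Δ (S h)).right (antiTensor S x) = antiTensor S ((Q.Δ h).left x) := by
  refine hQ.eq_of_mul_antiTensor fun v => ?_
  rw [← Multiplier.compat, hQ.Δ_antipode_left, ← hQ.antiTensor_mul, ← hQ.antiTensor_mul,
    ← Multiplier.compat]

theorem ρl_antipode (h b : H) : Q.ρl (tmul (S b) (S h)) = antiTensor S (Q.γr (tmul h b)) := by
  refine hQ.eq_of_antiTensor_mul fun u => ?_
  rw [Q.mul_ρl, ← hQ.antiTensor_mul, Q.γr_mul, ← hQ.Δ_antipode_right,
    map_antiTensor (hQ.mul_right_comp_antipode b) (g' := BHom.id H) (f' := BHom.id H) rfl]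

theorem γl_antipode (h b : H) : Q.γl (tmul (S h) (S b)) = antiTensor S (Q.ρr (tmul b h)) := by
  refine hQ.eq_of_mul_antiTensor fun u => ?_
  rw [Q.γl_mul, ← hQ.antiTensor_mul, Q.mul_ρr, ← hQ.Δ_antipode_left,
    map_antiTensor (hQ.mul_left_comp_antipode b) (g' := BHom.id H) (f' := BHom.id H) rfl]

theorem ρr_antipode (h b : H) : Q.ρr (tmul (S b) (S h)) = antiTensor S (Q.γl (tmul h b)) := by
  refine hQ.eq_of_antiTensor_mul fun u => ?_
  rw [Q.mul_ρr, ← hQ.antiTensor_mul, Q.γl_mul, ← hQ.Δ_antipode_right,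
    map_antiTensor (S := S) (g := BHom.id H) (f := BHom.id H) rfl (hQ.mul_right_comp_antipode b)]

theorem counit_γl (f g : H) : idTensor H ε (Q.γl (tmul f g)) = f * g :=
  Q.eq_of_mul_left fun c => by
    rw [Q.mul_idTensor_γl, hQ.counit_ρl, lift_tmul, mulHom_apply, mul_assoc]

theorem counit_ρr (f g : H) : tensorId H ε (Q.ρr (tmul g f)) = g * f :=
  Q.eq_of_mul_right fun c => by
    rw [Q.tensorId_ρr_mul, hQ.counit_γr, lift_tmul, mulHom_apply, mul_assoc]

theorem idTensor_counit_γr (u : CTensor H H) : idTensor H ε (Q.γr u) = idTensor H ε u := by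
  refine eq_of_tmul ((idTensor H ε).comp Q.γr) (idTensor H ε)
    (fun x y => Q.eq_of_mul_left fun c => ?_) u
  have hε : ε.comp ((mulHom H).flip y) = ε y • ε := by
    ext z
    simp [hQ.counit_mul, mul_comm]
  rw [BHom.comp_apply, Q.mul_idTensor_γr, hε, idTensor_smul, hQ.counit_ρl, lift_tmul,
    mulHom_apply, idTensor_tmul, mul_smul_comm]

theorem tensorId_counit_ρl (u : CTensor H H) : tensorId H ε (Q.ρl u) = tensorId H ε u := by
  refine eq_of_tmul ((tensorId H ε).comp Q.ρl) (tensorId H ε)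
    (fun x y => Q.eq_of_mul_right fun c => ?_) u
  have hε : ε.comp (mulHom H x) = ε x • ε := by
    ext z
    simp [hQ.counit_mul]
  rw [BHom.comp_apply, Q.tensorId_ρl_mul, hε, tensorId_smul, hQ.counit_γr, lift_tmul,
    mulHom_apply, tensorId_tmul, smul_mul_assoc]

theorem exists_counit_eq_one : ∃ e, ε e = 1 := by
  have := Q.nontrivial
  obtain ⟨x, hx⟩ := exists_ne (0 : H)
  obtain ⟨g, hg⟩ : ∃ g, ε g ≠ 0 := by
    by_contra! hε
    refine hx (Q.eq_zero_of_mul_left fun b => ?_)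
    calc b * x = idTensor H ε (Q.ρl (tmul b x)) := by rw [hQ.counit_ρl, lift_tmul, mulHom_apply]
      _ = 0 := eq_of_tmul (idTensor H ε) 0 (fun v w => by simp [hε]) _
  exact ⟨(ε g)⁻¹ • g, by rw [map_smul, smul_eq_mul, inv_mul_cancel₀ hg]⟩

section Essential

variable {X : Type*} [AddCommGroup X] [Module ℂ X] [Bornology X] [CompleteBornology X]

theorem map_eq_counit_smul_of_mul_right {e : H} (he : ε e = 1) {Φ : BHom H X}
    (hΦ : ∀ x y, Φ (x * y) = ε y • Φ x) (b : H) : Φ b = ε b • Φ e := by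
  have hmul : ∀ u, Φ (lift (mulHom H) u) = Φ (idTensor H ε u) :=
    eq_of_tmul (Φ.comp (lift (mulHom H))) (Φ.comp (idTensor H ε)) fun x y => by simp [hΦ]
  obtain ⟨u, hu⟩ := Q.γr_iso.1.2 (tmul e b)
  specialize hmul u
  rwa [← hQ.counit_γr, ← hQ.idTensor_counit_γr, hu, tensorId_tmul, idTensor_tmul, he, one_smul,
    map_smul] at hmul

theorem map_eq_counit_smul_of_mul_left {e : H} (he : ε e = 1) {Φ : BHom H X}
    (hΦ : ∀ x y, Φ (x * y) = ε x • Φ y) (b : H) : Φ b = ε b • Φ e := by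
  have hmul : ∀ u, Φ (lift (mulHom H) u) = Φ (tensorId H ε u) :=
    eq_of_tmul (Φ.comp (lift (mulHom H))) (Φ.comp (tensorId H ε)) fun x y => by simp [hΦ]
  obtain ⟨u, hu⟩ := Q.ρl_iso.1.2 (tmul b e)
  specialize hmul u
  rwa [← hQ.counit_ρl, ← hQ.tensorId_counit_ρl, hu, tensorId_tmul, idTensor_tmul, he, one_smul,
    map_smul] at hmul

end Essential

theorem counit_essential_left : InducesIso (A := H) (V := H) (W := ℂ) (X := ℂ) (· * ·)
    (fun h z => ε h * z) (fun h z => ε h * z) := by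
  obtain ⟨e, he⟩ := hQ.exists_counit_eq_one
  have hiso := InducesIso.of_inverse (r := (· * ·)) (l := fun (h : H) (z : ℂ) => ε h * z)
    (tensorId ℂ ε) (fun v a w => by simp [hQ.counit_mul, mul_assoc]) (tmulHom H ℂ e)
    (fun x => by simp [he]) (fun b z => ?_)
  · simpa using hiso
  · have hmk := hQ.map_eq_counit_smul_of_mul_right he (b := b)
      (Φ := (BalancedTensor.mk (· * ·) fun (h : H) (z : ℂ) => ε h * z).comp
        ((tmulHom H ℂ).flip z)) fun x y => by
        simp only [BHom.comp_apply, BHom.flip_apply, tmulHom_apply]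
        rw [BalancedTensor.mk_tmul, ← smul_eq_mul, tmul_smul, map_smul]
    rw [tensorId_tmul, tmulHom_apply, tmul_smul, map_smul]
    exact hmk.symm

theorem counit_essential_right : InducesIso (A := H) (V := ℂ) (W := H) (X := ℂ)
    (fun z h => z * ε h) (· * ·) (fun z h => z * ε h) := by
  obtain ⟨e, he⟩ := hQ.exists_counit_eq_one
  have hiso := InducesIso.of_inverse (r := fun (z : ℂ) (h : H) => z * ε h) (l := (· * ·))
    (idTensor ℂ ε) (fun v a w => by simp [hQ.counit_mul, mul_left_comm, mul_comm])
    ((tmulHom ℂ H).flip e) (fun x => by simp [he]) (fun z b => ?_)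
  · simpa [mul_comm] using hiso
  · have hmk := hQ.map_eq_counit_smul_of_mul_left he (b := b)
      (Φ := (BalancedTensor.mk (fun (z : ℂ) (h : H) => z * ε h) (· * ·)).comp
        (tmulHom ℂ H z)) fun x y => by
        simp only [BHom.comp_apply, tmulHom_apply]
        rw [← BalancedTensor.mk_tmul, mul_comm, ← smul_eq_mul, CTensor.smul_tmul, map_smul]
    rw [idTensor_tmul, BHom.flip_apply, tmulHom_apply, CTensor.smul_tmul, map_smul]
    exact hmk.symm

theorem isCounitAntipode : IsCounitAntipode Q ε S where
  counit_mul := hQ.counit_mul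
  counit_essential := ⟨hQ.counit_essential_left, hQ.counit_essential_right⟩
  counit_left f g := ⟨by simpa using hQ.counit_γr (tmul f g), hQ.counit_ρr f g⟩
  counit_right f g := ⟨hQ.counit_γl f g, by simpa using hQ.counit_ρl (tmul g f)⟩
  antipode_iso := .of_inverse T hQ.left_inv hQ.right_inv
  antipode_mul := hQ.antipode_mul
  antipode_comul h x := ⟨hQ.Δ_antipode_left h x, hQ.Δ_antipode_right h x⟩
  antipode_left := hQ.antipode_γr
  antipode_right := hQ.antipode_ρl

theorem counit_unique {ε' : BHom H ℂ} {S' : BHom H H} (h : IsCounitAntipode Q ε' S') :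
    ε' = ε := by
  have := Q.nontrivial
  obtain ⟨x, hx⟩ := exists_ne (0 : H)
  ext y
  have hslice : idTensor H ε' (tmul x y) = idTensor H ε (tmul x y) :=
    eq_of_surjective Q.ρl_iso.1.2 (idTensor H ε') (idTensor H ε) (fun g f => by
      rw [(h.counit_right f g).2, hQ.counit_ρl, lift_tmul, mulHom_apply]) _
  rw [idTensor_tmul, idTensor_tmul] at hslice
  exact smul_left_injective ℂ hx hslice

theorem antipode_unique {S' : BHom H H} (h : IsCounitAntipode Q ε S') : S' = S :=
  BHom.ext fun y => Q.eq_of_mul_right fun b => by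
    obtain ⟨u, hu⟩ := Q.γr_iso.1.2 (tmul y b)
    simpa [hu] using (h.antipode_left u).trans (hQ.antipode_γr u).symm

theorem eq_of_isCounitAntipode {ε' : BHom H ℂ} {S' : BHom H H} (h : IsCounitAntipode Q ε' S') :
    ε' = ε ∧ S' = S := by
  obtain rfl := hQ.counit_unique h
  exact ⟨rfl, hQ.antipode_unique h⟩

end BornologicalQuantumGroup.IsHopf

/-! ## The modular automorphism -/

namespace BornologicalQuantumGroup

variable {H : Type*}
  [NonUnitalRing H] [Module ℂ H] [IsScalarTower ℂ H H] [SMulCommClass ℂ H H]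
  [Bornology H] [CompleteBornology H] [BornologicalAlgebra H] (Q : BornologicalQuantumGroup H)

theorem eq_of_φ_mul_left {x y : H} (h : ∀ z, Q.φ (z * x) = Q.φ (z * y)) : x = y :=
  sub_eq_zero.1 (Q.faithful.2 _ fun z => by rw [mul_sub, map_sub, h, sub_self])

theorem eq_of_φ_mul_right {x y : H} (h : ∀ z, Q.φ (x * z) = Q.φ (y * z)) : x = y :=
  sub_eq_zero.1 (Q.faithful.1 _ fun z => by rw [sub_mul, map_sub, h, sub_self])

theorem ρr_mul_tmul (z x c : H) :
    Q.ρr (tmul (z * x) c) = map (BHom.id H) (mulHom H z) (Q.ρr (tmul x c)) := by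
  have hmul : (mulHom H z).comp (mulHom H x) = mulHom H (z * x) :=
    BHom.ext fun y => (mul_assoc z x y).symm
  refine Q.eq_of_map_mul_left Q.hasSeparatingDual fun p => ?_
  calc map (mulHom H p) (BHom.id H) (Q.ρr (tmul (z * x) c))
      = map (BHom.id H) (mulHom H z) (map (BHom.id H) (mulHom H x) (Q.ρl (tmul p c))) := by
        rw [Q.mul_left_ρr, CTensor.map_map, BHom.id_comp, hmul]
    _ = map (mulHom H p) (BHom.id H) (map (BHom.id H) (mulHom H z) (Q.ρr (tmul x c))) := by
        rw [← Q.mul_left_ρr, CTensor.map_map, CTensor.map_map]; rfl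

/-- The defining property `φ(f g) = φ(g σ(f))` of the modular automorphism `σ` of `φ`. -/
def IsModular (σ : H → H) : Prop := ∀ f g, Q.φ (f * g) = Q.φ (g * σ f)

namespace IsModular

variable {Q}

theorem eq {σ σ' : H → H} (hσ : Q.IsModular σ) (hσ' : Q.IsModular σ') : σ = σ' :=
  funext fun _ => Q.eq_of_φ_mul_left fun z => by rw [← hσ, ← hσ']

theorem map_mul {σ : H → H} (hσ : Q.IsModular σ) (x y : H) : σ (x * y) = σ x * σ y :=
  Q.eq_of_φ_mul_left fun z => by rw [← hσ, mul_assoc, hσ, mul_assoc, hσ, mul_assoc]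

/-- A bounded linear map with the modular property, as an algebra homomorphism. -/
def algHom {σ : BHom H H} (hσ : Q.IsModular σ) : H →ₙₐ[ℂ] H where
  toFun := σ
  map_smul' := map_smul σ
  map_zero' := map_zero σ
  map_add' := map_add σ
  map_mul' := hσ.map_mul

theorem isBornIso {σ τ : BHom H H} (hσ : Q.IsModular σ)
    (hτ : ∀ f g, Q.φ (g * f) = Q.φ (τ f * g)) : IsBornIso σ :=
  .of_inverse τ (fun x => Q.eq_of_φ_mul_right fun z => by rw [← hτ, ← hσ])
    fun x => Q.eq_of_φ_mul_left fun z => by rw [← hσ, ← hτ]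

theorem φ_apply {σ : BHom H H} (hσ : Q.IsModular σ) (f : H) : Q.φ (σ f) = Q.φ f :=
  eq_of_surjective Q.mul_surjective (Q.φ.comp σ) Q.φ (fun f g =>
    calc Q.φ (σ (lift (mulHom H) (tmul f g)))
        = Q.φ (σ f * σ g) := by rw [lift_tmul, mulHom_apply, hσ.map_mul]
      _ = Q.φ (f * g) := by rw [← hσ, ← hσ]
      _ = Q.φ (lift (mulHom H) (tmul f g)) := by rw [lift_tmul, mulHom_apply]) f

end IsModular

namespace IsHopf

variable {Q} {ε : BHom H ℂ} {S T : BHom H H} (hQ : Q.IsHopf ε S T)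

include hQ

theorem γr_rightInvariant (h b : H) :
    tensorId H (Q.φ.comp S) (Q.γr (tmul h b)) = Q.φ (S h) • b := by
  apply hQ.injective
  rw [← idTensor_antiTensor, ← hQ.ρl_antipode, Q.isLeftInvariant_φ, map_smul]

theorem ρr_rightInvariant (b h : H) :
    tensorId H (Q.φ.comp S) (Q.ρr (tmul b h)) = Q.φ (S h) • b := by
  apply hQ.injective
  rw [← idTensor_antiTensor, ← hQ.γl_antipode, (Q.leftInvariant _ _).1, map_smul]

theorem isLeftInvariant_antipode_sq : Q.IsLeftInvariant ((Q.φ.comp S).comp S) := fun g f => by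
  apply hQ.injective
  rw [← tensorId_antiTensor, ← hQ.γr_antipode, hQ.γr_rightInvariant, map_smul]
  rfl

theorem apply_tensorId_ρr {η : BHom H ℂ} (hη : Q.IsLeftInvariant η) (x c : H) :
    η (tensorId H Q.φ (Q.ρr (tmul x c))) = Q.φ (S x) * η c :=
  calc η (tensorId H Q.φ (Q.ρr (tmul x c)))
      = Q.φ (S (idTensor H η (Q.γr (tmul x c)))) := by rw [← apply_idTensor, hQ.slice η hη]
    _ = η (tensorId H (Q.φ.comp S) (Q.γr (tmul x c))) := apply_idTensor (Q.φ.comp S) η _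
    _ = Q.φ (S x) * η c := by rw [hQ.γr_rightInvariant, map_smul, smul_eq_mul]

theorem apply_eq_zero_of_isLeftInvariant {η : BHom H ℂ} (hη : Q.IsLeftInvariant η) {c : H}
    (hc : Q.φ c = 0) : η c = 0 := by
  obtain ⟨f, hf⟩ := Q.exists_φ_eq_one
  have hslice : tensorId H Q.φ (Q.ρr (tmul (T f) c)) = 0 := Q.faithful.2 _ fun z => by
    calc Q.φ (z * tensorId H Q.φ (Q.ρr (tmul (T f) c)))
        = Q.φ (tensorId H Q.φ (Q.ρr (tmul (z * T f) c))) := by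
          rw [Q.ρr_mul_tmul, tensorId_map, BHom.comp_id, mulHom_apply]
      _ = 0 := by rw [hQ.apply_tensorId_ρr Q.isLeftInvariant_φ, hc, mul_zero]
  calc η c = Q.φ (S (T f)) * η c := by rw [hQ.right_inv, hf, one_mul]
    _ = 0 := by rw [← hQ.apply_tensorId_ρr hη, hslice, map_zero]

theorem isLeftInvariant_unique {η : BHom H ℂ} (hη : Q.IsLeftInvariant η) :
    ∃ ν : ℂ, ∀ c, η c = ν * Q.φ c := by
  obtain ⟨f, hf⟩ := Q.exists_φ_eq_one
  refine ⟨η f, fun c => ?_⟩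
  have hη_sub : η (c - Q.φ c • f) = 0 :=
    hQ.apply_eq_zero_of_isLeftInvariant hη (by simp [hf])
  rwa [map_sub, map_smul, sub_eq_zero, smul_eq_mul, mul_comm] at hη_sub

theorem antipode_sq_comm {σ : H → H} (hσ : Q.IsModular σ) (f : H) :
    S (S (σ f)) = σ (S (S f)) := by
  obtain ⟨ν, hν⟩ := hQ.isLeftInvariant_unique hQ.isLeftInvariant_antipode_sq
  have hν_sq : ∀ c, Q.φ (S (S c)) = ν * Q.φ c := hν
  have hmul : ∀ x y, S (S (x * y)) = S (S x) * S (S y) := fun x y => by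
    rw [hQ.antipode_mul, hQ.antipode_mul]
  refine Q.eq_of_φ_mul_left fun z => ?_
  obtain ⟨g, rfl⟩ : ∃ g, S (S g) = z := ⟨T (T z), by rw [hQ.right_inv, hQ.right_inv]⟩
  calc Q.φ (S (S g) * S (S (σ f))) = ν * Q.φ (g * σ f) := by rw [← hmul, hν_sq]
    _ = Q.φ (S (S f) * S (S g)) := by rw [← hσ, ← hν_sq, hmul]
    _ = Q.φ (S (S g) * σ (S (S f))) := hσ _ _

theorem antipode_slice_ρl (b h : H) : S (tensorId H (Q.φ.comp S) (Q.ρl (tmul b h))) =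
    tensorId H (Q.φ.comp S) (Q.γl (tmul b h)) := by
  apply hQ.injective
  rw [← idTensor_antiTensor, ← idTensor_antiTensor, ← hQ.γr_antipode, ← hQ.ρr_antipode,
    hQ.slice _ Q.isLeftInvariant_φ]

theorem φ_mul_tensorId_γl (a c x : H) :
    Q.φ (x * tensorId H Q.φ (Q.γl (tmul c (S a)))) =
      Q.φ (S (idTensor H (Q.φ.comp T) (Q.ρr (tmul (S c) a)) * x)) :=
  calc Q.φ (x * tensorId H Q.φ (Q.γl (tmul c (S a))))
      = Q.φ (idTensor H Q.φ (Q.ρr (tmul x c)) * S a) := by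
        rw [Q.mul_tensorId_γl, ← apply_idTensor]; rfl
    _ = Q.φ (S (a * idTensor H Q.φ (Q.γr (tmul x c)))) := by
        rw [hQ.antipode_mul, hQ.slice _ Q.isLeftInvariant_φ]
    _ = Q.φ (tensorId H (Q.φ.comp S) (Q.ρl (tmul a x)) * c) := by
        rw [Q.mul_idTensor_γr]
        exact apply_idTensor (Q.φ.comp S) (Q.φ.comp ((mulHom H).flip c)) _
    _ = Q.φ (T (S c * tensorId H (Q.φ.comp S) (Q.γl (tmul a x)))) := by
        rw [← hQ.antipode_slice_ρl, ← hQ.antipode_mul, hQ.left_inv]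
    _ = Q.φ (S (idTensor H (Q.φ.comp T) (Q.ρr (tmul (S c) a)) * x)) := by
        rw [Q.mul_tensorId_γl]
        exact (apply_idTensor ((Q.φ.comp S).comp ((mulHom H).flip x)) (Q.φ.comp T) _).symm

theorem φ_antipode_tensorId_mul (y : CTensor H H) (x : H) :
    Q.φ (S (tensorId H Q.φ (Q.ρr_iso.inverse y) * x)) =
      Q.φ (tensorId H (Q.φ.comp S) (Q.ρl_iso.inverse y) * x) := by
  have hρr := eq_of_surjective Q.ρr_iso.1.2
    (Q.φ.comp ((S.comp ((mulHom H).flip x)).comp ((tensorId H Q.φ).comp Q.ρr_iso.inverse)))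
    (Q.φ.comp ((tensorId H (Q.φ.comp S)).comp (Q.Δ x).right)) (fun a b => by
      simp only [BHom.comp_apply]
      rw [← Q.ρr_tmul_mul, hQ.ρr_rightInvariant, IsBornIso.inverse_apply]
      simp [mul_comm]) y
  have hρl := eq_of_surjective Q.ρl_iso.1.2
    (Q.φ.comp (((mulHom H).flip x).comp ((tensorId H (Q.φ.comp S)).comp Q.ρl_iso.inverse)))
    (Q.φ.comp ((tensorId H (Q.φ.comp S)).comp (Q.Δ x).right)) (fun a b => by
      simp only [BHom.comp_apply]
      rw [← Q.ρl_tmul_mul, ← apply_idTensor, Q.isLeftInvariant_φ, IsBornIso.inverse_apply]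
      simp [mul_comm]) y
  exact hρr.trans hρl.symm

theorem exists_φ_mul_eq_φ_antipode_mul : ∃ α β : BHom H H,
    (∀ d x, Q.φ (x * d) = Q.φ (S (α d * x))) ∧ ∀ d x, Q.φ (x * β d) = Q.φ (S (d * x)) := by
  obtain ⟨f, hf⟩ := Q.exists_φ_eq_one
  have hST : S.comp T = BHom.id H := BHom.ext hQ.right_inv
  let A := (tensorId H Q.φ).comp (Q.γl.comp (map (BHom.id H) S))
  let B := (idTensor H (Q.φ.comp T)).comp (Q.ρr.comp (map S (BHom.id H)))
  have hAB : ∀ y x, Q.φ (x * A y) = Q.φ (S (B y * x)) := fun y x =>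
    eq_of_tmul ((Q.φ.comp (mulHom H x)).comp A)
      ((Q.φ.comp (S.comp ((mulHom H).flip x))).comp B)
      (fun c a => by simpa [A, B] using hQ.φ_mul_tensorId_γl a c x) y
  let sA := (map (BHom.id H) T).comp (Q.γl_iso.inverse.comp (tmulHom H H f))
  let sB := (map T (BHom.id H)).comp (Q.ρr_iso.inverse.comp ((tmulHom H H).flip (S f)))
  have hA : ∀ d, A (sA d) = d := fun d => by simp [A, sA, CTensor.map_map, hST, hf]
  have hB : ∀ d, B (sB d) = d := fun d => by
    simp [B, sB, CTensor.map_map, hST, hf, hQ.left_inv]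
  refine ⟨B.comp sA, A.comp sB, fun d x => ?_, fun d x => ?_⟩
  · rw [BHom.comp_apply, ← hAB, hA]
  · rw [BHom.comp_apply, hAB, hB]

theorem exists_φ_antipode_mul_eq_φ_mul : ∃ α β : BHom H H,
    (∀ d x, Q.φ (S (d * x)) = Q.φ (α d * x)) ∧ ∀ d x, Q.φ (S (β d * x)) = Q.φ (d * x) := by
  obtain ⟨f, hf⟩ := Q.exists_φ_eq_one
  refine ⟨(tensorId H (Q.φ.comp S)).comp (Q.ρl_iso.inverse.comp (Q.ρr.comp (tmulHom H H f))),
    (tensorId H Q.φ).comp (Q.ρr_iso.inverse.comp (Q.ρl.comp (tmulHom H H (T f)))),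
    fun d x => ?_, fun d x => ?_⟩
  · simpa [hf] using hQ.φ_antipode_tensorId_mul (Q.ρr (tmul f d)) x
  · simpa [hf, hQ.right_inv] using hQ.φ_antipode_tensorId_mul (Q.ρl (tmul (T f) d)) x

theorem exists_isModular : ∃ σ τ : BHom H H,
    Q.IsModular σ ∧ ∀ f g, Q.φ (g * f) = Q.φ (τ f * g) := by
  obtain ⟨α, β, hα, hβ⟩ := hQ.exists_φ_mul_eq_φ_antipode_mul
  obtain ⟨α', β', hα', hβ'⟩ := hQ.exists_φ_antipode_mul_eq_φ_mul
  refine ⟨β.comp β', α'.comp α, fun f g => ?_, fun f g => ?_⟩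
  · rw [BHom.comp_apply, hβ, hβ']
  · rw [BHom.comp_apply, hα, hα']

end IsHopf

end BornologicalQuantumGroup

end BornQG

end

theorem mainTheorem8 {H : Type*} [NonUnitalRing H] [Module ℂ H] [IsScalarTower ℂ H H]
    [SMulCommClass ℂ H H] [Bornology H] [BornQG.CompleteBornology H] [BornQG.BornologicalAlgebra H]
    (Q : BornQG.BornologicalQuantumGroup H) :
    ∃ σ : H →ₙₐ[ℂ] H, BornQG.IsBornIso σ ∧ (∀ f g : H, Q.φ (f * g) = Q.φ (g * σ f)) ∧
      (∀ σ' : H →ₙₐ[ℂ] H, (∀ f g : H, Q.φ (f * g) = Q.φ (g * σ' f)) → σ' = σ) ∧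
      (∀ f : H, Q.φ (σ f) = Q.φ f) ∧
      ∃ (ε : BornQG.BHom H ℂ) (S : BornQG.BHom H H), BornQG.IsCounitAntipode Q ε S ∧
        (∀ (ε' : BornQG.BHom H ℂ) (S' : BornQG.BHom H H),
          BornQG.IsCounitAntipode Q ε' S' → ε' = ε ∧ S' = S) ∧
        ∀ f : H, S (S (σ f)) = σ (S (S f)) := by
  obtain ⟨ε, S, T, hQ⟩ := Q.exists_isHopf
  obtain ⟨σ, τ, hσ, hτ⟩ := hQ.exists_isModular
  exact ⟨hσ.algHom, hσ.isBornIso hτ, hσ,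
    fun σ' (hσ' : Q.IsModular σ') => DFunLike.coe_injective (hσ'.eq hσ), hσ.φ_apply, ε, S,
    hQ.isCounitAntipode, fun _ _ => hQ.eq_of_isCounitAntipode, hQ.antipode_sq_comm hσ⟩
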